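/- **Setting.** A nonlocal game $\mathcal G=(\mathcal X^2,\mathcal A^2,\mu,V)$ consists of finite sets $\mathcal X,\mathcal A$, a probability distribution $\mu$ on $\mathcal X\times\mathcal X$ and $V:\mathcal X^2\times\mathcal A^2\to\{0,1\}$; it is *synchronous* if $V(x,x,a,b)=\delta_{a,b}$ for all $x,a,b$. A *POVM* is a finite family of positive bounded operators with sum $\mathbb 1$. A *commuting operator strategy* $\mathscr S$ consists of a unit vector $|\psi\rangle$ in a Hilbert space and POVMs $\{A^x_a\}_{a\in\mathcal A}$, $\{B^y_b\}_{b\in\mathcal A}$ ($x,y\in\mathcal X$) with $[A^x_a,B^y_b]=0$. Its correlation is $C_{x,y,a,b}=\langle\psi|A^x_aB^y_b|\psi\rangle$, and its winning probability is $\omega(\mathcal G,\mathscr S)=\sum_{x,y}\mu(x,y)\sum_{a,b}V(x,y,a,b)\,C_{x,y,a,b}$. The synchronicity of a correlation is $\delta_{\rm sync}(\mathcal G,C)=\sum_x\mu_1(x)\sum_{a\ne b}C_{x,x,a,b}$, where $\mu_1(x)=\sum_y\mu(x,y)$; put also $\mu_2(x)=\sum_y\mu(y,x)$. A correlation or strategy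 is *$\delta$-synchronous* if its synchronicity is at most $\delta$, and *synchronous* if $C_{x,x,a,b}=0$ for all $x$ and all $a\neq b$. Let $(\mathscr A,\tau)$ be a tracial von Neumann algebra (with faithful normal tracial state $\tau$) in standard form on $L^2(\mathscr A,\tau)$ with trace vector $|\tau\rangle$; for $a\in\mathscr A$ let $a^{op}$ be the operator with $a^{op}(m|\tau\rangle)=ma|\tau\rangle$ for $m\in\mathscr A$. A strategy is *tracial embedded* in $(\mathscr A,\tau)$ if $|\psi\rangle=\sigma|\tau\rangle$ for some $\sigma\in\mathscr A$, all $A^x_a\in\mathscr A$ and all $B^y_b\in\mathscr A'$. A *synchronous tracial strategy* is a tracial embedded strategy with $\sigma=\mathbb 1$ and $B^x_a=(A^x_a)^{op}$ whose correlation is synchronous. Given a probability distribution $\rho$ on $\mathcal X\times\mathcal Y$ and maps $g_{xy}:\mathcal A\to2^{\mathcal B}$, a strategy tracial embedded in $(\mathscr A,\tau)$ has the *soundness property at level $v$* if there are POVMs $\{G^y_b\}_{b\in\mathcal B}\subseteq\mathscr A$ ($y\in\mathcal Y$) with $$\mathbb E_{(x,y)\sim\rho}\sum_{a\in\mathcal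 A}\langle\psi|A^x_a\,(G^y_{g_{xy}(a)})^{op}|\psi\rangle\ \ge\ v,\qquad G^y_{g_{xy}(a)}=\sum_{b\in g_{xy}(a)}G^y_b .$$ **Statement.** There is an absolute constant $q>0$ such that for all real $K,L$ there is a constant $c>0$, depending only on $K$ and $L$, with the following property. Let $\mathcal G$ be a synchronous game with $\mu_2(x)\le L\,\mu_1(x)$ for all $x$ (for instance $\mu_1=\mu_2$ and $L=1$). Let $\mathcal Y,\mathcal B$ be finite sets and let $\rho$ be a probability distribution on $\mathcal X\times\mathcal Y$ with first marginal $\rho_1$ such that, for every $\delta$ and every $\delta$-synchronous commuting operator correlation $C$, $$\sum_x\rho_1(x)\sum_{a\neq b}C_{x,x,a,b}\le K\delta .$$ For every $(x,y)\in\mathcal X\times\mathcal Y$ let $g_{xy}:\mathcal A\to2^{\mathcal B}$ be such that the sets $g_{xy}(a)$, $a\in\mathcal A$, are pairwise disjoint. Let $\kappa:[0,1]\to\mathbb R_{\ge0}$ be convex and nondecreasing and let $c_0>0$. Suppose that every synchronous tracial strategy $\mathscr S^{\rm sync}$, on any tracial von Neumann algebra, has the soundness property at level $c_0\,\kappa(\omega(\mathcal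 G,\mathscr S^{\rm sync}))$. Then for every $\delta$, every tracial embedded $\delta$-synchronous strategy $\mathscr S$ has the soundness property at level $$c_0\,\kappa\bigl(\max\{0,\ \omega(\mathcal G,\mathscr S)-c\,\delta^{q}\}\bigr)-c\,\delta^{1/8}.$$ -/

import Mathlib

open scoped InnerProductSpace

universe u v

/-- A two-player nonlocal game with question set `X` and answer set `A` for both players: a
probability distribution `μ` on `X × X` and a `{0,1}`-valued evaluation function `V`. -/
structure NonlocalGame (X A : Type*) [Fintype X] where
  μ : X → X → ℝ
  μ_nonneg : ∀ x y, 0 ≤ μ x y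
  μ_sum : ∑ x, ∑ y, μ x y = 1
  V : X → X → A → A → Bool

/-- The game is synchronous: `V x x a b` is the Kronecker delta of `a` and `b`. -/
def NonlocalGame.IsSynchronous {X A : Type*} [Fintype X] (𝓖 : NonlocalGame X A) : Prop :=
  ∀ x a b, 𝓖.V x x a b = true ↔ a = b

/-- The winning probability of a correlation `C x y a b`. -/
noncomputable def NonlocalGame.winProb {X A : Type*} [Fintype X] [Fintype A]
    (𝓖 : NonlocalGame X A) (C : X → X → A → A → ℝ) : ℝ :=
  ∑ x, ∑ y, 𝓖.μ x y * ∑ a, ∑ b, if 𝓖.V x y a b = true then C x y a b else 0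

/-- `∑_{a ≠ b} C x x a b`: the probability that the two answers to the question pair `(x, x)`
differ. -/
noncomputable def disagreement {X A : Type*} [Fintype A] [DecidableEq A]
    (C : X → X → A → A → ℝ) (x : X) : ℝ :=
  ∑ a, ∑ b, if a ≠ b then C x x a b else 0

/-- The synchronicity `δ_sync(𝓖, C)`: the expectation of the disagreement when the question is drawn
from the first marginal of `μ`. -/
noncomputable def NonlocalGame.synchronicity {X A : Type*} [Fintype X] [Fintype A] [DecidableEq A]
    (𝓖 : NonlocalGame X A) (C : X → X → A → A → ℝ) : ℝ :=
  ∑ x, (∑ y, 𝓖.μ x y) * disagreement C x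

/-- A correlation is synchronous if equal questions never receive different answers. -/
def IsSynchronousCorr {X A : Type*} (C : X → X → A → A → ℝ) : Prop :=
  ∀ x a b, a ≠ b → C x x a b = 0

/-- A positive operator-valued measure with outcome set `A` on the Hilbert space `H`. -/
structure IsPOVM {A H : Type*} [Fintype A] [NormedAddCommGroup H] [InnerProductSpace ℂ H]
    (E : A → H →L[ℂ] H) : Prop where
  pos : ∀ a, (E a).IsPositive
  sum_eq : ∑ a, E a = 1

/-- A commuting operator strategy on the Hilbert space `H`. -/
structure CommutingStrategy (X A H : Type*) [Fintype A]
    [NormedAddCommGroup H] [InnerProductSpace ℂ H] where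
  ψ : H
  norm_ψ : ‖ψ‖ = 1
  alice : X → A → H →L[ℂ] H
  bob : X → A → H →L[ℂ] H
  alice_povm : ∀ x, IsPOVM (alice x)
  bob_povm : ∀ y, IsPOVM (bob y)
  commute : ∀ x y a b, alice x a * bob y b = bob y b * alice x a

/-- The correlation `C x y a b = ⟨ψ| A_a^x B_b^y |ψ⟩` of a strategy (the inner product is a
nonnegative real number, so taking the real part loses nothing). -/
noncomputable def CommutingStrategy.corr {X A H : Type*} [Fintype A]
    [NormedAddCommGroup H] [InnerProductSpace ℂ H] (S : CommutingStrategy X A H) :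
    X → X → A → A → ℝ :=
  fun x y a b => RCLike.re ⟪S.ψ, (S.alice x a * S.bob y b) S.ψ⟫_ℂ

/-- The set `C_qc(X, A)` of commuting operator correlations (with Hilbert spaces in universe
`u`). -/
def commutingCorr (X A : Type v) [Fintype A] : Set (X → X → A → A → ℝ) :=
  {C | ∃ (H : Type u) (_ : NormedAddCommGroup H) (_ : InnerProductSpace ℂ H) (_ : CompleteSpace H)
    (S : CommutingStrategy X A H), S.corr = C}

/-- A tracial von Neumann algebra `(M, τ)` in standard form. Here `H` is `L²(M, τ)`, the vector
`Ω` is `|τ⟩`, and the trace is `τ(a) = ⟨Ω, a Ω⟩`. The standard form is the GNS representation of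
a faithful normal tracial state; up to unitary equivalence this is the same as a von Neumann
algebra acting on `H` with a cyclic and separating unit vector whose vector state is tracial (a
vector state is normal, and it is faithful on `M` iff the vector is separating, as
`τ(a* a) = ‖a Ω‖ ^ 2`). -/
structure TracialStandardForm (H : Type*) [NormedAddCommGroup H] [InnerProductSpace ℂ H]
    [CompleteSpace H] where
  M : VonNeumannAlgebra H
  Ω : H
  norm_Ω : ‖Ω‖ = 1
  tracial : ∀ a ∈ M, ∀ b ∈ M, ⟪Ω, (a * b) Ω⟫_ℂ = ⟪Ω, (b * a) Ω⟫_ℂ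
  separating : ∀ a ∈ M, a Ω = 0 → a = 0
  cyclic : Dense {v : H | ∃ m ∈ M, m Ω = v}

namespace TracialStandardForm

variable {H : Type*} [NormedAddCommGroup H] [InnerProductSpace ℂ H] [CompleteSpace H]

/-- The trace norm does not see the adjoint: `‖a Ω‖ = ‖a* Ω‖`. -/
theorem norm_star_apply (T : TracialStandardForm H) {a : H →L[ℂ] H} (ha : a ∈ T.M) :
    ‖(star a) T.Ω‖ = ‖a T.Ω‖ := by
  have h := T.tracial a ha (star a) (star_mem ha)
  have e1 : ⟪T.Ω, (a * star a) T.Ω⟫_ℂ = ⟪(star a) T.Ω, (star a) T.Ω⟫_ℂ := by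
    rw [mul_apply_eq_comp, ContinuousLinearMap.star_eq_adjoint,
      ContinuousLinearMap.adjoint_inner_left]
  have e2 : ⟪T.Ω, (star a * a) T.Ω⟫_ℂ = ⟪a T.Ω, a T.Ω⟫_ℂ := by
    rw [mul_apply_eq_comp, ContinuousLinearMap.star_eq_adjoint,
      ContinuousLinearMap.adjoint_inner_right]
  rw [e1, e2, inner_self_eq_norm_sq_to_K, inner_self_eq_norm_sq_to_K] at h
  have h' : ‖(star a) T.Ω‖ ^ 2 = ‖a T.Ω‖ ^ 2 := by exact_mod_cast h
  exact (sq_eq_sq₀ (norm_nonneg _) (norm_nonneg _)).1 h'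

/-- Right multiplication by `a` extends to a bounded operator on `L²(M, τ)`. -/
theorem exists_op (T : TracialStandardForm H) {a : H →L[ℂ] H} (ha : a ∈ T.M) :
    ∃ R : H →L[ℂ] H, ∀ m ∈ T.M, R (m T.Ω) = (m * a) T.Ω := by
  let P : Submodule ℂ (H →L[ℂ] H) := Subalgebra.toSubmodule T.M.toStarSubalgebra.toSubalgebra
  let e : P →ₗ[ℂ] H :=
    (LinearMap.applyₗ T.Ω).comp ((ContinuousLinearMap.coeLM ℂ).comp P.subtype)
  let f : P →ₗ[ℂ] H :=
    (LinearMap.applyₗ (a T.Ω)).comp ((ContinuousLinearMap.coeLM ℂ).comp P.subtype)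
  have hP : ∀ m : P, (m : H →L[ℂ] H) ∈ T.M := fun m => m.2
  have he : DenseRange e := by
    have : Set.range e = {v : H | ∃ m ∈ T.M, m T.Ω = v} := by
      ext v
      constructor
      · rintro ⟨m, rfl⟩
        exact ⟨m, hP m, rfl⟩
      · rintro ⟨m, hm, rfl⟩
        exact ⟨⟨m, hm⟩, rfl⟩
    rw [DenseRange, this]
    exact T.cyclic
  have hb : ∃ C, ∀ m, ‖f m‖ ≤ C * ‖e m‖ := by
    refine ⟨‖star a‖, fun m => ?_⟩
    have h1 : ‖((m : H →L[ℂ] H) * a) T.Ω‖ = ‖(star a) ((star (m : H →L[ℂ] H)) T.Ω)‖ := by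
      rw [← T.norm_star_apply (mul_mem (hP m) ha), star_mul]
      rfl
    calc ‖f m‖ = ‖(star a) ((star (m : H →L[ℂ] H)) T.Ω)‖ := h1
      _ ≤ ‖star a‖ * ‖(star (m : H →L[ℂ] H)) T.Ω‖ := ContinuousLinearMap.le_opNorm _ _
      _ = ‖star a‖ * ‖e m‖ := by rw [T.norm_star_apply (hP m)]; rfl
  exact ⟨f.extendOfNorm e, fun m hm => LinearMap.extendOfNorm_eq he hb ⟨m, hm⟩⟩

open Classical in
/-- The opposite map: for `a ∈ M`, `T.op a` is the operator `a^op` on `L²(M, τ)` with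
`a^op (m Ω) = (m a) Ω` for `m ∈ M` (unique since `Ω` is cyclic). It is only used for `a ∈ M`. -/
noncomputable def op (T : TracialStandardForm H) (a : H →L[ℂ] H) : H →L[ℂ] H :=
  if ha : a ∈ T.M then Classical.choose (T.exists_op ha) else 0

theorem op_apply (T : TracialStandardForm H) {a m : H →L[ℂ] H} (ha : a ∈ T.M) (hm : m ∈ T.M) :
    T.op a (m T.Ω) = (m * a) T.Ω := by
  rw [op, dif_pos ha]
  exact Classical.choose_spec (T.exists_op ha) m hm

end TracialStandardForm

/-- The strategy `S` is tracial embedded in the standard form of `(M, τ)`, with state `σ |τ⟩`,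
`σ ∈ M`: Alice measures in `M` and Bob in the commutant `M'`. -/
structure CommutingStrategy.IsTracialEmbedded {X A H : Type*} [Fintype A]
    [NormedAddCommGroup H] [InnerProductSpace ℂ H] [CompleteSpace H]
    (S : CommutingStrategy X A H) (T : TracialStandardForm H) (σ : H →L[ℂ] H) : Prop where
  σ_mem : σ ∈ T.M
  state_eq : S.ψ = σ T.Ω
  alice_mem : ∀ x a, S.alice x a ∈ T.M
  bob_mem : ∀ y b, S.bob y b ∈ T.M.commutant

/-- A synchronous strategy `(L²(M, τ), |τ⟩, {A_a^x})`: it is tracial embedded with state `|τ⟩`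
(that is, `σ = 1`), symmetric (Bob's operators are the `(A_a^x)^op`), and its correlation is
synchronous. -/
structure CommutingStrategy.IsTracialSynchronous {X A H : Type*} [Fintype A]
    [NormedAddCommGroup H] [InnerProductSpace ℂ H] [CompleteSpace H]
    (S : CommutingStrategy X A H) (T : TracialStandardForm H) : Prop where
  embedded : S.IsTracialEmbedded T 1
  symm : ∀ x a, S.bob x a = T.op (S.alice x a)
  sync : IsSynchronousCorr S.corr

/-- The soundness property of the strategy `S` at level `v`: there are POVMs `{G_b^y}_b` in `M` with
`𝔼_{(x,y) ∼ ρ} ∑_a ⟨ψ| A_a^x (∑_{b ∈ g_{xy}(a)} G_b^y)^op |ψ⟩ ≥ v`. -/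
def CommutingStrategy.HasSoundness {X A Y B H : Type*} [Fintype X] [Fintype A] [Fintype Y]
    [Fintype B] [NormedAddCommGroup H] [InnerProductSpace ℂ H] [CompleteSpace H]
    (S : CommutingStrategy X A H) (T : TracialStandardForm H)
    (ρ : X → Y → ℝ) (g : X → Y → A → Finset B) (v : ℝ) : Prop :=
  ∃ G : Y → B → H →L[ℂ] H, (∀ y, IsPOVM (G y)) ∧ (∀ y b, G y b ∈ T.M) ∧
    v ≤ ∑ x, ∑ y, ρ x y *
      ∑ a, RCLike.re ⟪S.ψ, (S.alice x a * T.op (∑ b ∈ g x y a, G y b)) S.ψ⟫_ℂ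

/-! The commutant of a standard form is the opposite algebra, so Bob's operators are b^op with b in
M, and the polar decomposition σ = h w* turns all statistics into τ(h E_a h F_b). Here E is Alice's
POVM, h ≥ 0 satisfies τ(h²) = 1, and F_b = w* b w is a sub-POVM in M (`exists_polar_form`). If h
were a multiple of a projection p and the E_a were projections commuting with p, then the p E_a p
would define a synchronous strategy on the corner p M p (`exists_corner`), to which the hypothesis
applies. The proof decomposes the general case into such corners.

Disagreement d forces E_a h ≈ h F_a in trace norm. Hence E almost commutes with h and is almost
projective against the weight h² (the lemmas on `IsCorrelatedPair`). For a positive s of finite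
spectrum, s² is a positive combination of spectral projections p_k with weights λ_k. Connes' trick
(`sum_levelProj_commutator_le`) bounds the averaged commutators of E with the p_k by a multiple of
√d. So the compressions p_k E p_k are, on average over k, almost projective POVMs in their corners.
Orthonormalization (`exists_projective_measurement`), with a constant that does not depend on the
number of answers, replaces each by a projective measurement, and paired with its opposite this is a
synchronous tracial strategy. The probability weights λ_k τ(p_k) / τ(s²) average its winning
probabilities; up to O(d^{1/4}), τ(s²) times this average is at least the winning value computed
with s.

The hypothesis now gives measurements G^k in the corners, and Jensen's inequality for the convex
function κ combines their values. Since the sum over k of λ_k G^k has total mass s², conjugation by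
s⁻¹ and then by w produces a measurement for the original state (`IsStaircase.exists_povm`).
Averaging d^{1/4} over the questions gives δ^{1/4}, by concavity.

It remains to pass from s to h. Staircases approximate h from below in norm, and κ is continuous in
(0,1), so the estimate survives up to ε. At 1, however, κ may jump. That level is reached only when
δ = 0 and the strategy wins with probability 1; then E commutes exactly with h on the relevant
questions, the staircases inherit the commutation, and they win perfectly themselves. The final ε is
removed by weak compactness of the set of POVMs (`hasSoundness_of_forall_lt`). -/

set_option linter.unusedSectionVars false

/-! ### Tracial states, polar decomposition and independent projections -/

section AbstractTrace

variable {N : Type*} [CStarAlgebra N] [PartialOrder N] [StarOrderedRing N]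

/-- A positive normalised trace, recorded through its real part. -/
structure IsTracialState (τ : N →ₗ[ℝ] ℝ) : Prop where
  mul_comm : ∀ x y, τ (x * y) = τ (y * x)
  star : ∀ x, τ (star x) = τ x
  nonneg : ∀ x, 0 ≤ x → 0 ≤ τ x
  one : τ 1 = 1

/-- Douglas factorization: `x* x ≤ S ^ 2` implies that `x = u S` for some `u` killing `ker S`. -/
def DouglasProperty (N : Type*) [CStarAlgebra N] [PartialOrder N] : Prop :=
  ∀ x S : N, IsSelfAdjoint S → star x * x ≤ S * S → ∃ u, u * S = x ∧ ∀ y, S * y = 0 → u * y = 0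

namespace IsTracialState

variable {τ : N →ₗ[ℝ] ℝ} (hτ : IsTracialState τ)
include hτ

theorem mono {x y : N} (h : x ≤ y) : τ x ≤ τ y := by
  have := hτ.nonneg (y - x) (sub_nonneg.2 h)
  rw [map_sub] at this
  linarith

theorem star_mul_self_nonneg (x : N) : 0 ≤ τ (Star.star x * x) :=
  hτ.nonneg _ (_root_.star_mul_self_nonneg x)

theorem conj_nonneg {F : N} (hF : 0 ≤ F) (x : N) : 0 ≤ τ (Star.star x * F * x) :=
  hτ.nonneg _ (star_left_conjugate_nonneg hF x)

theorem mul_nonneg {x y : N} (hx : 0 ≤ x) (hy : 0 ≤ y) : 0 ≤ τ (x * y) := by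
  obtain ⟨z, rfl⟩ := CStarAlgebra.nonneg_iff_eq_star_mul_self.1 hy
  rw [← mul_assoc, hτ.mul_comm, ← mul_assoc]
  simpa using hτ.conj_nonneg hx (Star.star z)

theorem mul_le_mul_right {x x' y : N} (hx : x ≤ x') (hy : 0 ≤ y) : τ (x * y) ≤ τ (x' * y) := by
  have := hτ.mul_nonneg (sub_nonneg.2 hx) hy
  rw [sub_mul, map_sub] at this
  linarith

/-- Weighted Cauchy-Schwarz for the form `(x, y) ↦ τ (x* F y)`. -/
theorem two_mul_le {F : N} (hF : 0 ≤ F) (x y : N) {θ : ℝ} (hθ : 0 < θ) :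
    2 * τ (Star.star x * F * y) ≤ θ * τ (Star.star x * F * x) + θ⁻¹ * τ (Star.star y * F * y) := by
  set r := Real.sqrt θ
  have hr : 0 < r := Real.sqrt_pos.2 hθ
  have hrr : r * r = θ := Real.mul_self_sqrt hθ.le
  have h := hτ.conj_nonneg hF (r • x - r⁻¹ • y)
  have e : τ (Star.star (r • x - r⁻¹ • y) * F * (r • x - r⁻¹ • y))
      = r * r * τ (Star.star x * F * x) + (r * r)⁻¹ * τ (Star.star y * F * y)
        - τ (Star.star x * F * y) - τ (Star.star y * F * x) := by
    simp only [star_sub, star_smul, sub_mul, mul_sub, smul_mul_assoc, mul_smul_comm, map_sub,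
      map_smul, smul_eq_mul, star_trivial]
    field_simp
    ring
  have e2 : τ (Star.star y * F * x) = τ (Star.star x * F * y) := by
    rw [← hτ.star (Star.star y * F * x)]
    simp [mul_assoc, hF.isSelfAdjoint.star_eq]
  rw [e, e2, hrr] at h
  linarith

end IsTracialState

/-- The optimal θ is √b / √a. When a or b vanishes there is no optimizer, and a very large or very
small θ gives the bound up to ε. -/
theorem le_two_sqrt_of_forall {X a b : ℝ} (ha : 0 ≤ a) (hb : 0 ≤ b)
    (h : ∀ θ : ℝ, 0 < θ → X ≤ θ * a + θ⁻¹ * b) : X ≤ 2 * Real.sqrt (a * b) := by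
  refine le_of_forall_pos_le_add fun ε hε => ?_
  by_cases ha0 : a = 0
  · subst ha0
    have := h ((b + 1) / ε) (by positivity)
    have h2 : ((b + 1) / ε)⁻¹ * b ≤ ε := by
      rw [inv_div, div_mul_eq_mul_div, div_le_iff₀ (by positivity)]
      nlinarith
    have := Real.sqrt_nonneg (0 * b)
    nlinarith
  by_cases hb0 : b = 0
  · subst hb0
    have := h (ε / (a + 1)) (by positivity)
    have h2 : (ε / (a + 1)) * a ≤ ε := by
      rw [div_mul_eq_mul_div, div_le_iff₀ (by positivity)]
      nlinarith
    have := Real.sqrt_nonneg (a * 0)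
    nlinarith
  have ha' : 0 < a := lt_of_le_of_ne ha (Ne.symm ha0)
  have hb' : 0 < b := lt_of_le_of_ne hb (Ne.symm hb0)
  have hsa := Real.sqrt_pos.2 ha'
  have hsb := Real.sqrt_pos.2 hb'
  have := h (Real.sqrt b / Real.sqrt a) (by positivity)
  have e1 : Real.sqrt b / Real.sqrt a * a = Real.sqrt (a * b) := by
    rw [Real.sqrt_mul ha, div_mul_eq_mul_div, div_eq_iff hsa.ne']
    nlinarith [Real.mul_self_sqrt ha]
  have e2 : (Real.sqrt b / Real.sqrt a)⁻¹ * b = Real.sqrt (a * b) := by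
    rw [Real.sqrt_mul ha, inv_div, div_mul_eq_mul_div, div_eq_iff hsb.ne']
    nlinarith [Real.mul_self_sqrt hb]
  rw [e1, e2] at this
  linarith

omit [PartialOrder N] [StarOrderedRing N] in
theorem eq_zero_of_star_mul_self {y : N} (h : star y * y = 0) : y = 0 :=
  CStarRing.star_mul_self_eq_zero_iff _ |>.1 h

omit [PartialOrder N] [StarOrderedRing N] in
theorem IsStarProjection.mul_self {p : N} (hp : IsStarProjection p) : p * p = p :=
  hp.isIdempotentElem

omit [PartialOrder N] [StarOrderedRing N] in
theorem IsStarProjection.star_eq {p : N} (hp : IsStarProjection p) : star p = p :=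
  hp.isSelfAdjoint

theorem IsStarProjection.zero_le {p : N} (hp : IsStarProjection p) : 0 ≤ p := by
  rw [← hp.mul_self]
  nth_rw 1 [← hp.star_eq]
  exact star_mul_self_nonneg p

theorem IsStarProjection.le_one' {p : N} (hp : IsStarProjection p) : p ≤ 1 :=
  sub_nonneg.1 hp.one_sub.zero_le

/-- An element of the positive unit ball satisfies `x ^ 2 ≤ x`. -/
theorem mul_self_le_self {x : N} (h0 : 0 ≤ x) (h1 : x ≤ 1) : x * x ≤ x := by
  have : 0 ≤ x * (1 - x) :=
    Commute.mul_nonneg h0 (sub_nonneg.2 h1) ((Commute.one_right x).sub_right (Commute.refl x))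
  rw [mul_sub, mul_one] at this
  exact sub_nonneg.1 this

/-! ### Supports and spectral cuts -/

/-- Douglas factorization of b by itself gives u b = b, hence b (u* - 1) = 0. The kernel condition
turns this into u u* = u, which makes u a projection. -/
theorem exists_support (hD : DouglasProperty N) {b : N} (hb : IsSelfAdjoint b) :
    ∃ p : N, IsStarProjection p ∧ p * b = b ∧ ∀ y, b * y = 0 → p * y = 0 := by
  obtain ⟨u, hu, hk⟩ := hD b b hb (by rw [hb.star_eq])
  have h1 : b * (star u - 1) = 0 := by
    have := congrArg star hu
    rw [star_mul, hb.star_eq] at this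
    rw [mul_sub, this, mul_one, sub_self]
  have h2 := hk _ h1
  rw [mul_sub, mul_one, sub_eq_zero] at h2
  have hsa : star u = u := by
    rw [← h2, star_mul, star_star, h2]
  exact ⟨u, ⟨by rw [hsa] at h2; exact h2, hsa⟩, hu, hk⟩

/-- The positive part of `h - l`. -/
noncomputable def upperPart (h : N) (l : ℝ) : N := cfc (fun t : ℝ => max (t - l) 0) h

theorem upperPart_nonneg (h : N) (l : ℝ) : 0 ≤ upperPart h l :=
  cfc_nonneg fun _ _ => le_max_right _ _

theorem upperPart_anti (h : N) {l l' : ℝ} (hl : l ≤ l') : upperPart h l' ≤ upperPart h l := by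
  refine cfc_mono (fun x _ => max_le_max (by linarith) le_rfl) ?_ ?_ <;> fun_prop

theorem upperPart_eq_zero {h : N} {l : ℝ} (hl : ‖h‖ ≤ l) :
    upperPart h l = 0 := by
  rcases subsingleton_or_nontrivial N with hN | hN
  · exact Subsingleton.elim _ _
  have : Set.EqOn (fun t : ℝ => max (t - l) 0) (fun _ => 0) (spectrum ℝ h) := by
    intro t ht
    have := spectrum.norm_le_norm_of_mem ht
    rw [Real.norm_eq_abs] at this
    have := le_abs_self t
    simp only
    exact max_eq_right (by linarith)
  rw [upperPart, cfc_congr this, cfc_const_zero]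

theorem upperPart_commute {h z : N} (hz : Commute h z) (l : ℝ) : Commute (upperPart h l) z :=
  hz.cfc_real _

/-- The spectral projection of `h` for `(l, ∞)`. -/
theorem exists_spectral_cut (hD : DouglasProperty N) {h : N} (hh : IsSelfAdjoint h) (l : ℝ) :
    ∃ p : N, IsStarProjection p ∧ p * upperPart h l = upperPart h l ∧
      (∀ y, upperPart h l * y = 0 → p * y = 0) ∧
      (∃ c : N, 0 ≤ c ∧ h - l • (1 : N) = upperPart h l - c ∧ p * c = 0 ∧ Commute h c) ∧
      ∀ z, IsSelfAdjoint z → Commute h z → Commute p z := by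
  obtain ⟨p, hp, hpb, hk⟩ := exists_support hD (upperPart_nonneg h l).isSelfAdjoint
  refine ⟨p, hp, hpb, hk, ⟨cfc (fun t : ℝ => max (l - t) 0) h,
    cfc_nonneg fun _ _ => le_max_right _ _, ?_, hk _ ?_, ?_⟩, fun z hz hhz => ?_⟩
  · rw [upperPart, ← cfc_sub _ _ h (by fun_prop) (by fun_prop)]
    have : (fun t : ℝ => max (t - l) 0 - max (l - t) 0) = fun t => t - l := by
      ext t
      rcases le_total t l with h | h
      · rw [max_eq_right (by linarith), max_eq_left (by linarith)]; ring
      · rw [max_eq_left (by linarith), max_eq_right (by linarith)]; ring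
    rw [this, cfc_sub (fun t : ℝ => t) (fun _ => l) h (by fun_prop) (by fun_prop), cfc_id' ℝ h,
      cfc_const l h, Algebra.algebraMap_eq_smul_one]
  · rw [upperPart, ← cfc_mul _ _ h (by fun_prop) (by fun_prop)]
    have : (fun t : ℝ => max (t - l) 0 * max (l - t) 0) = fun t => 0 := by
      ext t
      rcases le_total t l with h | h
      · rw [max_eq_right (by linarith)]; ring
      · rw [max_eq_right (a := l - t) (by linarith)]; ring
    rw [this, cfc_const_zero]
  · exact ((Commute.refl h).cfc_real _).symm
  · have hb := upperPart_commute hhz l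
    have hbp : upperPart h l * p = upperPart h l := by
      have := congrArg star hpb
      rwa [star_mul, hp.star_eq, (upperPart_nonneg h l).isSelfAdjoint.star_eq] at this
    -- Since z commutes with the positive part, it preserves its kernel, so p z = p z p. The adjoint
    -- of this identity gives the commutation.
    have h1 : p * (z * (1 - p)) = 0 := by
      apply hk
      rw [← mul_assoc, hb.eq, mul_assoc, mul_sub, mul_one, hbp, sub_self, mul_zero]
    have h2 : p * z = p * z * p := by
      rw [mul_sub, mul_one, mul_sub, sub_eq_zero, ← mul_assoc] at h1
      exact h1
    have h3 := congrArg star h2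
    simp only [star_mul, hp.star_eq, hz.star_eq] at h3
    rw [commute_iff_eq, h2, h3, mul_assoc]

/-! ### Polar decomposition of a column -/

/-- Each entry satisfies x_i* x_i ≤ S², so Douglas factorization applies entry by entry. The sum q
of the u_i* u_i satisfies S q S = S² and kills the kernel of S; these two facts give (q S - S)* (q S
- S) = 0, so q is the support projection of S. -/
theorem exists_polar {ι : Type*} (hD : DouglasProperty N) (s : Finset ι) (x : ι → N) :
    ∃ (S : N) (u : ι → N), 0 ≤ S ∧ S * S = ∑ i ∈ s, star (x i) * x i ∧
      (∀ i ∈ s, u i * S = x i) ∧ (∀ y, S * y = 0 → ∀ i ∈ s, u i * y = 0) ∧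
      IsStarProjection (∑ i ∈ s, star (u i) * u i) ∧ (∑ i ∈ s, star (u i) * u i) * S = S ∧
      ∀ i ∈ s, u i * (∑ j ∈ s, star (u j) * u j) = u i := by
  classical
  have h0 : 0 ≤ ∑ i ∈ s, star (x i) * x i := Finset.sum_nonneg fun i _ => star_mul_self_nonneg _
  set S := CFC.sqrt (∑ i ∈ s, star (x i) * x i) with hS
  have hS0 : 0 ≤ S := CFC.sqrt_nonneg _
  have hSS : S * S = ∑ i ∈ s, star (x i) * x i := CFC.sqrt_mul_sqrt_self _ h0
  have hex : ∀ i, ∃ u, i ∈ s → u * S = x i ∧ ∀ y, S * y = 0 → u * y = 0 := by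
    intro i
    by_cases hi : i ∈ s
    · obtain ⟨u, hu⟩ := hD (x i) S hS0.isSelfAdjoint (by
        rw [hSS]
        exact Finset.single_le_sum (f := fun i => star (x i) * x i)
          (fun i _ => star_mul_self_nonneg _) hi)
      exact ⟨u, fun _ => hu⟩
    · exact ⟨0, fun h => absurd h hi⟩
  choose u hu using hex
  set q := ∑ i ∈ s, star (u i) * u i with hq
  have hqsa : star q = q := by simp [hq, star_sum]
  have hSsa : star S = S := hS0.isSelfAdjoint.star_eq
  have hk : ∀ y, S * y = 0 → q * y = 0 := by
    intro y hy
    rw [hq, Finset.sum_mul]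
    exact Finset.sum_eq_zero fun i hi => by rw [mul_assoc, (hu i hi).2 y hy, mul_zero]
  have hSqS : S * q * S = S * S := by
    rw [hSS, hq, Finset.mul_sum, Finset.sum_mul]
    refine Finset.sum_congr rfl fun i hi => ?_
    have := (hu i hi).1
    calc S * (star (u i) * u i) * S = star (u i * S) * (u i * S) := by
          rw [star_mul, hSsa]; simp only [mul_assoc]
      _ = _ := by rw [this]
  have hqS : q * S = S := by
    have h1 : S * (q * S - S) = 0 := by rw [mul_sub, ← mul_assoc, hSqS, sub_self]
    have h2 := hk _ h1
    have : star (q * S - S) * (q * S - S) = 0 := by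
      rw [star_sub, star_mul, hqsa, hSsa, sub_mul, h1, mul_assoc, h2, mul_zero, sub_zero]
    exact sub_eq_zero.1 (eq_zero_of_star_mul_self this)
  have huq : ∀ i ∈ s, u i * q = u i := by
    intro i hi
    have h1 : S * (1 - q) = 0 := by
      have := congrArg star hqS
      rw [star_mul, hqsa, hSsa] at this
      rw [mul_sub, mul_one, this, sub_self]
    have := (hu i hi).2 _ h1
    rw [mul_sub, mul_one, sub_eq_zero] at this
    exact this.symm
  have hqq : q * q = q := by
    nth_rw 1 [hq]
    rw [Finset.sum_mul]
    exact Finset.sum_congr rfl fun i hi => by rw [mul_assoc, huq i hi]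
  exact ⟨S, u, hS0, hSS, fun i hi => (hu i hi).1, fun y hy i hi => (hu i hi).2 y hy,
    ⟨hqq, hqsa⟩, hqS, huq⟩

/-! ### Independent subprojections -/

/-- This is Kaplansky's parallelogram law. If u is the partial isometry of (1 - F) P, then u* u is P
minus its meet with F, and F + u u* is the join of F and P. The two new pieces have equal trace
because τ(u* u) = τ(u u*). -/
theorem exists_independent_step (hD : DouglasProperty N) {P F : N} (hP : IsStarProjection P)
    (hF : IsStarProjection F) {τ : N →ₗ[ℝ] ℝ} (hτ : IsTracialState τ) :
    ∃ P' F' : N, IsStarProjection P' ∧ IsStarProjection F' ∧ P * P' = P' ∧ F' * P = P ∧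
      F' * F = F ∧ τ F' = τ F + τ P' ∧ ∀ y, P' * y = y → F * y = y → y = 0 := by
  obtain ⟨S, u', hS0, hSS, huS, hk, hq, hqS, huq⟩ :=
    exists_polar hD {()} (fun _ : Unit => (1 - F) * P)
  simp only [Finset.sum_singleton, Finset.mem_singleton, forall_const] at *
  set u := u' ()
  have huS : u * S = (1 - F) * P := huS ()
  have hk : ∀ y, S * y = 0 → u * y = 0 := fun y hy => hk y hy ()
  have huq : u * (star u * u) = u := huq ()
  have hSsa : star S = S := hS0.isSelfAdjoint.star_eq
  have hSk : ∀ y, (1 - F) * P * y = 0 → u * y = 0 := by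
    intro y hy
    apply hk
    apply eq_zero_of_star_mul_self
    rw [star_mul, hSsa, mul_assoc, ← mul_assoc S, hSS, mul_assoc, hy]
    simp
  have hFu : F * u = 0 := by
    have h1 : S * (star u * F) = 0 := by
      have : star (u * S) = S * star u := by rw [star_mul, hSsa]
      rw [← mul_assoc, ← this, huS, star_mul, star_sub, star_one, hF.star_eq, hP.star_eq,
        mul_assoc, hF.one_sub_mul_self, mul_zero]
    have h2 := hk _ h1
    have h3 : star (star u * F) * (star u * F) = 0 := by
      rw [star_mul, star_star, hF.star_eq, mul_assoc, h2, mul_zero]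
    have := congrArg star (eq_zero_of_star_mul_self h3)
    rwa [star_mul, star_star, hF.star_eq, star_zero] at this
  have huF : star u * F = 0 := by
    have := congrArg star hFu
    rwa [star_mul, hF.star_eq, star_zero] at this
  have hPP' : P * (star u * u) = star u * u := by
    have h1 : u * (1 - P) = 0 := hSk _ (by rw [mul_assoc, hP.mul_one_sub_self, mul_zero])
    have h2 : u * P = u := by rw [mul_sub, mul_one, sub_eq_zero] at h1; exact h1.symm
    have h3 := congrArg star h2
    rw [star_mul, hP.star_eq] at h3
    rw [← mul_assoc, h3]
  refine ⟨star u * u, F + u * star u, hq, ⟨?_, ?_⟩, hPP', ?_, ?_, ?_, ?_⟩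
  · change (F + u * star u) * (F + u * star u) = F + u * star u
    rw [add_mul, mul_add, mul_add, hF.mul_self, ← mul_assoc F, hFu, mul_assoc u, huF,
      mul_assoc u, ← mul_assoc (star u)]
    rw [← mul_assoc u (star u * u), huq]
    simp
  · change star (F + u * star u) = F + u * star u
    rw [star_add, hF.star_eq, star_mul, star_star]
  · have h1 : u * star u * ((1 - F) * P) = (1 - F) * P := by
      rw [← huS, ← mul_assoc, mul_assoc u, huq]
    have h2 : u * star u * P = (1 - F) * P := by
      rw [← h1, sub_mul, mul_sub, one_mul]
      rw [← mul_assoc (u * star u) F, mul_assoc u (star u) F, huF]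
      simp
    rw [add_mul, h2, sub_mul, one_mul]
    abel
  · rw [add_mul, hF.mul_self, mul_assoc, huF, mul_zero, add_zero]
  · rw [map_add, hτ.mul_comm u]
  · intro y h1 h2
    have hPy : P * y = y := by rw [← h1, ← mul_assoc, hPP']
    have : u * y = 0 := hSk _ (by rw [mul_assoc, hPy, sub_mul, one_mul, h2, sub_self])
    rw [← h1, mul_assoc, this, mul_zero]

/-- Adding the projections one at a time, each is cut down by its meet with the join F of the
earlier ones. The trace lost in total is that of the sum of the P_i minus τ(F), which is small when
that sum is close to 1. -/
theorem exists_independent_subprojections {ι : Type*} (hD : DouglasProperty N)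
    {τ : N →ₗ[ℝ] ℝ} (hτ : IsTracialState τ) (s : Finset ι) (P : ι → N)
    (hP : ∀ i, IsStarProjection (P i)) :
    ∃ (P' : ι → N) (F : N), IsStarProjection F ∧ (∀ i ∈ s, IsStarProjection (P' i)) ∧
      (∀ i ∈ s, P i * P' i = P' i) ∧ (∀ i ∈ s, F * P i = P i) ∧ ∑ i ∈ s, τ (P' i) = τ F ∧
      ∀ y : ι → N, (∀ i ∈ s, P' i * y i = y i) → ∑ i ∈ s, y i = 0 → ∀ i ∈ s, y i = 0 := by
  classical
  induction s using Finset.induction_on with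
  | empty => exact ⟨0, 0, IsStarProjection.zero N, by simp, by simp, by simp, by simp, by simp⟩
  | insert a s ha ih =>
    obtain ⟨P', F, hF, h1, h2, h3, h4, h5⟩ := ih
    obtain ⟨Q, F', hQ, hF', g1, g2, g3, g4, g5⟩ := exists_independent_step hD (hP a) hF hτ
    have hne : ∀ i ∈ s, i ≠ a := fun i hi h => ha (h ▸ hi)
    refine ⟨Function.update P' a Q, F', hF', ?_, ?_, ?_, ?_, ?_⟩
    · intro i hi
      rcases Finset.mem_insert.1 hi with rfl | hi
      · simpa using hQ
      · rw [Function.update_of_ne (hne i hi)]; exact h1 i hi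
    · intro i hi
      rcases Finset.mem_insert.1 hi with rfl | hi
      · simpa using g1
      · rw [Function.update_of_ne (hne i hi)]; exact h2 i hi
    · intro i hi
      rcases Finset.mem_insert.1 hi with rfl | hi
      · exact g2
      · rw [← h3 i hi, ← mul_assoc, g3]
    · rw [Finset.sum_insert ha, Function.update_self, g4, ← h4, add_comm]
      congr 1
      exact Finset.sum_congr rfl fun i hi => by rw [Function.update_of_ne (hne i hi)]
    · intro y hy hsum
      have hy' : ∀ i ∈ s, P' i * y i = y i := fun i hi => by
        have := hy i (Finset.mem_insert_of_mem hi)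
        rwa [Function.update_of_ne (hne i hi)] at this
      rw [Finset.sum_insert ha] at hsum
      -- The vanishing sum expresses the new term through the old ones, so it lies under F and also
      -- under the new subprojection, hence is zero.
      have hFy : F * y a = y a := by
        have : y a = - ∑ i ∈ s, y i := eq_neg_of_add_eq_zero_left hsum
        rw [this, mul_neg, Finset.mul_sum]
        congr 1
        refine Finset.sum_congr rfl fun i hi => ?_
        rw [← hy' i hi, ← h2 i hi, ← mul_assoc, ← mul_assoc, h3 i hi]
      have hya : y a = 0 := g5 _ (by simpa using hy a (Finset.mem_insert_self a s)) hFy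
      intro i hi
      rcases Finset.mem_insert.1 hi with rfl | hi
      · exact hya
      · exact h5 y hy' (by simpa [hya] using hsum) i hi

end AbstractTrace

/-! ### Orthonormalization of almost projective measurements -/

section Orthonormalization

variable {N : Type*} [CStarAlgebra N] [PartialOrder N] [StarOrderedRing N]

namespace IsTracialState

variable {τ : N →ₗ[ℝ] ℝ} (hτ : IsTracialState τ)
include hτ

theorem sq_add_le (x y : N) :
    τ (Star.star (x + y) * (x + y)) ≤ 2 * τ (Star.star x * x) + 2 * τ (Star.star y * y) := by
  have h := hτ.star_mul_self_nonneg (x - y)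
  simp only [star_add, star_sub, add_mul, mul_add, sub_mul, mul_sub, map_add, map_sub] at h ⊢
  linarith

theorem sq_add_four_le (x y z w : N) :
    τ (Star.star (x + y + (z + w)) * (x + y + (z + w))) ≤
      4 * (τ (Star.star x * x) + τ (Star.star y * y) + τ (Star.star z * z)
        + τ (Star.star w * w)) := by
  have := hτ.sq_add_le (x + y) (z + w)
  have := hτ.sq_add_le x y
  have := hτ.sq_add_le z w
  linarith

/-- The operators need not commute: τ((Y - X)(Y + X)) is nonnegative, and the trace cancels the
cross terms. -/
theorem sq_le_sq {X Y : N} (h1 : X ≤ Y) (h2 : -Y ≤ X) : τ (X * X) ≤ τ (Y * Y) := by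
  have h2' : 0 ≤ Y + X := by
    have := sub_nonneg.2 h2
    rwa [sub_neg_eq_add, add_comm] at this
  have h := hτ.mul_nonneg (sub_nonneg.2 h1) h2'
  simp only [sub_mul, mul_add, map_add, map_sub] at h
  have := hτ.mul_comm X Y
  linarith

theorem mul_self_le {x : N} (h0 : 0 ≤ x) (h1 : x ≤ 1) : τ (x * x) ≤ τ x :=
  hτ.mono (mul_self_le_self h0 h1)

theorem conj_le_conj {F G : N} (h : F ≤ G) (x : N) :
    τ (Star.star x * F * x) ≤ τ (Star.star x * G * x) :=
  hτ.mono (star_left_conjugate_le_conjugate h x)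

end IsTracialState

/-- The spectral projection of a positive contraction `a` for `(1/2, 1]` differs from `a` by at most
`2 (a - a ^ 2)`. -/
theorem exists_rounding_projection (hD : DouglasProperty N) {a : N} (h0 : 0 ≤ a) (h1 : a ≤ 1) :
    ∃ p : N, IsStarProjection p ∧ p - a ≤ (2 : ℝ) • (a - a * a) ∧
      -((2 : ℝ) • (a - a * a)) ≤ p - a := by
  obtain ⟨p, hp, hpb, -, ⟨c, hc, habc, hpc, hac⟩, hcomm⟩ :=
    exists_spectral_cut hD h0.isSelfAdjoint (1 / 2)
  set b := upperPart a (1 / 2)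
  have hb : 0 ≤ b := upperPart_nonneg _ _
  have hab : Commute b a := upperPart_commute (Commute.refl a) _
  have hpa : Commute p a := hcomm a h0.isSelfAdjoint (Commute.refl a)
  have hd : 0 ≤ a - a * a := sub_nonneg.2 (mul_self_le_self h0 h1)
  have h1' : 0 ≤ 1 - a := sub_nonneg.2 h1
  have ha : a = (1 / 2 : ℝ) • (1 : N) + b - c := by
    rw [sub_eq_iff_eq_add] at habc
    rw [habc]; abel
  have ea : p * a = (1 / 2 : ℝ) • p + b := by
    nth_rw 1 [ha]
    rw [mul_sub, mul_add, hpb, hpc, mul_smul_comm, mul_one, sub_zero]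
  have ebc : a * c = (1 / 2 : ℝ) • a + b * a - a * a := by
    have : a * a = (1 / 2 : ℝ) • a + b * a - a * c := by
      conv_lhs => rw [ha]
      rw [sub_mul, add_mul]
      rw [← ha, smul_mul_assoc, one_mul, hac.eq]
    rw [this]; abel
  have hdp : Commute p (a - a * a) := hpa.sub_right (hpa.mul_right hpa)
  refine ⟨p, hp, ?_, ?_⟩
  -- On the spectrum the claim is the scalar inequality |1_{t > 1/2} - t| ≤ 2 t (1 - t). Each half
  -- is shown by writing the difference as a sum of products of commuting positive elements.
  · have e : (2 : ℝ) • (a - a * a) - (p - a)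
        = (2 : ℝ) • ((1 - a) * b) + (1 - p) * (a + (2 : ℝ) • (a - a * a)) := by
      simp only [mul_add, mul_sub, sub_mul, add_mul, one_mul, mul_smul_comm,
        ← mul_assoc, ea, smul_mul_assoc, ← hab.eq]
      module
    rw [← sub_nonneg, e]
    refine add_nonneg (smul_nonneg (by norm_num) (Commute.mul_nonneg h1' hb ?_))
      (Commute.mul_nonneg hp.one_sub.zero_le (add_nonneg h0 (smul_nonneg (by norm_num) hd)) ?_)
    · exact ((Commute.one_right b).sub_right hab).symm
    · exact (Commute.one_left _).sub_left (hpa.add_right (hdp.smul_right _))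
  · have e : (p - a) - -((2 : ℝ) • (a - a * a))
        = p * ((1 - a) + (2 : ℝ) • (a - a * a)) + (2 : ℝ) • (a * c) := by
      rw [ebc]
      simp only [mul_add, mul_sub, add_mul, mul_one, mul_smul_comm,
        ← mul_assoc, ea, smul_mul_assoc]
      module
    rw [← sub_nonneg, e]
    refine add_nonneg (Commute.mul_nonneg hp.zero_le
      (add_nonneg h1' (smul_nonneg (by norm_num) hd)) ?_)
      (smul_nonneg (by norm_num) (Commute.mul_nonneg h0 hc hac))
    exact ((Commute.one_right p).sub_right hpa).add_right (hdp.smul_right _)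

/-- Independent projections can be orthogonalized symmetrically, at a cost controlled by the distance
of their sum from the identity. -/
theorem exists_orthogonal_of_independent {ι : Type*} [Fintype ι] (hD : DouglasProperty N)
    {τ : N →ₗ[ℝ] ℝ} (hτ : IsTracialState τ) (P : ι → N) (hP : ∀ i, IsStarProjection (P i))
    (hind : ∀ y : ι → N, (∀ i, P i * y i = y i) → ∑ i, y i = 0 → ∀ i, y i = 0) :
    ∃ Q : ι → N, (∀ i, IsStarProjection (Q i)) ∧ (∀ i j, i ≠ j → Q i * Q j = 0) ∧
      IsStarProjection (∑ i, Q i) ∧ (∀ i, τ (Q i) = τ (P i)) ∧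
      ∑ i, τ (star (Q i - P i) * (Q i - P i)) ≤
        4 * τ ((∑ i, P i - 1) * (∑ i, P i - 1)) := by
  classical
  obtain ⟨S, u, hS0, hSS, huS, hk, hq, hqS, huq⟩ := exists_polar hD Finset.univ P
  simp only [Finset.mem_univ, forall_const] at huS hk huq
  set q := ∑ i, star (u i) * u i with hqdef
  have hSsa : star S = S := hS0.isSelfAdjoint.star_eq
  have hT : S * S = ∑ i, P i := by
    rw [hSS]; exact Finset.sum_congr rfl fun i _ => by rw [(hP i).star_eq, (hP i).mul_self]
  have hSu : ∀ i, S * star (u i) = P i := fun i => by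
    rw [← (hP i).star_eq, ← huS i, star_mul, hSsa]
  have hPu : ∀ i, P i * u i = u i := by
    intro i
    have h1 : S * (star (u i) * (1 - P i)) = 0 := by
      rw [← mul_assoc, hSu, (hP i).mul_one_sub_self]
    have h2 := hk _ h1 i
    have h3 : star (star (u i) * (1 - P i)) * (star (u i) * (1 - P i)) = 0 := by
      rw [star_mul, star_star, mul_assoc, h2, mul_zero]
    have h4 := congrArg star (eq_zero_of_star_mul_self h3)
    rw [star_mul, star_star, (hP i).one_sub.star_eq, star_zero, sub_mul, one_mul, sub_eq_zero] at h4
    exact h4.symm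
  have hqu : ∀ i, q * star (u i) = star (u i) := fun i => by
    have := congrArg star (huq i)
    rwa [star_mul, hq.star_eq] at this
  -- Independence enters here. For fixed j the differences of the two sides lie under the P_i and
  -- sum to S q u_j* - P_j = 0, so each vanishes. The u_i* u_i are then mutually orthogonal
  -- projections.
  have huu : ∀ i j, u i * star (u j) = if i = j then P j else 0 := by
    intro i j
    have := hind (fun i => u i * star (u j) - if i = j then P j else 0) ?_ ?_ i
    · exact sub_eq_zero.1 this
    · intro i
      rw [mul_sub, ← mul_assoc, hPu]
      split_ifs with h
      · rw [h, (hP j).mul_self]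
      · simp
    · rw [Finset.sum_sub_distrib, Finset.sum_ite_eq' Finset.univ j, if_pos (Finset.mem_univ _),
        sub_eq_zero]
      calc ∑ i, u i * star (u j) = ∑ i, S * (star (u i) * u i * star (u j)) := by
            refine Finset.sum_congr rfl fun i _ => ?_
            rw [← mul_assoc, ← mul_assoc, hSu, hPu]
        _ = S * (q * star (u j)) := by rw [← Finset.mul_sum, hqdef, Finset.sum_mul]
        _ = P j := by rw [hqu, hSu]
  have huui : ∀ i, u i * star (u i) = P i := fun i => by rw [huu]; simp
  have huP : ∀ i, star (u i) * P i = star (u i) := fun i => by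
    have := congrArg star (hPu i)
    rwa [star_mul, (hP i).star_eq] at this
  refine ⟨fun i => star (u i) * u i, fun i => ⟨?_, ?_⟩, ?_, hq, ?_, ?_⟩
  · change star (u i) * u i * (star (u i) * u i) = star (u i) * u i
    rw [mul_assoc, ← mul_assoc (u i), huui, hPu]
  · exact IsSelfAdjoint.star_mul_self _
  · intro i j hij
    change star (u i) * u i * (star (u j) * u j) = 0
    rw [mul_assoc, ← mul_assoc (u i), huu, if_neg hij]
    simp
  · intro i
    change τ (star (u i) * u i) = _
    rw [hτ.mul_comm, huui]
  · have key : ∀ i, τ (star (star (u i) * u i - P i) * (star (u i) * u i - P i))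
        ≤ 4 * τ ((1 - S) * (star (u i) * u i) * (1 - S)) := by
      intro i
      set w := u i - P i with hw
      have hww : w = u i * (1 - S) := by rw [mul_sub, mul_one, huS]
      -- Both terms are controlled by w = u_i - P_i = u_i (1 - S), so the sum over i is controlled
      -- by q compressed by 1 - S.
      have e1 : star (u i) * u i - P i = star (u i) * w + star w * P i := by
        rw [hw, star_sub, mul_sub, sub_mul, (hP i).star_eq, (hP i).mul_self, huP]
        abel
      have e2 : star (star (u i) * w) * (star (u i) * w) = star w * P i * w := by
        rw [star_mul, star_star, mul_assoc, ← mul_assoc (u i), huui, mul_assoc]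
      have e3 : τ (star (star w * P i) * (star w * P i)) = τ (star w * P i * w) := by
        rw [star_mul, star_star, (hP i).star_eq, hτ.mul_comm, ← mul_assoc, mul_assoc (star w),
          (hP i).mul_self]
      have e4 : τ (star w * P i * w) ≤ τ (star w * w) := by
        simpa using hτ.conj_le_conj (hP i).le_one' w
      have e5 : star w * w = (1 - S) * (star (u i) * u i) * (1 - S) := by
        rw [hww, star_mul, star_sub, star_one, hSsa]
        simp only [mul_assoc]
      rw [e1, ← e5]
      have := hτ.sq_add_le (star (u i) * w) (star w * P i)
      rw [e2, e3] at this
      linarith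
    calc _ ≤ ∑ i, 4 * τ ((1 - S) * (star (u i) * u i) * (1 - S)) :=
          Finset.sum_le_sum fun i _ => key i
      _ = 4 * τ ((1 - S) * q * (1 - S)) := by
          rw [← Finset.mul_sum, ← map_sum, ← Finset.sum_mul, ← Finset.mul_sum]
      _ ≤ 4 * τ ((1 - S) * (1 - S)) := by
          have := hτ.conj_le_conj hq.le_one' (1 - S)
          rw [star_sub, star_one, hSsa, mul_one] at this
          linarith
      _ ≤ 4 * τ ((∑ i, P i - 1) * (∑ i, P i - 1)) := by
          -- Since (S² - 1)² = (1 - S)(1 + S)²(1 - S) and (1 + S)² - 1 = 2 S + S² ≥ 0, the distance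
          -- of S from 1 is at most that of S².
          have hpos : 0 ≤ S + S + S * S :=
            add_nonneg (add_nonneg hS0 hS0) (by
              have := star_mul_self_nonneg S
              rwa [hSsa] at this)
          have := hτ.conj_nonneg hpos (1 - S)
          have e : (∑ i, P i - 1) * (∑ i, P i - 1)
              = (1 - S) * (1 - S) + star (1 - S) * (S + S + S * S) * (1 - S) := by
            rw [← hT, star_sub, star_one, hSsa]
            noncomm_ring
          rw [e, map_add]
          linarith

/-- Orthonormalization of measurements: a POVM which is projective on average in the trace norm is
close to a projective measurement, with a constant independent of the number of outcomes. -/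
theorem exists_projective_measurement {ι : Type*} [Fintype ι] [Nonempty ι]
    (hD : DouglasProperty N) {τ : N →ₗ[ℝ] ℝ} (hτ : IsTracialState τ) (a : ι → N)
    (h0 : ∀ i, 0 ≤ a i) (h1 : ∑ i, a i = 1) :
    ∃ Q : ι → N, (∀ i, IsStarProjection (Q i)) ∧ (∀ i j, i ≠ j → Q i * Q j = 0) ∧
      ∑ i, Q i = 1 ∧
      ∑ i, τ (star (Q i - a i) * (Q i - a i)) ≤ 776 * ∑ i, τ (a i - a i * a i) := by
  classical
  have hle : ∀ i, a i ≤ 1 := fun i => by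
    rw [← h1]; exact Finset.single_le_sum (fun i _ => h0 i) (Finset.mem_univ i)
  have hd : ∀ i, 0 ≤ a i - a i * a i := fun i => sub_nonneg.2 (mul_self_le_self (h0 i) (hle i))
  choose P hP hPu hPl using fun i => exists_rounding_projection hD (h0 i) (hle i)
  set e := ∑ i, τ (a i - a i * a i) with he
  set D := ∑ i, (a i - a i * a i) with hDdef
  have hD0 : 0 ≤ D := Finset.sum_nonneg fun i _ => hd i
  have hD1 : D ≤ 1 := by
    rw [hDdef, Finset.sum_sub_distrib, h1, sub_le_self_iff]
    refine Finset.sum_nonneg fun i _ => ?_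
    have := star_mul_self_nonneg (a i)
    rwa [(h0 i).isSelfAdjoint.star_eq] at this
  have hτD : τ D = e := by rw [hDdef, map_sum]
  set T := ∑ i, P i with hT
  set X := T - 1 with hX
  have hXs : X = ∑ i, (P i - a i) := by rw [Finset.sum_sub_distrib, h1]
  have hXu : X ≤ (2 : ℝ) • D := by
    rw [hXs, hDdef, Finset.smul_sum]; exact Finset.sum_le_sum fun i _ => hPu i
  have hXl : -((2 : ℝ) • D) ≤ X := by
    rw [hXs, hDdef, Finset.smul_sum, ← Finset.sum_neg_distrib]
    exact Finset.sum_le_sum fun i _ => hPl i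
  have hsm : ∀ x : N, ((2 : ℝ) • x) * ((2 : ℝ) • x) = (4 : ℝ) • (x * x) := fun x => by
    rw [smul_mul_smul_comm]; norm_num
  have hXX : τ (X * X) ≤ 4 * e := by
    have := hτ.sq_le_sq hXu hXl
    rw [hsm, map_smul, smul_eq_mul] at this
    have := hτ.mul_self_le hD0 hD1
    linarith
  have hτXu : τ X ≤ 2 * e := by
    have := hτ.mono hXu
    rwa [map_smul, smul_eq_mul, hτD] at this
  have hτXl : -(2 * e) ≤ τ X := by
    have := hτ.mono hXl
    rwa [map_neg, map_smul, smul_eq_mul, hτD] at this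
  have hTX : T = 1 + X := by rw [hX]; abel
  obtain ⟨P', F, hF, k1, k2, k3, k4, k5⟩ :=
    exists_independent_subprojections hD hτ Finset.univ P hP
  simp only [Finset.mem_univ, forall_const] at k1 k2 k3 k5
  have hTsa : star T = T := by
    rw [hT, star_sum]; exact Finset.sum_congr rfl fun i _ => (hP i).star_eq
  -- F acts as the identity on T, so this is τ((T - F)²) ≥ 0. It bounds the trace of F from below by
  -- moments of T alone.
  have hτF : 2 * τ T - τ (T * T) ≤ τ F := by
    have hFT : F * T = T := by
      rw [hT, Finset.mul_sum]; exact Finset.sum_congr rfl fun i _ => k3 i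
    have hTF : T * F = T := by
      have := congrArg star hFT
      rwa [star_mul, hTsa, hF.star_eq] at this
    have := hτ.star_mul_self_nonneg (T - F)
    rw [star_sub, hTsa, hF.star_eq] at this
    simp only [sub_mul, mul_sub, hFT, hTF, hF.mul_self, map_sub] at this
    linarith
  have hloss : τ T - τ F ≤ 6 * e := by
    have : T * T = T + X + X * X := by rw [hTX]; noncomm_ring
    rw [this, map_add, map_add] at hτF
    linarith
  set T' := ∑ i, P' i with hT'
  have hτT' : τ T' = τ F := by rw [hT', map_sum, k4]
  have hsub : ∀ i, IsStarProjection (P i - P' i) := fun i =>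
    (k1 i).sub_of_mul_eq_right (hP i) (k2 i)
  set R := T - T' with hR
  have hRs : R = ∑ i, (P i - P' i) := by rw [Finset.sum_sub_distrib]
  have hR0 : 0 ≤ R := by rw [hRs]; exact Finset.sum_nonneg fun i _ => (hsub i).zero_le
  -- A uniform operator bound turns the small trace of R into a small second moment: τ(R²) ≤ 3 τ(R)
  -- ≤ 18 e.
  have hR3 : R ≤ (3 : ℝ) • (1 : N) := by
    have : 0 ≤ T' := Finset.sum_nonneg fun i _ => (k1 i).zero_le
    calc R ≤ T := sub_le_self _ this
      _ = 1 + X := hTX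
      _ ≤ 1 + (2 : ℝ) • (1 : N) := by
          gcongr; exact hXu.trans (smul_le_smul_of_nonneg_left hD1 (by norm_num))
      _ = (3 : ℝ) • (1 : N) := by module
  have hRsa : star R = R := hR0.isSelfAdjoint.star_eq
  have hXsa : star X = X := by rw [hX, star_sub, hTsa, star_one]
  have hRR : τ (R * R) ≤ 18 * e := by
    have := hτ.mul_nonneg hR0 (sub_nonneg.2 hR3)
    rw [mul_sub, mul_smul_comm, mul_one, map_sub, map_smul, smul_eq_mul] at this
    have h2 : τ R = τ T - τ F := by rw [hR, map_sub, hτT']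
    linarith
  have hZZ : τ ((T' - 1) * (T' - 1)) ≤ 44 * e := by
    have h := hτ.sq_add_le X (-R)
    have e1 : X + -R = T' - 1 := by rw [hX, hR]; abel
    have e2 : star (T' - 1) = T' - 1 := by
      rw [← e1, star_add, star_neg, hRsa, hXsa]
    rw [e1, e2, star_neg, hRsa, hXsa, neg_mul_neg] at h
    linarith
  obtain ⟨Q, q1, q2, q3, q4, q5⟩ := exists_orthogonal_of_independent hD hτ P' k1 k5
  set r := 1 - ∑ i, Q i with hr
  have hrp : IsStarProjection r := q3.one_sub
  have hτr : τ r ≤ 8 * e := by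
    have : τ T = 1 + τ X := by rw [hTX, map_add, hτ.one]
    rw [hr, map_sub, hτ.one, map_sum, Finset.sum_congr rfl fun i _ => q4 i, k4]
    linarith
  obtain ⟨i₀⟩ := ‹Nonempty ι›
  have hQr : ∀ i, Q i * r = 0 := by
    intro i
    rw [hr, mul_sub, mul_one, Finset.mul_sum, Finset.sum_eq_single i, (q1 i).mul_self, sub_self]
    · intro j _ hj; exact q2 i j (Ne.symm hj)
    · simp
  have hrQ : ∀ i, r * Q i = 0 := by
    intro i
    have := congrArg star (hQr i)
    rwa [star_mul, (q1 i).star_eq, hrp.star_eq, star_zero] at this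
  -- The orthogonal projections need not sum to 1; the remainder r, of trace at most 8 e, is given
  -- to one arbitrary outcome.
  set z : ι → N := fun i => if i = i₀ then r else 0 with hz
  have hzp : ∀ i, IsStarProjection (z i) := fun i => by
    simp only [hz]; split_ifs
    · exact hrp
    · exact IsStarProjection.zero N
  have hQz : ∀ i j, Q i * z j = 0 := fun i j => by simp only [hz]; split_ifs <;> simp [hQr]
  have hzQ : ∀ i j, z i * Q j = 0 := fun i j => by simp only [hz]; split_ifs <;> simp [hrQ]
  refine ⟨fun i => Q i + z i, fun i => (q1 i).add (hzp i) (hQz i i), ?_, ?_, ?_⟩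
  · intro i j hij
    have : z i * z j = 0 := by
      simp only [hz]; split_ifs with h h'
      · exact absurd (h.trans h'.symm) hij
      all_goals simp
    change (Q i + z i) * (Q j + z j) = 0
    rw [add_mul, mul_add, mul_add, q2 i j hij, hQz, hzQ, this]
    simp
  · rw [Finset.sum_add_distrib]
    simp only [hz, Finset.sum_ite_eq', Finset.mem_univ, if_true, hr]
    abel
  · have hPa : ∀ i, τ (star (P i - a i) * (P i - a i)) ≤ 4 * τ (a i - a i * a i) := by
      intro i
      have hsa : star (P i - a i) = P i - a i := by
        rw [star_sub, (hP i).star_eq, (h0 i).isSelfAdjoint.star_eq]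
      have h := hτ.sq_le_sq (hPu i) (hPl i)
      rw [hsm, map_smul, smul_eq_mul] at h
      rw [hsa]
      have hd1 : a i - a i * a i ≤ 1 := by
        refine (sub_le_self _ ?_).trans (hle i)
        have := star_mul_self_nonneg (a i)
        rwa [(h0 i).isSelfAdjoint.star_eq] at this
      have := hτ.mul_self_le (hd i) hd1
      linarith
    have hPP : ∀ i, star (P' i - P i) * (P' i - P i) = P i - P' i := by
      intro i
      rw [← neg_sub, star_neg, (hsub i).star_eq, neg_mul_neg, (hsub i).mul_self]
    have hzz : ∀ i, star (z i) * z i = z i := fun i => by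
      rw [(hzp i).star_eq, (hzp i).mul_self]
    calc _ ≤ ∑ i, 4 * (τ (star (z i) * z i) + τ (star (Q i - P' i) * (Q i - P' i))
          + τ (star (P' i - P i) * (P' i - P i)) + τ (star (P i - a i) * (P i - a i))) := by
            refine Finset.sum_le_sum fun i _ => ?_
            have := hτ.sq_add_four_le (z i) (Q i - P' i) (P' i - P i) (P i - a i)
            have e : z i + (Q i - P' i) + (P' i - P i + (P i - a i)) = Q i + z i - a i := by abel
            rwa [e] at this
      _ ≤ ∑ i, 4 * (τ (z i) + τ (star (Q i - P' i) * (Q i - P' i))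
          + τ (P i - P' i) + 4 * τ (a i - a i * a i)) := by
            refine Finset.sum_le_sum fun i _ => ?_
            rw [hzz, hPP]
            have := hPa i
            linarith
      _ = 4 * (τ r + ∑ i, τ (star (Q i - P' i) * (Q i - P' i)) + τ R + 4 * e) := by
            rw [← Finset.mul_sum, Finset.sum_add_distrib, Finset.sum_add_distrib,
              Finset.sum_add_distrib, ← map_sum, ← map_sum τ (fun i => P i - P' i), ← hRs,
              ← Finset.mul_sum, ← he]
            simp [hz]
      -- 776 = 4 (8 + 4·44 + 6 + 4): the remainder, the symmetric orthogonalization, the cut to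
      -- independent subprojections and the spectral rounding.
      _ ≤ 776 * e := by
            have : τ R = τ T - τ F := by rw [hR, map_sub, hτT']
            linarith

end Orthonormalization

/-! ### Stability of joint statistics and correlated pairs of measurements -/

section Rounding

variable {N : Type*} [CStarAlgebra N] [PartialOrder N] [StarOrderedRing N]

namespace IsTracialState

variable {τ : N →ₗ[ℝ] ℝ} (hτ : IsTracialState τ)
include hτ

/-- Cauchy-Schwarz for weighted families. -/
theorem two_mul_sum_le {ι : Type*} (S : Finset ι) {w : ι → ℝ} (hw : ∀ i ∈ S, 0 ≤ w i) {F : ι → N}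
    (hF : ∀ i ∈ S, 0 ≤ F i) (x y : ι → N) :
    2 * ∑ i ∈ S, w i * τ (Star.star (x i) * F i * y i) ≤
      2 * √((∑ i ∈ S, w i * τ (Star.star (x i) * F i * x i)) *
        ∑ i ∈ S, w i * τ (Star.star (y i) * F i * y i)) := by
  refine le_two_sqrt_of_forall
    (Finset.sum_nonneg fun i hi => _root_.mul_nonneg (hw i hi) (hτ.conj_nonneg (hF i hi) _))
    (Finset.sum_nonneg fun i hi => _root_.mul_nonneg (hw i hi) (hτ.conj_nonneg (hF i hi) _))
    fun θ hθ => ?_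
  rw [Finset.mul_sum, Finset.mul_sum, Finset.mul_sum, ← Finset.sum_add_distrib]
  refine Finset.sum_le_sum fun i hi => ?_
  have := mul_le_mul_of_nonneg_left (hτ.two_mul_le (hF i hi) (x i) (y i) hθ) (hw i hi)
  linarith

theorem conj_add {F : N} (hF : 0 ≤ F) (x y : N) :
    τ (Star.star y * F * y) = τ (Star.star x * F * x) + 2 * τ (Star.star x * F * (y - x))
      + τ (Star.star (y - x) * F * (y - x)) := by
  have e2 : τ (Star.star y * F * x) = τ (Star.star x * F * y) := by
    rw [← hτ.star (Star.star y * F * x)]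
    simp [mul_assoc, hF.isSelfAdjoint.star_eq]
  simp only [star_sub, sub_mul, mul_sub, map_sub]
  linarith

/-- The weighted seminorm `∑ w τ (x* F x)` is continuous: lower bound. -/
theorem sum_conj_lower {ι : Type*} (S : Finset ι) {w : ι → ℝ} (hw : ∀ i ∈ S, 0 ≤ w i)
    {F : ι → N} (hF : ∀ i ∈ S, 0 ≤ F i) (x y : ι → N) :
    ∑ i ∈ S, w i * τ (Star.star (x i) * F i * x i)
      - 2 * √((∑ i ∈ S, w i * τ (Star.star (x i) * F i * x i)) *
        ∑ i ∈ S, w i * τ (Star.star (y i - x i) * F i * (y i - x i)))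
      ≤ ∑ i ∈ S, w i * τ (Star.star (y i) * F i * y i) := by
  have h := hτ.two_mul_sum_le S hw hF x (fun i => x i - y i)
  have e1 : ∀ i, τ (Star.star (x i - y i) * F i * (x i - y i))
      = τ (Star.star (y i - x i) * F i * (y i - x i)) := fun i => by
    rw [← neg_sub (y i) (x i), star_neg, neg_mul, neg_mul_neg]
  simp only [e1] at h
  have e2 : ∑ i ∈ S, w i * τ (Star.star (y i) * F i * y i)
      = ∑ i ∈ S, w i * τ (Star.star (x i) * F i * x i)
        - 2 * ∑ i ∈ S, w i * τ (Star.star (x i) * F i * (x i - y i))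
        + ∑ i ∈ S, w i * τ (Star.star (y i - x i) * F i * (y i - x i)) := by
    rw [Finset.mul_sum, ← Finset.sum_sub_distrib, ← Finset.sum_add_distrib]
    refine Finset.sum_congr rfl fun i hi => ?_
    rw [hτ.conj_add (hF i hi) (x i) (y i), ← neg_sub (y i) (x i), mul_neg, map_neg]
    ring
  have : 0 ≤ ∑ i ∈ S, w i * τ (Star.star (y i - x i) * F i * (y i - x i)) :=
    Finset.sum_nonneg fun i hi => _root_.mul_nonneg (hw i hi) (hτ.conj_nonneg (hF i hi) _)
  rw [e2]
  linarith

/-- The weighted seminorm `∑ w τ (x* F x)` is continuous: upper bound. -/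
theorem sum_conj_upper {ι : Type*} (S : Finset ι) {w : ι → ℝ} (hw : ∀ i ∈ S, 0 ≤ w i)
    {F : ι → N} (hF : ∀ i ∈ S, 0 ≤ F i) (x y : ι → N) :
    ∑ i ∈ S, w i * τ (Star.star (y i) * F i * y i) ≤
    ∑ i ∈ S, w i * τ (Star.star (x i) * F i * x i)
      + 2 * √((∑ i ∈ S, w i * τ (Star.star (x i) * F i * x i)) *
        ∑ i ∈ S, w i * τ (Star.star (y i - x i) * F i * (y i - x i)))
      + ∑ i ∈ S, w i * τ (Star.star (y i - x i) * F i * (y i - x i)) := by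
  have h := hτ.two_mul_sum_le S hw hF x (fun i => y i - x i)
  have e2 : ∑ i ∈ S, w i * τ (Star.star (y i) * F i * y i)
      = ∑ i ∈ S, w i * τ (Star.star (x i) * F i * x i)
        + 2 * ∑ i ∈ S, w i * τ (Star.star (x i) * F i * (y i - x i))
        + ∑ i ∈ S, w i * τ (Star.star (y i - x i) * F i * (y i - x i)) := by
    rw [Finset.mul_sum, ← Finset.sum_add_distrib, ← Finset.sum_add_distrib]
    refine Finset.sum_congr rfl fun i hi => ?_
    rw [hτ.conj_add (hF i hi) (x i) (y i)]
    ring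
  rw [e2]
  linarith

theorem conj_le_of_le_one {F : N} (h1 : F ≤ 1) (x : N) :
    τ (Star.star x * F * x) ≤ τ (Star.star x * x) := by
  simpa using hτ.conj_le_conj h1 x

/-- For a nearly projective measurement `a`, replacing `a` by a nearby projective measurement `Q`
hardly changes the joint statistics with arbitrary effects `F`. -/
theorem abs_sum_sub_sum_le {ι : Type*} [Fintype ι] {a Q F : ι → N} (h0 : ∀ i, 0 ≤ a i)
    (h1 : ∑ i, a i = 1) (hQ : ∀ i, IsStarProjection (Q i)) (hF0 : ∀ i, 0 ≤ F i)
    (hF1 : ∀ i, F i ≤ 1)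
    (hQa : ∑ i, τ (Star.star (Q i - a i) * (Q i - a i)) ≤ 776 * ∑ i, τ (a i - a i * a i)) :
    |∑ i, τ (Q i * F i) - ∑ i, τ (a i * F i)| ≤ 840 * √(∑ i, τ (a i - a i * a i)) := by
  set e := ∑ i, τ (a i - a i * a i) with he
  have hle : ∀ i, a i ≤ 1 := fun i => by
    rw [← h1]; exact Finset.single_le_sum (fun i _ => h0 i) (Finset.mem_univ i)
  have hd : ∀ i, 0 ≤ a i - a i * a i := fun i => sub_nonneg.2 (mul_self_le_self (h0 i) (hle i))
  have hsa : ∀ i, Star.star (a i) = a i := fun i => (h0 i).isSelfAdjoint.star_eq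
  have he0 : 0 ≤ e := Finset.sum_nonneg fun i _ => hτ.nonneg _ (hd i)
  have hsq0 : ∀ i, 0 ≤ τ (a i * a i) := fun i => by
    have := hτ.star_mul_self_nonneg (a i); rwa [hsa] at this
  have hsum : ∑ i, τ (a i) = 1 := by rw [← map_sum, h1, hτ.one]
  have hsq1 : ∑ i, τ (a i * a i) = 1 - e := by
    rw [he]; simp only [map_sub, Finset.sum_sub_distrib, hsum]; ring
  have he1 : e ≤ 1 := by
    have : 0 ≤ ∑ i, τ (a i * a i) := Finset.sum_nonneg fun i _ => hsq0 i
    linarith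
  have hes : e ≤ √e := by
    rw [Real.le_sqrt he0 he0]; nlinarith
  have hw : ∀ i ∈ (Finset.univ : Finset ι), (0 : ℝ) ≤ (fun _ => 1 : ι → ℝ) i := by simp
  have up := hτ.sum_conj_upper Finset.univ hw (fun i _ => hF0 i) a Q
  have lo := hτ.sum_conj_lower Finset.univ hw (fun i _ => hF0 i) a Q
  simp only [one_mul] at up lo
  set qa := ∑ i, τ (Star.star (a i) * F i * a i) with hqa
  set qQ := ∑ i, τ (Star.star (Q i) * F i * Q i) with hqQ
  set qd := ∑ i, τ (Star.star (Q i - a i) * F i * (Q i - a i)) with hqd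
  have hqd1 : qd ≤ 776 * e :=
    (Finset.sum_le_sum fun i _ => hτ.conj_le_of_le_one (hF1 i) _).trans hQa
  have hqd0 : 0 ≤ qd := Finset.sum_nonneg fun i _ => hτ.conj_nonneg (hF0 i) _
  have hqa0 : 0 ≤ qa := Finset.sum_nonneg fun i _ => hτ.conj_nonneg (hF0 i) _
  have hqa1 : qa ≤ 1 := by
    calc qa ≤ ∑ i, τ (a i * a i) := Finset.sum_le_sum fun i _ => by
          have := hτ.conj_le_of_le_one (hF1 i) (a i); rw [hsa] at this ⊢; exact this
      _ ≤ 1 := by linarith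
  have hroot : √(qa * qd) ≤ 28 * √e := by
    calc √(qa * qd) ≤ √(28 ^ 2 * e) := Real.sqrt_le_sqrt (by nlinarith)
      _ = 28 * √e := by rw [Real.sqrt_mul (by norm_num), Real.sqrt_sq (by norm_num)]
  -- For projections τ(Q F) = τ(Q F Q) exactly. For the POVM a the same replacement costs at most
  -- the defect e, so only the quadratic forms qQ and qa need comparing.
  have eQ : ∑ i, τ (Q i * F i) = qQ := by
    refine Finset.sum_congr rfl fun i _ => ?_
    rw [(hQ i).star_eq, hτ.mul_comm (Q i * F i), ← mul_assoc, (hQ i).mul_self]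
  have ea : ∑ i, τ (a i * F i) - qa = ∑ i, τ ((a i - a i * a i) * F i) := by
    rw [hqa, ← Finset.sum_sub_distrib]
    refine Finset.sum_congr rfl fun i _ => ?_
    rw [hsa, hτ.mul_comm (a i * F i), sub_mul, map_sub, mul_assoc]
  have ea0 : 0 ≤ ∑ i, τ ((a i - a i * a i) * F i) :=
    Finset.sum_nonneg fun i _ => hτ.mul_nonneg (hd i) (hF0 i)
  have ea1 : ∑ i, τ ((a i - a i * a i) * F i) ≤ e := by
    refine Finset.sum_le_sum fun i _ => ?_
    have := hτ.mul_le_mul_right (hF1 i) (hd i)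
    rw [one_mul] at this
    rwa [hτ.mul_comm]
  -- The losses are 2·28 √e from Cauchy-Schwarz (776 ≤ 28²), at most 776 e from the quadratic term
  -- and e from the defect; e ≤ √e because e ≤ 1.
  rw [eQ, abs_le]
  constructor <;> linarith

end IsTracialState

/-! ### Correlated POVMs -/

/-- `A` is a POVM, `B` a sub-POVM, and the state `s` sees disagreement `d` between them. -/
structure IsCorrelatedPair {ι : Type*} [Fintype ι] (τ : N →ₗ[ℝ] ℝ) (s : N) (A B : ι → N) (d : ℝ) :
    Prop where
  nonneg_left : ∀ i, 0 ≤ A i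
  sum_left : ∑ i, A i = 1
  nonneg_right : ∀ i, 0 ≤ B i
  sum_right : ∑ i, B i ≤ 1
  agree : ∑ i, τ (s * A i * s * B i) = τ (s * s) - d

namespace IsCorrelatedPair

variable {ι : Type*} [Fintype ι] {τ : N →ₗ[ℝ] ℝ} {s : N} {A B : ι → N} {d : ℝ}
  (h : IsCorrelatedPair τ s A B d)
include h

theorem star_left (i : ι) : star (A i) = A i := (h.nonneg_left i).isSelfAdjoint.star_eq

theorem star_right (i : ι) : star (B i) = B i := (h.nonneg_right i).isSelfAdjoint.star_eq

theorem left_le (i : ι) : A i ≤ 1 := by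
  rw [← h.sum_left]
  exact Finset.single_le_sum (fun i _ => h.nonneg_left i) (Finset.mem_univ i)

theorem right_le (i : ι) : B i ≤ 1 :=
  (Finset.single_le_sum (fun i _ => h.nonneg_right i) (Finset.mem_univ i)).trans h.sum_right

theorem left_defect (i : ι) : 0 ≤ A i - A i * A i :=
  sub_nonneg.2 (mul_self_le_self (h.nonneg_left i) (h.left_le i))

theorem right_defect (i : ι) : 0 ≤ B i - B i * B i :=
  sub_nonneg.2 (mul_self_le_self (h.nonneg_right i) (h.right_le i))

variable (hτ : IsTracialState τ) (hs : 0 ≤ s)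
include hτ hs

omit h hτ in
theorem mul_self_nonneg' : 0 ≤ s * s := by
  have := star_mul_self_nonneg s
  rwa [hs.isSelfAdjoint.star_eq] at this

omit [StarOrderedRing N] hτ hs in
theorem sum_left_eq : ∑ i, τ (s * s * A i) = τ (s * s) := by
  rw [← map_sum, ← Finset.mul_sum, h.sum_left, mul_one]

theorem sum_right_le : ∑ i, τ (s * s * B i) ≤ τ (s * s) := by
  rw [← map_sum, ← Finset.mul_sum, hτ.mul_comm]
  simpa using hτ.mul_le_mul_right h.sum_right (mul_self_nonneg' hs)

theorem sum_left_sq_le : ∑ i, τ (s * s * (A i * A i)) ≤ τ (s * s) := by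
  rw [← h.sum_left_eq]
  refine Finset.sum_le_sum fun i _ => ?_
  have := hτ.mul_nonneg (mul_self_nonneg' hs) (h.left_defect i)
  rw [mul_sub, map_sub] at this
  linarith

theorem sum_right_sq_le : ∑ i, τ (s * s * (B i * B i)) ≤ τ (s * s) := by
  refine le_trans (Finset.sum_le_sum fun i _ => ?_) (h.sum_right_le hτ hs)
  have := hτ.mul_nonneg (mul_self_nonneg' hs) (h.right_defect i)
  rw [mul_sub, map_sub] at this
  linarith

/-- Serves in two directions. Each sum of squares is at most τ(s²), so A s and s B are close. As the
left side is nonnegative, neither sum can fall below τ(s²) by more than 2 d, so both measurements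
are almost projective against s². -/
theorem diff_eq : ∑ i, τ (star (A i * s - s * B i) * (A i * s - s * B i))
    = ∑ i, τ (s * s * (A i * A i)) + ∑ i, τ (s * s * (B i * B i)) - 2 * (τ (s * s) - d) := by
  rw [← h.agree, Finset.mul_sum, ← Finset.sum_add_distrib, ← Finset.sum_sub_distrib]
  refine Finset.sum_congr rfl fun i _ => ?_
  rw [star_sub, star_mul, star_mul, h.star_left, h.star_right, hs.isSelfAdjoint.star_eq]
  have e1 : τ (s * A i * (A i * s)) = τ (s * s * (A i * A i)) := by
    rw [← mul_assoc, hτ.mul_comm]; simp only [mul_assoc]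
  have e2 : τ (B i * s * (s * B i)) = τ (s * s * (B i * B i)) := by
    rw [mul_assoc, hτ.mul_comm]; simp only [mul_assoc]
  have e3 : τ (s * A i * (s * B i)) = τ (s * A i * s * B i) := by simp only [mul_assoc]
  have e4 : τ (B i * s * (A i * s)) = τ (s * A i * s * B i) := by
    rw [← hτ.star]; simp only [star_mul, h.star_left, h.star_right, hs.isSelfAdjoint.star_eq,
      mul_assoc]
  simp only [sub_mul, mul_sub, map_sub, e1, e2, e3, e4]
  ring

theorem diff_le : ∑ i, τ (star (A i * s - s * B i) * (A i * s - s * B i)) ≤ 2 * d := by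
  rw [h.diff_eq hτ hs]
  have := h.sum_left_sq_le hτ hs
  have := h.sum_right_sq_le hτ hs
  linarith

theorem le_sum_left_sq : τ (s * s) - 2 * d ≤ ∑ i, τ (s * s * (A i * A i)) := by
  have h1 : 0 ≤ ∑ i, τ (star (A i * s - s * B i) * (A i * s - s * B i)) :=
    Finset.sum_nonneg fun i _ => hτ.star_mul_self_nonneg _
  rw [h.diff_eq hτ hs] at h1
  have := h.sum_right_sq_le hτ hs
  linarith

theorem le_sum_right_sq : τ (s * s) - 2 * d ≤ ∑ i, τ (s * s * (B i * B i)) := by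
  have h1 : 0 ≤ ∑ i, τ (star (A i * s - s * B i) * (A i * s - s * B i)) :=
    Finset.sum_nonneg fun i _ => hτ.star_mul_self_nonneg _
  rw [h.diff_eq hτ hs] at h1
  have := h.sum_left_sq_le hτ hs
  linarith

theorem sum_left_defect_le : ∑ i, τ (s * s * (A i - A i * A i)) ≤ 2 * d := by
  simp only [mul_sub, map_sub, Finset.sum_sub_distrib, h.sum_left_eq]
  have := h.le_sum_left_sq hτ hs
  linarith

theorem sum_right_defect_le : ∑ i, τ (s * s * (B i - B i * B i)) ≤ 2 * d := by
  simp only [mul_sub, map_sub, Finset.sum_sub_distrib]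
  have := h.le_sum_right_sq hτ hs
  have := h.sum_right_le hτ hs
  linarith

omit h in
-- The gap between the two sides is half the squared trace norm of the commutator of s and X.
theorem twisted_le {X : N} (hX : IsSelfAdjoint X) : τ (s * X * s * X) ≤ τ (s * s * (X * X)) := by
  have h1 := hτ.star_mul_self_nonneg (s * X - X * s)
  have e1 : τ (X * s * (s * X)) = τ (s * s * (X * X)) := by
    rw [mul_assoc, hτ.mul_comm]; simp only [mul_assoc]
  have e2 : τ (X * s * (X * s)) = τ (s * X * s * X) := by
    rw [mul_assoc, hτ.mul_comm]; simp only [mul_assoc]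
  have e3 : τ (s * X * (s * X)) = τ (s * X * s * X) := by simp only [mul_assoc]
  have e4 : τ (s * X * (X * s)) = τ (s * s * (X * X)) := by
    rw [← mul_assoc, hτ.mul_comm]; simp only [mul_assoc]
  rw [star_sub, star_mul, star_mul, hX.star_eq, hs.isSelfAdjoint.star_eq] at h1
  simp only [sub_mul, mul_sub, map_sub, e1, e2, e3, e4] at h1
  linarith

/-- The form x ↦ τ(s x s x) is nonnegative on self-adjoint elements. Applied to A - B, it moves the
agreement of A with B to the agreement of A with itself, so by `twisted_le` the commutators of A
with s are small. -/
theorem le_sum_left_twisted : τ (s * s) - 2 * d ≤ ∑ i, τ (s * A i * s * A i) := by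
  have h1 : ∀ i, 2 * τ (s * A i * s * B i) ≤ τ (s * A i * s * A i) + τ (s * B i * s * B i) := by
    intro i
    have hX : IsSelfAdjoint (A i - B i) := by
      rw [isSelfAdjoint_iff, star_sub, h.star_left, h.star_right]
    have := hτ.mul_nonneg hs (hX.conjugate_nonneg hs)
    have e4 : τ (s * (B i * s * A i)) = τ (s * A i * s * B i) := by
      rw [← hτ.star]
      simp only [star_mul, h.star_left, h.star_right, hs.isSelfAdjoint.star_eq]
      rw [hτ.mul_comm]; simp only [mul_assoc]
    have e3 : ∀ x y, τ (s * (x * s * y)) = τ (s * x * s * y) := fun x y => by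
      simp only [mul_assoc]
    simp only [sub_mul, mul_sub, map_sub, e4, e3] at this
    linarith
  have h2 : ∑ i, τ (s * B i * s * B i) ≤ τ (s * s) :=
    (Finset.sum_le_sum fun i _ => twisted_le hτ hs (h.nonneg_right i).isSelfAdjoint).trans
      (h.sum_right_sq_le hτ hs)
  have h3 := Finset.sum_le_sum fun i (_ : i ∈ Finset.univ) => h1 i
  rw [← Finset.mul_sum, h.agree, Finset.sum_add_distrib] at h3
  linarith

theorem disagree_nonneg : 0 ≤ d := by
  have h1 : 0 ≤ ∑ i, τ (star (A i * s - s * B i) * (A i * s - s * B i)) :=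
    Finset.sum_nonneg fun i _ => hτ.star_mul_self_nonneg _
  have := h.diff_le hτ hs
  linarith

theorem disagree_le : d ≤ τ (s * s) := by
  have : 0 ≤ ∑ i, τ (s * A i * s * B i) := Finset.sum_nonneg fun i _ =>
    hτ.mul_nonneg (hs.isSelfAdjoint.conjugate_nonneg (h.nonneg_left i)) (h.nonneg_right i)
  rw [h.agree] at this
  linarith

/-- Bob's measurement can be replaced by Alice's, applied on both sides of the state. -/
theorem sum_effect_le (ht : τ (s * s) ≤ 1) {F : ι → N} (hF0 : ∀ i, 0 ≤ F i) (hF1 : ∀ i, F i ≤ 1) :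
    ∑ i, τ (s * F i * s * B i) ≤ ∑ i, τ (s * s * (A i * F i * A i)) + 7 * √(√d) := by
  have hd0 := h.disagree_nonneg hτ hs
  have hd1 : d ≤ 1 := (h.disagree_le hτ hs).trans ht
  have hssa := hs.isSelfAdjoint.star_eq
  have hr0 : 0 ≤ √d := Real.sqrt_nonneg d
  have hr1 : √d ≤ 1 := Real.sqrt_le_one.2 hd1
  have hrr : √d * √d = d := Real.mul_self_sqrt hd0
  have hq0 : 0 ≤ √√d := Real.sqrt_nonneg _
  have hqq : √√d * √√d = √d := Real.mul_self_sqrt hr0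
  have hq1 : √√d ≤ 1 := Real.sqrt_le_one.2 hr1
  -- Replacing B by B² costs the defect of B, at most 2 d, and makes the left side a quadratic form
  -- in s B, which can be compared with A s.
  have step1 : ∑ i, τ (s * F i * s * B i)
      ≤ ∑ i, τ (star (s * B i) * F i * (s * B i)) + 2 * d := by
    refine le_trans ?_ (add_le_add_right (h.sum_right_defect_le hτ hs) _)
    rw [← Finset.sum_add_distrib]
    refine Finset.sum_le_sum fun i _ => ?_
    have h1 := hτ.mul_le_mul_right (star_left_conjugate_le_conjugate (hF1 i) s) (h.right_defect i)
    have e : τ (star (s * B i) * F i * (s * B i)) = τ (s * F i * s * (B i * B i)) := by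
      rw [star_mul, h.star_right, hssa, mul_assoc (B i * s), mul_assoc (B i), hτ.mul_comm]
      simp only [mul_assoc]
    rw [e]
    rw [hssa, mul_one, mul_sub (s * F i * s), map_sub] at h1
    linarith
  have hw : ∀ i ∈ (Finset.univ : Finset ι), (0 : ℝ) ≤ (fun _ => 1 : ι → ℝ) i := by simp
  have up := hτ.sum_conj_upper Finset.univ hw (fun i _ => hF0 i) (fun i => A i * s)
    (fun i => s * B i)
  simp only [one_mul] at up
  set qa := ∑ i, τ (star (A i * s) * F i * (A i * s)) with hqa
  set qd := ∑ i, τ (star (s * B i - A i * s) * F i * (s * B i - A i * s)) with hqd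
  have eqa : qa = ∑ i, τ (s * s * (A i * F i * A i)) := by
    refine Finset.sum_congr rfl fun i _ => ?_
    rw [star_mul, h.star_left, hssa, ← mul_assoc, hτ.mul_comm]
    simp only [mul_assoc]
  have hqa0 : 0 ≤ qa := Finset.sum_nonneg fun i _ => hτ.conj_nonneg (hF0 i) _
  have hqa1 : qa ≤ 1 := by
    refine le_trans ?_ ((h.sum_left_sq_le hτ hs).trans ht)
    refine Finset.sum_le_sum fun i _ => (hτ.conj_le_of_le_one (hF1 i) _).trans ?_
    rw [star_mul, h.star_left, hssa, ← mul_assoc, hτ.mul_comm]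
    simp only [mul_assoc, le_refl]
  have hqd1 : qd ≤ 2 * d := by
    refine le_trans ?_ (h.diff_le hτ hs)
    refine Finset.sum_le_sum fun i _ => (hτ.conj_le_of_le_one (hF1 i) _).trans ?_
    rw [← neg_sub, star_neg, neg_mul_neg]
  have hqd0 : 0 ≤ qd := Finset.sum_nonneg fun i _ => hτ.conj_nonneg (hF0 i) _
  have hroot : √(qa * qd) ≤ 3 / 2 * √d := by
    calc √(qa * qd) ≤ √((3 / 2) ^ 2 * d) := Real.sqrt_le_sqrt (by nlinarith)
      _ = 3 / 2 * √d := by rw [Real.sqrt_mul (by norm_num), Real.sqrt_sq (by norm_num)]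
  rw [← eqa]
  -- The total loss is 2·(3/2) √d + 4 d, and d ≤ √d ≤ √√d because d ≤ 1.
  have : √d ≤ √√d := by nlinarith
  nlinarith

end IsCorrelatedPair

end Rounding

/-! ### States of finite spectrum and Connes' trick -/

section Staircase

variable {N : Type*} [CStarAlgebra N] [PartialOrder N] [StarOrderedRing N]

/-- The operator with eigenvalue `f i` on `E i`, `i ≤ n`. -/
noncomputable def diagOp (n : ℕ) (E : ℕ → N) (f : ℕ → ℝ) : N := ∑ i ∈ Finset.range (n + 1), f i • E i

/-- The projection on the eigenspaces with index larger than `k`. -/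
noncomputable def levelProj (n : ℕ) (E : ℕ → N) (k : ℕ) : N := diagOp n E fun i => if k < i then 1 else 0

/-- The weight of the `k`-th level of the square of `diagOp n E r`. -/
noncomputable def levelWeight (r : ℕ → ℝ) (k : ℕ) : ℝ := r (k + 1) ^ 2 - r k ^ 2

/-- A finite resolution of the identity with increasing eigenvalues starting at `0`. -/
structure IsStaircase (n : ℕ) (E : ℕ → N) (r : ℕ → ℝ) : Prop where
  proj : ∀ i, IsStarProjection (E i)
  orth : ∀ i j, i ≠ j → E i * E j = 0
  sum_eq : ∑ i ∈ Finset.range (n + 1), E i = 1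
  zero : r 0 = 0
  mono : Monotone r

namespace IsStaircase

variable {n : ℕ} {E : ℕ → N} {r : ℕ → ℝ} (h : IsStaircase n E r)
include h

theorem diagOp_mul (f g : ℕ → ℝ) : diagOp n E f * diagOp n E g = diagOp n E (fun i => f i * g i) := by
  rw [diagOp, diagOp, diagOp, Finset.sum_mul]
  refine Finset.sum_congr rfl fun i hi => ?_
  rw [Finset.mul_sum, Finset.sum_eq_single i]
  · rw [smul_mul_smul_comm, (h.proj i).mul_self]
  · intro j _ hj
    rw [smul_mul_smul_comm, h.orth i j (Ne.symm hj), smul_zero]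
  · intro hi'; exact absurd hi hi'

theorem diagOp_one : diagOp n E (fun _ => 1) = 1 := by
  simp only [diagOp, one_smul, h.sum_eq]

theorem star_diagOp (f : ℕ → ℝ) : star (diagOp n E f) = diagOp n E f := by
  simp only [diagOp, star_sum, star_smul, star_trivial, (h.proj _).star_eq]

theorem diagOp_nonneg {f : ℕ → ℝ} (hf : ∀ i, 0 ≤ f i) : 0 ≤ diagOp n E f :=
  Finset.sum_nonneg fun i _ => smul_nonneg (hf i) (h.proj i).zero_le

omit h in
theorem diagOp_sub (f g : ℕ → ℝ) :
    diagOp n E f - diagOp n E g = diagOp n E (fun i => f i - g i) := by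
  simp only [diagOp, sub_smul, Finset.sum_sub_distrib]

theorem levelProj_proj (k : ℕ) : IsStarProjection (levelProj n E k) := by
  refine ⟨?_, h.star_diagOp _⟩
  change levelProj n E k * levelProj n E k = levelProj n E k
  rw [levelProj, h.diagOp_mul]
  congr 1
  ext i
  split_ifs <;> simp

theorem one_sub_levelProj (k : ℕ) :
    1 - levelProj n E k = diagOp n E (fun i => if k < i then 0 else 1) := by
  rw [levelProj, ← h.diagOp_one, diagOp_sub]
  congr 1
  ext i
  split_ifs <;> simp

theorem r_nonneg (i : ℕ) : 0 ≤ r i := by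
  rw [← h.zero]; exact h.mono (Nat.zero_le i)

theorem levelWeight_nonneg (k : ℕ) : 0 ≤ levelWeight r k := by
  have := h.r_nonneg k
  have := h.mono (Nat.le_succ k)
  rw [levelWeight]
  simp only [Nat.succ_eq_add_one] at this
  nlinarith

theorem sum_levelWeight {j : ℕ} (hj : j ≤ n) :
    ∑ k ∈ Finset.range n, levelWeight r k * (if k < j then 1 else 0) = r j ^ 2 := by
  have e : ∑ k ∈ Finset.range n, levelWeight r k * (if k < j then 1 else 0)
      = ∑ k ∈ Finset.range j, levelWeight r k := by
    simp only [mul_ite, mul_one, mul_zero]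
    rw [← Finset.sum_filter]
    refine Finset.sum_congr ?_ fun _ _ => rfl
    ext k
    simp only [Finset.mem_filter, Finset.mem_range]
    omega
  rw [e]
  have := Finset.sum_range_sub (fun k => r k ^ 2) j
  simp only [levelWeight]
  rw [this, h.zero]
  ring

/-- The layer-cake decomposition of `s ^ 2`. -/
theorem sq_eq_sum : diagOp n E r * diagOp n E r
    = ∑ k ∈ Finset.range n, levelWeight r k • levelProj n E k := by
  rw [h.diagOp_mul]
  simp only [levelProj, diagOp, Finset.smul_sum, smul_smul]
  rw [Finset.sum_comm]
  refine Finset.sum_congr rfl fun j hj => ?_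
  rw [← Finset.sum_smul, h.sum_levelWeight (by simpa [Nat.lt_succ_iff] using hj), sq]

variable {τ : N →ₗ[ℝ] ℝ} (hτ : IsTracialState τ)

omit h in
theorem tr_diagOp (f g : ℕ → ℝ) (A : N) : τ (diagOp n E f * A * diagOp n E g * A)
    = ∑ i ∈ Finset.range (n + 1), ∑ j ∈ Finset.range (n + 1),
        f i * g j * τ (E i * A * E j * A) := by
  simp only [diagOp, Finset.sum_mul, Finset.mul_sum, map_sum]
  rw [Finset.sum_comm]
  refine Finset.sum_congr rfl fun i _ => Finset.sum_congr rfl fun j _ => ?_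
  simp only [smul_mul_assoc, mul_smul_comm, map_smul, smul_eq_mul]
  ring

include hτ

/-- The blocks τ(E_i A E_j A) form a positive measure on pairs of eigenvalues, so commutator
estimates reduce to scalar inequalities between r_i and r_j. -/
theorem tr_block_nonneg {A : N} (hA : IsSelfAdjoint A) (i j : ℕ) : 0 ≤ τ (E i * A * E j * A) := by
  have h1 := hτ.conj_nonneg (h.proj j).zero_le (A * E i)
  rw [star_mul, hA.star_eq, (h.proj i).star_eq] at h1
  have e : τ (E i * A * E j * (A * E i)) = τ (E i * A * E j * A) := by
    rw [← mul_assoc, hτ.mul_comm]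
    simp only [← mul_assoc, (h.proj i).mul_self]
  rwa [e] at h1

/-- Connes' trick: the commutators with the level projections are controlled by the commutator with
the operator. -/
theorem sum_levelProj_commutator_le {ι : Type*} [Fintype ι] {A : ι → N}
    (hA : ∀ a, IsSelfAdjoint (A a)) {t d : ℝ} (ht : 0 ≤ t) (hd : 0 ≤ d)
    (h1 : ∑ a, τ (diagOp n E r * diagOp n E r * (A a * A a)) ≤ t)
    (h2 : ∑ a, τ (diagOp n E r * diagOp n E r * (A a * A a))
      - ∑ a, τ (diagOp n E r * A a * diagOp n E r * A a) ≤ 2 * d) :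
    ∑ k ∈ Finset.range n, levelWeight r k *
      ∑ a, τ (levelProj n E k * A a * (1 - levelProj n E k) * A a) ≤ 4 * √(t * d) := by
  set s := diagOp n E r with hs
  have hs0 : 0 ≤ s := h.diagOp_nonneg h.r_nonneg
  -- Level k separates i from j exactly when j ≤ k < i. The weights of those levels telescope to
  -- r_i² - r_j², and there are none when i ≤ j.
  have hcoef : ∀ i ∈ Finset.range (n + 1), ∀ j ∈ Finset.range (n + 1),
      ∑ k ∈ Finset.range n, levelWeight r k *
        ((if k < i then (1 : ℝ) else 0) * (if k < j then 0 else 1))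
        ≤ |r i - r j| * (r i + r j) := by
    intro i hi j hj
    have hi' : i ≤ n := by simpa [Nat.lt_succ_iff] using hi
    have hj' : j ≤ n := by simpa [Nat.lt_succ_iff] using hj
    rcases le_total i j with hij | hij
    · rw [Finset.sum_eq_zero]
      · exact _root_.mul_nonneg (abs_nonneg _) (add_nonneg (h.r_nonneg _) (h.r_nonneg _))
      · intro k _
        by_cases hk : k < i
        · rw [if_pos (lt_of_lt_of_le hk hij)]; simp
        · rw [if_neg hk]; simp
    · have e : ∀ k, levelWeight r k * ((if k < i then (1 : ℝ) else 0) * (if k < j then 0 else 1))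
          = levelWeight r k * (if k < i then 1 else 0)
            - levelWeight r k * (if k < j then 1 else 0) := by
        intro k
        by_cases hk : k < j
        · rw [if_pos hk, if_pos (lt_of_lt_of_le hk hij), if_pos hk]; simp
        · rw [if_neg hk, if_neg hk]; simp
      simp only [e, Finset.sum_sub_distrib]
      rw [h.sum_levelWeight hi', h.sum_levelWeight hj', abs_of_nonneg (sub_nonneg.2 (h.mono hij))]
      apply le_of_eq; ring
  have h4 : 4 * √(t * d) = 2 * √((2 * t) * (2 * d)) := by
    rw [show (2 * t) * (2 * d) = 2 ^ 2 * (t * d) by ring,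
      Real.sqrt_mul (by norm_num : (0 : ℝ) ≤ 2 ^ 2), Real.sqrt_sq (by norm_num : (0 : ℝ) ≤ 2)]
    ring
  rw [h4]
  -- Cauchy-Schwarz in the form |r_i - r_j| (r_i + r_j) ≤ (θ/2)(r_i + r_j)² + (1/(2θ))(r_i - r_j)².
  -- Against the block measure the first square is bounded by the mass, the second is the commutator
  -- with s.
  refine le_two_sqrt_of_forall (by positivity) (by positivity) fun θ hθ => ?_
  have key : ∀ a, ∑ k ∈ Finset.range n, levelWeight r k *
      τ (levelProj n E k * A a * (1 - levelProj n E k) * A a)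
      ≤ θ * (τ (s * s * (A a * A a)) + τ (s * A a * s * A a))
        + θ⁻¹ * (τ (s * s * (A a * A a)) - τ (s * A a * s * A a)) := by
    intro a
    set m : ℕ → ℕ → ℝ := fun i j => τ (E i * A a * E j * A a) with hm
    have hm0 : ∀ i j, 0 ≤ m i j := fun i j => h.tr_block_nonneg hτ (hA a) i j
    have e0 : ∑ k ∈ Finset.range n, levelWeight r k *
        τ (levelProj n E k * A a * (1 - levelProj n E k) * A a)
        = ∑ i ∈ Finset.range (n + 1), ∑ j ∈ Finset.range (n + 1),
          (∑ k ∈ Finset.range n, levelWeight r k *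
            ((if k < i then (1 : ℝ) else 0) * (if k < j then 0 else 1))) * m i j := by
      have e00 : ∀ k, τ (levelProj n E k * A a * (1 - levelProj n E k) * A a)
          = ∑ i ∈ Finset.range (n + 1), ∑ j ∈ Finset.range (n + 1),
            (if k < i then (1 : ℝ) else 0) * (if k < j then 0 else 1) * m i j := fun k => by
        rw [h.one_sub_levelProj, levelProj, tr_diagOp]
      simp only [e00, Finset.mul_sum, Finset.sum_mul]
      rw [Finset.sum_comm]
      refine Finset.sum_congr rfl fun i _ => ?_
      rw [Finset.sum_comm]
      refine Finset.sum_congr rfl fun j _ => Finset.sum_congr rfl fun k _ => ?_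
      ring
    have e1 : τ (s * s * (A a * A a)) = ∑ i ∈ Finset.range (n + 1), ∑ j ∈ Finset.range (n + 1),
        (r i * r i) * m i j := by
      have : s * s * (A a * A a) = diagOp n E (fun i => r i * r i) * A a * diagOp n E (fun _ => 1)
          * A a := by
        rw [h.diagOp_one, mul_one, ← h.diagOp_mul, mul_assoc _ (A a) (A a)]
      rw [this, tr_diagOp]
      simp [hm]
    have e2 : τ (s * s * (A a * A a)) = ∑ i ∈ Finset.range (n + 1), ∑ j ∈ Finset.range (n + 1),
        (r j * r j) * m i j := by
      have : τ (s * s * (A a * A a)) = τ (diagOp n E (fun _ => 1) * A a *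
          diagOp n E (fun i => r i * r i) * A a) := by
        rw [h.diagOp_one, one_mul, ← h.diagOp_mul, mul_assoc (A a), hτ.mul_comm (A a),
          mul_assoc (s * s)]
      rw [this, tr_diagOp]
      simp [hm]
    have e3 : τ (s * A a * s * A a) = ∑ i ∈ Finset.range (n + 1), ∑ j ∈ Finset.range (n + 1),
        (r i * r j) * m i j := tr_diagOp _ _ _
    have e4 : θ * (τ (s * s * (A a * A a)) + τ (s * A a * s * A a))
        + θ⁻¹ * (τ (s * s * (A a * A a)) - τ (s * A a * s * A a))
        = ∑ i ∈ Finset.range (n + 1), ∑ j ∈ Finset.range (n + 1),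
          (θ / 2 * (r i + r j) ^ 2 + θ⁻¹ / 2 * (r i - r j) ^ 2) * m i j := by
      have e12 : τ (s * s * (A a * A a)) = ∑ i ∈ Finset.range (n + 1),
          ∑ j ∈ Finset.range (n + 1), (1 / 2 * (r i * r i) + 1 / 2 * (r j * r j)) * m i j := by
        calc _ = 1 / 2 * τ (s * s * (A a * A a)) + 1 / 2 * τ (s * s * (A a * A a)) := by ring
          _ = _ := by
            nth_rw 1 [e1]
            rw [e2]
            simp only [Finset.mul_sum, ← Finset.sum_add_distrib]
            refine Finset.sum_congr rfl fun i _ => Finset.sum_congr rfl fun j _ => ?_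
            ring
      rw [e12, e3]
      simp only [Finset.mul_sum, ← Finset.sum_add_distrib, ← Finset.sum_sub_distrib]
      refine Finset.sum_congr rfl fun i _ => Finset.sum_congr rfl fun j _ => ?_
      ring
    rw [e0, e4]
    refine Finset.sum_le_sum fun i hi => Finset.sum_le_sum fun j hj =>
      mul_le_mul_of_nonneg_right ((hcoef i hi j hj).trans ?_) (hm0 i j)
    have hq : 0 ≤ (θ * (r i + r j) - |r i - r j|) ^ 2 := sq_nonneg _
    have hab : |r i - r j| ^ 2 = (r i - r j) ^ 2 := sq_abs _
    have : θ / 2 * (r i + r j) ^ 2 + θ⁻¹ / 2 * (r i - r j) ^ 2 - |r i - r j| * (r i + r j)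
        = θ⁻¹ / 2 * (θ * (r i + r j) - |r i - r j|) ^ 2 := by
      rw [← hab]; field_simp; ring
    have : 0 ≤ θ⁻¹ / 2 * (θ * (r i + r j) - |r i - r j|) ^ 2 := by positivity
    linarith
  have htw : ∑ a, τ (s * A a * s * A a) ≤ ∑ a, τ (s * s * (A a * A a)) :=
    Finset.sum_le_sum fun a _ => IsCorrelatedPair.twisted_le hτ hs0 (hA a)
  calc _ = ∑ a, ∑ k ∈ Finset.range n, levelWeight r k *
        τ (levelProj n E k * A a * (1 - levelProj n E k) * A a) := by
        simp only [Finset.mul_sum]; rw [Finset.sum_comm]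
    _ ≤ ∑ a, (θ * (τ (s * s * (A a * A a)) + τ (s * A a * s * A a))
        + θ⁻¹ * (τ (s * s * (A a * A a)) - τ (s * A a * s * A a))) :=
        Finset.sum_le_sum fun a _ => key a
    _ = θ * (∑ a, τ (s * s * (A a * A a)) + ∑ a, τ (s * A a * s * A a))
        + θ⁻¹ * (∑ a, τ (s * s * (A a * A a)) - ∑ a, τ (s * A a * s * A a)) := by
        rw [Finset.sum_add_distrib, ← Finset.mul_sum, ← Finset.mul_sum, Finset.sum_add_distrib,
          Finset.sum_sub_distrib]
    _ ≤ θ * (2 * t) + θ⁻¹ * (2 * d) := by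
        gcongr
        linarith

variable {ι : Type*} [Fintype ι] {A B : ι → N} {d : ℝ}
  (hc : IsCorrelatedPair τ (diagOp n E r) A B d)
  (ht : τ (diagOp n E r * diagOp n E r) ≤ 1)
include hc ht

theorem sum_commutator_le : ∑ k ∈ Finset.range n, levelWeight r k *
      ∑ a, τ (levelProj n E k * A a * (1 - levelProj n E k) * A a) ≤ 4 * √d := by
  have hs0 : 0 ≤ diagOp n E r := h.diagOp_nonneg h.r_nonneg
  have hd := hc.disagree_nonneg hτ hs0
  have := h.sum_levelProj_commutator_le hτ (fun a => (hc.nonneg_left a).isSelfAdjoint)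
    zero_le_one hd ((hc.sum_left_sq_le hτ hs0).trans ht) (by
      have := hc.sum_left_sq_le hτ hs0
      have := hc.le_sum_left_twisted hτ hs0
      linarith)
  rwa [one_mul] at this

/-- The compressions of Alice's measurement to the levels are nearly projective on average. -/
theorem sum_level_defect_le : ∑ k ∈ Finset.range n, levelWeight r k *
      ∑ a, τ (levelProj n E k * A a * levelProj n E k -
        levelProj n E k * A a * levelProj n E k * (levelProj n E k * A a * levelProj n E k))
      ≤ 6 * √d := by
  have hs0 : 0 ≤ diagOp n E r := h.diagOp_nonneg h.r_nonneg
  have hd0 := hc.disagree_nonneg hτ hs0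
  have hd1 := (hc.disagree_le hτ hs0).trans ht
  have hcomm := h.sum_commutator_le hτ hc ht
  have hdef := hc.sum_left_defect_le hτ hs0
  rw [h.sq_eq_sum] at hdef
  -- The defect of a compression splits into the compressed defect of A, which the layer-cake
  -- formula sums to at most 2 d, and the off-diagonal part, at most 4 √d by Connes' trick.
  have e : ∀ k a, τ (levelProj n E k * A a * levelProj n E k -
        levelProj n E k * A a * levelProj n E k * (levelProj n E k * A a * levelProj n E k))
      = τ (levelProj n E k * (A a - A a * A a))
        + τ (levelProj n E k * A a * (1 - levelProj n E k) * A a) := by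
    intro k a
    have hp := h.levelProj_proj k
    set p := levelProj n E k
    have e1 : τ (p * A a * p) = τ (p * A a) := by
      rw [hτ.mul_comm, ← mul_assoc, hp.mul_self]
    have e2 : τ (p * A a * p * (p * A a * p)) = τ (p * A a * p * A a) := by
      rw [← mul_assoc, hτ.mul_comm]
      simp only [← mul_assoc, hp.mul_self]
      rw [mul_assoc _ p p, hp.mul_self]
    rw [map_sub, e1, e2]
    simp only [mul_sub, sub_mul, mul_one, map_sub, ← mul_assoc]
    ring
  simp only [e, Finset.sum_add_distrib, mul_add]
  have e3 : ∑ k ∈ Finset.range n, levelWeight r k * ∑ a, τ (levelProj n E k * (A a - A a * A a))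
      = ∑ a, τ ((∑ k ∈ Finset.range n, levelWeight r k • levelProj n E k)
        * (A a - A a * A a)) := by
    simp only [Finset.sum_mul, map_sum, smul_mul_assoc, map_smul, smul_eq_mul, Finset.mul_sum]
    rw [Finset.sum_comm]
  rw [e3]
  have : d ≤ √d := by
    rw [Real.le_sqrt hd0 hd0]; nlinarith
  linarith

/-- Averaged over the levels, the joint statistics of the compressions are at least those of the
original pair of strategies. -/
theorem sum_level_effect_ge {F : ι → N} (hF0 : ∀ i, 0 ≤ F i) (hF1 : ∀ i, F i ≤ 1) :
    ∑ i, τ (diagOp n E r * F i * diagOp n E r * B i) - 13 * √(√d) ≤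
      ∑ k ∈ Finset.range n, levelWeight r k *
        ∑ i, τ (levelProj n E k * F i * levelProj n E k * A i) := by
  have hs0 : 0 ≤ diagOp n E r := h.diagOp_nonneg h.r_nonneg
  have h1 := hc.sum_effect_le hτ hs0 ht hF0 hF1
  have hcomm := h.sum_commutator_le hτ hc ht
  have hd0 := hc.disagree_nonneg hτ hs0
  set K := Finset.range n ×ˢ (Finset.univ : Finset ι)
  -- Compares A p with p A at every level: the first recovers the s² statistics by the layer-cake
  -- formula, the second is dominated by the statistics of the compression. Their distance is the
  -- averaged commutator.
  have lo := hτ.sum_conj_lower K (w := fun k => levelWeight r k.1) (F := fun k => F k.2)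
    (fun k _ => h.levelWeight_nonneg _) (fun k _ => hF0 _)
    (fun k => A k.2 * levelProj n E k.1) (fun k => levelProj n E k.1 * A k.2)
  simp only [K, Finset.sum_product] at lo
  simp only [← Finset.mul_sum] at lo
  set qx := ∑ k ∈ Finset.range n, levelWeight r k *
    ∑ i, τ (star (A i * levelProj n E k) * F i * (A i * levelProj n E k)) with hqx
  set qy := ∑ k ∈ Finset.range n, levelWeight r k *
    ∑ i, τ (star (levelProj n E k * A i) * F i * (levelProj n E k * A i)) with hqy
  set qd := ∑ k ∈ Finset.range n, levelWeight r k *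
    ∑ i, τ (star (levelProj n E k * A i - A i * levelProj n E k) * F i *
      (levelProj n E k * A i - A i * levelProj n E k)) with hqd
  have eqx : qx = ∑ i, τ (diagOp n E r * diagOp n E r * (A i * F i * A i)) := by
    rw [h.sq_eq_sum]
    simp only [Finset.sum_mul, map_sum, smul_mul_assoc, map_smul, smul_eq_mul]
    rw [Finset.sum_comm, hqx]
    refine Finset.sum_congr rfl fun k _ => ?_
    rw [Finset.mul_sum]
    refine Finset.sum_congr rfl fun i _ => ?_
    have hp := h.levelProj_proj k
    congr 1
    rw [star_mul, hp.star_eq, hc.star_left, ← mul_assoc, hτ.mul_comm]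
    simp only [← mul_assoc, hp.mul_self]
  have hqx1 : qx ≤ 1 := by
    rw [eqx]
    refine le_trans (Finset.sum_le_sum fun i _ => ?_) ((hc.sum_left_sq_le hτ hs0).trans ht)
    have h1 := star_left_conjugate_le_conjugate (hF1 i) (A i)
    rw [hc.star_left, mul_one] at h1
    rw [hτ.mul_comm, hτ.mul_comm _ (A i * A i)]
    exact hτ.mul_le_mul_right h1 (IsCorrelatedPair.mul_self_nonneg' hs0)
  have hqx0 : 0 ≤ qx := Finset.sum_nonneg fun k _ => mul_nonneg (h.levelWeight_nonneg k)
    (Finset.sum_nonneg fun i _ => hτ.conj_nonneg (hF0 i) _)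
  have hqd0 : 0 ≤ qd := Finset.sum_nonneg fun k _ => mul_nonneg (h.levelWeight_nonneg k)
    (Finset.sum_nonneg fun i _ => hτ.conj_nonneg (hF0 i) _)
  have hqd1 : qd ≤ 8 * √d := by
    have : qd ≤ 2 * ∑ k ∈ Finset.range n, levelWeight r k *
        ∑ a, τ (levelProj n E k * A a * (1 - levelProj n E k) * A a) := by
      rw [hqd, Finset.mul_sum]
      refine Finset.sum_le_sum fun k _ => ?_
      rw [mul_left_comm]
      refine mul_le_mul_of_nonneg_left ?_ (h.levelWeight_nonneg k)
      rw [Finset.mul_sum]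
      refine Finset.sum_le_sum fun i _ => (hτ.conj_le_of_le_one (hF1 i) _).trans (le_of_eq ?_)
      have hp := h.levelProj_proj k
      set p := levelProj n E k
      rw [star_sub, star_mul, star_mul, hp.star_eq, hc.star_left]
      have e1 : τ (A i * p * (p * A i)) = τ (p * A i * A i) := by
        rw [hτ.mul_comm]
        simp only [← mul_assoc]
        rw [hτ.mul_comm]
        simp only [← mul_assoc, hp.mul_self]
      have e2 : τ (A i * p * (A i * p)) = τ (p * A i * p * A i) := by
        rw [hτ.mul_comm]
        simp only [← mul_assoc]
        rw [hτ.mul_comm]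
        simp only [← mul_assoc]
      have e3 : τ (p * A i * (p * A i)) = τ (p * A i * p * A i) := by
        simp only [← mul_assoc]
      have e4 : τ (p * A i * (A i * p)) = τ (p * A i * A i) := by
        rw [← mul_assoc, hτ.mul_comm]
        simp only [← mul_assoc, hp.mul_self]
      simp only [sub_mul, mul_sub, map_sub, e1, e2, e3, e4, mul_one]
      ring
    linarith
  have eqy : qy ≤ ∑ k ∈ Finset.range n, levelWeight r k *
        ∑ i, τ (levelProj n E k * F i * levelProj n E k * A i) := by
    refine Finset.sum_le_sum fun k _ => mul_le_mul_of_nonneg_left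
      (Finset.sum_le_sum fun i _ => ?_) (h.levelWeight_nonneg k)
    have hp := h.levelProj_proj k
    set p := levelProj n E k
    have h1 := hτ.mul_nonneg (star_left_conjugate_nonneg (hF0 i) p) (hc.left_defect i)
    rw [hp.star_eq, mul_sub, map_sub] at h1
    have e : τ (star (p * A i) * F i * (p * A i)) = τ (p * F i * p * (A i * A i)) := by
      rw [star_mul, hp.star_eq, hc.star_left, mul_assoc (A i * p), mul_assoc (A i), hτ.mul_comm]
      simp only [← mul_assoc]
    rw [e]
    linarith
  have hr0 : 0 ≤ √d := Real.sqrt_nonneg d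
  -- Doubled, this costs 6 √√d; with the 7 √√d of `sum_effect_le` the total is 13.
  have hroot : √(qx * qd) ≤ 3 * √√d := by
    calc √(qx * qd) ≤ √(3 ^ 2 * √d) := Real.sqrt_le_sqrt (by nlinarith)
      _ = 3 * √√d := by rw [Real.sqrt_mul (by norm_num), Real.sqrt_sq (by norm_num)]
  rw [← eqx] at h1
  linarith

end IsStaircase

end Staircase

/-! ### Approximation of a positive operator by staircases -/

section StaircaseApproximation

variable {N : Type*} [CStarAlgebra N] [PartialOrder N] [StarOrderedRing N]

theorem mul_eq_zero_of_conj {b x : N} (hb : 0 ≤ b) (h : star x * b * x = 0) : b * x = 0 := by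
  obtain ⟨y, rfl⟩ := CStarAlgebra.nonneg_iff_eq_star_mul_self.1 hb
  have : y * x = 0 := eq_zero_of_star_mul_self (by rw [star_mul, ← h]; simp only [mul_assoc])
  rw [mul_assoc, this, mul_zero]

/-- Kernels grow as positive operators decrease. This carries support and orthogonality relations
from h to any staircase below it. -/
theorem mul_eq_zero_of_le {b b' x : N} (hb' : 0 ≤ b') (hle : b' ≤ b) (h : b * x = 0) :
    b' * x = 0 := by
  refine mul_eq_zero_of_conj hb' (le_antisymm ?_ (star_left_conjugate_nonneg hb' x))
  refine (star_left_conjugate_le_conjugate hle x).trans (le_of_eq ?_)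
  rw [mul_assoc, h, mul_zero]

/-- Every positive operator is approximated from below by a staircase of spectral projections. -/
theorem exists_staircase (hD : DouglasProperty N) {h : N} (hh : 0 ≤ h) {η : ℝ} (hη : 0 < η) :
    ∃ (n : ℕ) (E : ℕ → N), IsStaircase n E (fun j => j * η) ∧
      diagOp n E (fun j => j * η) ≤ h ∧ h ≤ diagOp n E (fun j => j * η) + η • (1 : N) ∧
      ∀ z, IsSelfAdjoint z → Commute h z → ∀ i, Commute (E i) z := by
  choose p hp hpb hk hc hcomm using fun l : ℝ => exists_spectral_cut hD hh.isSelfAdjoint l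
  have hanti : ∀ l l', l ≤ l' → p l * p l' = p l' := by
    intro l l' hl
    have h1 : upperPart h l * (1 - p l) = 0 := by
      have := congrArg star (hpb l)
      rw [star_mul, (hp l).star_eq, (upperPart_nonneg h l).isSelfAdjoint.star_eq] at this
      rw [mul_sub, mul_one, this, sub_self]
    have h2 := hk _ _ (mul_eq_zero_of_le (upperPart_nonneg h l') (upperPart_anti h hl) h1)
    have h3 := congrArg star h2
    rw [star_mul, (hp l).one_sub.star_eq, (hp l').star_eq, star_zero, sub_mul, one_mul,
      sub_eq_zero] at h3
    exact h3.symm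
  -- At index 0 the whole identity is taken instead of the cut at 0, so that the kernel of h belongs
  -- to the bottom step E_0 and the steps sum to 1.
  set Q : ℕ → N := fun j => if j = 0 then 1 else p (j * η) with hQ
  have hQp : ∀ j, IsStarProjection (Q j) := fun j => by
    simp only [hQ]; split_ifs
    · exact IsStarProjection.one N
    · exact hp _
  have hQanti : ∀ i j, i ≤ j → Q i * Q j = Q j := by
    intro i j hij
    simp only [hQ]
    by_cases hi : i = 0
    · simp [hi]
    · have hj : j ≠ 0 := by omega
      rw [if_neg hi, if_neg hj]
      exact hanti _ _ (by gcongr)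
  have hQanti' : ∀ i j, i ≤ j → Q j * Q i = Q j := fun i j hij => by
    have := congrArg star (hQanti i j hij)
    rwa [star_mul, (hQp _).star_eq, (hQp _).star_eq] at this
  have hQcomm : ∀ z, IsSelfAdjoint z → Commute h z → ∀ i, Commute (Q i) z := by
    intro z hz hhz i
    simp only [hQ]; split_ifs
    · exact Commute.one_left z
    · exact hcomm _ z hz hhz
  set E : ℕ → N := fun j => Q j - Q (j + 1) with hE
  have hEp : ∀ j, IsStarProjection (E j) := fun j =>
    (hQp _).sub_of_mul_eq_right (hQp _) (hQanti _ _ (Nat.le_succ j))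
  have horth : ∀ i j, i < j → E i * E j = 0 := by
    intro i j hij
    simp only [hE, sub_mul, mul_sub]
    rw [hQanti i j hij.le, hQanti i (j + 1) (by omega), hQanti (i + 1) j (by omega),
      hQanti (i + 1) (j + 1) (by omega)]
    abel
  have hEcomm : ∀ z, IsSelfAdjoint z → Commute h z → ∀ i, Commute (E i) z :=
    fun z hz hhz i => (hQcomm z hz hhz i).sub_left (hQcomm z hz hhz (i + 1))
  obtain ⟨n, hn⟩ := exists_nat_ge (‖h‖ / η)
  have hQn : Q (n + 1) = 0 := by
    have : upperPart h ((n + 1 : ℕ) * η) = 0 := by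
      apply upperPart_eq_zero
      rw [div_le_iff₀ hη] at hn
      push_cast
      linarith
    have := hk _ 1 (by rw [this, zero_mul])
    rw [mul_one] at this
    simp only [hQ]
    rw [if_neg (Nat.succ_ne_zero n), this]
  have hEsum : ∑ i ∈ Finset.range (n + 1), E i = 1 := by
    have := Finset.sum_range_sub' Q (n + 1)
    rw [hE, this, hQn, sub_zero]
    simp [hQ]
  have hhE : ∀ j, Commute h (E j) := fun j =>
    (hEcomm h hh.isSelfAdjoint (Commute.refl h) j).symm
  have hlow : ∀ j : ℕ, ((j : ℝ) * η) • E j ≤ h * E j := by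
    intro j
    by_cases hj : j = 0
    · subst hj
      simpa using Commute.mul_nonneg hh (hEp 0).zero_le (hhE 0)
    · obtain ⟨c, hc0, hhc, hpc, -⟩ := hc (j * η)
      have hQj : Q j = p (j * η) := by simp only [hQ]; rw [if_neg hj]
      have hQE : Q j * E j = E j := by
        simp only [hE, mul_sub]; rw [(hQp j).mul_self, hQanti _ _ (Nat.le_succ j)]
      have hcp : c * p (j * η) = 0 := by
        have := congrArg star hpc
        rwa [star_mul, (hp _).star_eq, hc0.isSelfAdjoint.star_eq, star_zero] at this
      have hcE : c * E j = 0 := by rw [← hQE, hQj, ← mul_assoc, hcp, zero_mul]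
      have : h * E j - ((j : ℝ) * η) • E j = upperPart h (j * η) * E j := by
        have := congrArg (· * E j) hhc
        simp only [sub_mul, smul_mul_assoc, one_mul, hcE, sub_zero] at this
        exact this
      rw [← sub_nonneg, this]
      exact Commute.mul_nonneg (upperPart_nonneg _ _) (hEp j).zero_le
        (upperPart_commute (hhE j) _)
  have hupp : ∀ j : ℕ, h * E j ≤ ((j : ℝ) * η) • E j + η • E j := by
    intro j
    obtain ⟨c, hc0, hhc, hpc, hcomm'⟩ := hc ((j + 1 : ℕ) * η)
    have hQj : Q (j + 1) = p ((j + 1 : ℕ) * η) := by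
      simp only [hQ]; rw [if_neg (Nat.succ_ne_zero j)]
    have hQE : Q (j + 1) * E j = 0 := by
      simp only [hE, mul_sub]; rw [(hQp _).mul_self, hQanti' _ _ (Nat.le_succ j), sub_self]
    have hbE : upperPart h ((j + 1 : ℕ) * η) * E j = 0 := by
      have := congrArg star (hpb ((j + 1 : ℕ) * η))
      rw [star_mul, (hp _).star_eq, (upperPart_nonneg h _).isSelfAdjoint.star_eq] at this
      rw [← this, ← hQj, mul_assoc, hQE, mul_zero]
    have : ((j : ℝ) * η) • E j + η • E j - h * E j = c * E j := by
      have h1 := congrArg (· * E j) hhc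
      simp only [sub_mul, smul_mul_assoc, one_mul, hbE, zero_sub] at h1
      have h2 : c * E j = ((j + 1 : ℕ) * η) • E j - h * E j := by
        rw [← neg_eq_iff_eq_neg.2 h1.symm.symm]
        simp
      rw [h2, ← add_smul]
      congr 2
      push_cast
      ring
    rw [← sub_nonneg, this]
    exact Commute.mul_nonneg hc0 (hEp j).zero_le (hEcomm c hc0.isSelfAdjoint hcomm' j).symm
  have hhsum : h = ∑ i ∈ Finset.range (n + 1), h * E i := by
    rw [← Finset.mul_sum, hEsum, mul_one]
  refine ⟨n, E, ⟨hEp, fun i j hij => ?_, hEsum, by simp, fun i j hij => by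
    change (i : ℝ) * η ≤ (j : ℝ) * η
    gcongr⟩,
    ?_, ?_, hEcomm⟩
  · rcases lt_or_gt_of_ne hij with h' | h'
    · exact horth i j h'
    · have := congrArg star (horth j i h')
      rwa [star_mul, (hEp _).star_eq, (hEp _).star_eq, star_zero] at this
  · rw [hhsum]; exact Finset.sum_le_sum fun j _ => hlow j
  · calc h = ∑ i ∈ Finset.range (n + 1), h * E i := hhsum
      _ ≤ ∑ i ∈ Finset.range (n + 1), (((i : ℝ) * η) • E i + η • E i) :=
          Finset.sum_le_sum fun j _ => hupp j
      _ = _ := by rw [Finset.sum_add_distrib, ← Finset.smul_sum, hEsum, diagOp]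

end StaircaseApproximation

/-! ### Von Neumann algebras: Douglas factorization, the trace, the commutant in standard form -/

section VonNeumann

variable {H : Type*} [NormedAddCommGroup H] [InnerProductSpace ℂ H] [CompleteSpace H]

namespace VonNeumannAlgebra

instance instSMulMemClass : SMulMemClass (VonNeumannAlgebra H) ℂ (H →L[ℂ] H) where
  smul_mem {S} r _ hx := S.toStarSubalgebra.smul_mem hx r

instance isClosed_coe (S : VonNeumannAlgebra H) : IsClosed (S : Set (H →L[ℂ] H)) := by
  rw [← S.centralizer_centralizer]
  exact Set.isClosed_centralizer _

theorem mem_iff_commute {S : VonNeumannAlgebra H} {x : H →L[ℂ] H} :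
    x ∈ S ↔ ∀ y ∈ S.commutant, y * x = x * y := by
  conv_lhs => rw [← S.commutant_commutant]
  exact mem_commutant_iff

theorem sqrt_mem {S : VonNeumannAlgebra H} {x : H →L[ℂ] H} (hx : x ∈ S) : CFC.sqrt x ∈ S := by
  rw [mem_iff_commute]
  intro y hy
  have : Commute x y := mem_commutant_iff.1 hy x hx
  rw [CFC.sqrt_eq_cfc]
  exact (this.cfc_nnreal _).eq.symm

/-- The square root of a positive element commutes with the commutant, hence stays in the algebra.
The order inherited from the bounded operators is therefore a star order, and the abstract trace
arguments apply inside M. -/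
instance instStarOrderedRing (S : VonNeumannAlgebra H) : StarOrderedRing S := by
  refine StarOrderedRing.of_nonneg_iff' (fun {x y} hxy z => ?_) fun x => ⟨fun hx => ?_, ?_⟩
  · exact add_le_add_right (α := H →L[ℂ] H) hxy _
  · have hx' : (0 : H →L[ℂ] H) ≤ x := hx
    refine ⟨⟨CFC.sqrt (x : H →L[ℂ] H), sqrt_mem x.2⟩, Subtype.ext ?_⟩
    change (x : H →L[ℂ] H) = star (CFC.sqrt (x : H →L[ℂ] H)) * CFC.sqrt (x : H →L[ℂ] H)
    rw [(CFC.sqrt_nonneg (x : H →L[ℂ] H)).isSelfAdjoint.star_eq, CFC.sqrt_mul_sqrt_self _ hx']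
  · rintro ⟨s, rfl⟩
    exact star_mul_self_nonneg (s : H →L[ℂ] H)

end VonNeumannAlgebra

theorem ContinuousLinearMap.re_inner_mono {x y : H →L[ℂ] H} (h : x ≤ y) (ξ : H) :
    RCLike.re ⟪ξ, x ξ⟫_ℂ ≤ RCLike.re ⟪ξ, y ξ⟫_ℂ := by
  have := ((ContinuousLinearMap.le_def x y).1 h).re_inner_nonneg_right ξ
  rw [sub_apply, inner_sub_right, map_sub] at this
  linarith

theorem ContinuousLinearMap.re_inner_star_mul_self (x : H →L[ℂ] H) (ξ : H) :
    RCLike.re ⟪ξ, (star x * x) ξ⟫_ℂ = ‖x ξ‖ ^ 2 := by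
  rw [mul_apply_eq_comp, ContinuousLinearMap.star_eq_adjoint,
    ContinuousLinearMap.adjoint_inner_right, inner_self_eq_norm_sq]

theorem ContinuousLinearMap.inner_star_left (x : H →L[ℂ] H) (ξ ζ : H) :
    ⟪(star x) ξ, ζ⟫_ℂ = ⟪ξ, x ζ⟫_ℂ := by
  rw [ContinuousLinearMap.star_eq_adjoint, ContinuousLinearMap.adjoint_inner_left]

theorem ContinuousLinearMap.inner_star_right (x : H →L[ℂ] H) (ξ ζ : H) :
    ⟪ξ, (star x) ζ⟫_ℂ = ⟪x ξ, ζ⟫_ℂ := by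
  rw [ContinuousLinearMap.star_eq_adjoint, ContinuousLinearMap.adjoint_inner_right]

/-- Von Neumann algebras have the Douglas factorization property. -/
theorem VonNeumannAlgebra.douglas (M : VonNeumannAlgebra H) : DouglasProperty M := by
  intro x S hS hle
  have hSsa : star (S : H →L[ℂ] H) = S := congrArg Subtype.val hS.star_eq
  have hnorm : ∀ ξ, ‖(x : H →L[ℂ] H) ξ‖ ≤ ‖(S : H →L[ℂ] H) ξ‖ := by
    intro ξ
    have h1 : star (x : H →L[ℂ] H) * x ≤ star (S : H →L[ℂ] H) * S := by rw [hSsa]; exact hle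
    have h2 := ContinuousLinearMap.re_inner_mono h1 ξ
    rw [ContinuousLinearMap.re_inner_star_mul_self,
      ContinuousLinearMap.re_inner_star_mul_self] at h2
    exact (sq_le_sq₀ (norm_nonneg _) (norm_nonneg _)).1 h2
  set V : Submodule ℂ H := (LinearMap.range (S : H →L[ℂ] H).toLinearMap).topologicalClosure with hV
  have hmemV : ∀ ξ, (S : H →L[ℂ] H) ξ ∈ V := fun ξ =>
    Submodule.le_topologicalClosure _ (LinearMap.mem_range_self _ ξ)
  have : CompleteSpace V := (Submodule.isClosed_topologicalClosure _).completeSpace_coe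
  set e : H →ₗ[ℂ] V := (S : H →L[ℂ] H).toLinearMap.codRestrict V hmemV with he
  have hdense : DenseRange e := by
    intro v
    have hv : (v : H) ∈ closure (Set.range (S : H →L[ℂ] H)) := by
      have h : (v : H) ∈ ((LinearMap.range (S : H →L[ℂ] H).toLinearMap).topologicalClosure : Set H) :=
        v.2
      rw [Submodule.topologicalClosure_coe] at h
      exact h
    rw [Metric.mem_closure_iff] at hv ⊢
    intro ε hε
    obtain ⟨_, ⟨ξ, rfl⟩, hξ⟩ := hv ε hε
    exact ⟨e ξ, ⟨ξ, rfl⟩, hξ⟩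
  have hb : ∃ C, ∀ ξ, ‖(x : H →L[ℂ] H).toLinearMap ξ‖ ≤ C * ‖e ξ‖ :=
    ⟨1, fun ξ => by rw [one_mul]; exact hnorm ξ⟩
  -- The contraction Sξ ↦ xξ extended to the closure of the range of S, and zero on the orthogonal
  -- complement, which is the kernel of S.
  set u : H →L[ℂ] H := ((x : H →L[ℂ] H).toLinearMap.extendOfNorm e).comp
    V.orthogonalProjectionOnto with hu
  have huS : ∀ ξ, u ((S : H →L[ℂ] H) ξ) = (x : H →L[ℂ] H) ξ := by
    intro ξ
    have h1 : V.orthogonalProjectionOnto ((S : H →L[ℂ] H) ξ) = e ξ :=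
      Submodule.orthogonalProjectionOnto_mem_subspace_eq_self (e ξ)
    rw [hu, ContinuousLinearMap.comp_apply, h1, LinearMap.extendOfNorm_eq hdense hb]
    rfl
  have hperp : ∀ ξ, (S : H →L[ℂ] H) ξ = 0 → ξ ∈ Vᗮ := by
    intro ξ hξ
    rw [hV, Submodule.orthogonal_closure, Submodule.mem_orthogonal]
    rintro _ ⟨ζ, rfl⟩
    change ⟪(S : H →L[ℂ] H) ζ, ξ⟫_ℂ = 0
    rw [← hSsa, ContinuousLinearMap.inner_star_left, hξ, inner_zero_right]
  have hperp' : ∀ ξ ∈ Vᗮ, (S : H →L[ℂ] H) ξ = 0 := by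
    intro ξ hξ
    rw [← inner_self_eq_zero (𝕜 := ℂ), ← ContinuousLinearMap.inner_star_right, hSsa]
    exact Submodule.inner_left_of_mem_orthogonal (hmemV _) hξ
  have huk : ∀ ξ, (S : H →L[ℂ] H) ξ = 0 → u ξ = 0 := by
    intro ξ hξ
    rw [hu, ContinuousLinearMap.comp_apply,
      Submodule.orthogonalProjectionOnto_apply_of_mem_orthogonal (hperp ξ hξ),
      map_zero]
  -- An element g of the commutant commutes with S and x, hence with u on the closed range of S by
  -- density. It also preserves the kernel of S, where u vanishes.
  have humem : u ∈ M := by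
    rw [VonNeumannAlgebra.mem_iff_commute]
    intro g hg
    have hgS : ∀ ξ, g ((S : H →L[ℂ] H) ξ) = (S : H →L[ℂ] H) (g ξ) := fun ξ => by
      have := VonNeumannAlgebra.mem_commutant_iff.1 hg S S.2
      exact congrArg (fun T : H →L[ℂ] H => T ξ) this.symm
    have hgx : ∀ ξ, g ((x : H →L[ℂ] H) ξ) = (x : H →L[ℂ] H) (g ξ) := fun ξ => by
      have := VonNeumannAlgebra.mem_commutant_iff.1 hg x x.2
      exact congrArg (fun T : H →L[ℂ] H => T ξ) this.symm
    have h1 : Set.EqOn (fun ξ => g (u ξ)) (fun ξ => u (g ξ))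
        (closure (Set.range (S : H →L[ℂ] H))) := by
      refine Set.EqOn.closure ?_ (by fun_prop) (by fun_prop)
      rintro _ ⟨ξ, rfl⟩
      simp only
      rw [huS, hgS, huS, hgx]
    have h2 : ∀ ξ ∈ V, g (u ξ) = u (g ξ) := by
      intro ξ hξ
      refine h1 ?_
      rw [hV, ← SetLike.mem_coe, Submodule.topologicalClosure_coe] at hξ
      exact hξ
    ext ξ
    change g (u ξ) = u (g ξ)
    have h3 := V.sub_starProjection_mem_orthogonal ξ
    have h4 := h2 _ (V.starProjection_apply_mem ξ)
    have h5 : ξ = V.starProjection ξ + (ξ - V.starProjection ξ) := by abel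
    have h6 := hperp' _ h3
    have h7 : u (g (ξ - V.starProjection ξ)) = 0 := huk _ (by rw [← hgS, h6, map_zero])
    rw [h5, map_add u, map_add g, map_add g, map_add u, h4, h7, huk _ h6, map_zero]
  refine ⟨⟨u, humem⟩, Subtype.ext (ContinuousLinearMap.ext huS), fun y hy => Subtype.ext ?_⟩
  ext ξ
  exact huk _ (congrArg (fun T : M => (T : H →L[ℂ] H) ξ) hy)

namespace TracialStandardForm

variable (T : TracialStandardForm H)

/-- The trace, as a real functional on the algebra. -/
noncomputable def tr : T.M →ₗ[ℝ] ℝ where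
  toFun x := RCLike.re ⟪T.Ω, (x : H →L[ℂ] H) T.Ω⟫_ℂ
  map_add' x y := by simp
  map_smul' r x := by
    change RCLike.re ⟪T.Ω, ((r : ℂ) • (x : H →L[ℂ] H)) T.Ω⟫_ℂ = _
    rw [smul_apply, inner_smul_right]
    simp

theorem tr_apply (x : T.M) : T.tr x = RCLike.re ⟪T.Ω, (x : H →L[ℂ] H) T.Ω⟫_ℂ := rfl

theorem isTracialState_tr : IsTracialState T.tr where
  mul_comm x y := congrArg RCLike.re (T.tracial x x.2 y y.2)
  star x := by
    rw [tr_apply, tr_apply]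
    change RCLike.re ⟪T.Ω, (star (x : H →L[ℂ] H)) T.Ω⟫_ℂ = _
    rw [ContinuousLinearMap.inner_star_right, ← inner_conj_symm, RCLike.conj_re]
  nonneg x hx := by
    have := ContinuousLinearMap.re_inner_mono (show (0 : H →L[ℂ] H) ≤ x from hx) T.Ω
    rw [zero_apply, inner_zero_right, map_zero] at this
    exact this
  one := by
    rw [tr_apply]
    change RCLike.re ⟪T.Ω, T.Ω⟫_ℂ = 1
    rw [inner_self_eq_norm_sq, T.norm_Ω, one_pow]

variable {T}

theorem clm_ext {R R' : H →L[ℂ] H} (h : ∀ m ∈ T.M, R (m T.Ω) = R' (m T.Ω)) : R = R' := by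
  refine ContinuousLinearMap.coeFn_injective (Continuous.ext_on T.cyclic R.continuous R'.continuous ?_)
  rintro _ ⟨m, hm, rfl⟩
  exact h m hm

theorem op_apply_Ω {a : H →L[ℂ] H} (ha : a ∈ T.M) : T.op a T.Ω = a T.Ω := by
  simpa using T.op_apply ha (one_mem T.M)

theorem op_mem {a : H →L[ℂ] H} (ha : a ∈ T.M) : T.op a ∈ T.M.commutant := by
  rw [VonNeumannAlgebra.mem_commutant_iff]
  intro g hg
  refine clm_ext (T := T) fun m hm => ?_
  change g (T.op a (m T.Ω)) = T.op a ((g * m) T.Ω)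
  rw [T.op_apply ha hm, T.op_apply ha (mul_mem hg hm), mul_assoc]
  rfl

theorem op_one : T.op 1 = 1 :=
  clm_ext (T := T) fun m hm => by rw [T.op_apply (one_mem _) hm, mul_one]; rfl

theorem op_add {a b : H →L[ℂ] H} (ha : a ∈ T.M) (hb : b ∈ T.M) :
    T.op (a + b) = T.op a + T.op b :=
  clm_ext (T := T) fun m hm => by
    rw [T.op_apply (add_mem ha hb) hm, add_apply, T.op_apply ha hm,
      T.op_apply hb hm, mul_add]
    rfl

theorem op_zero : T.op 0 = 0 :=
  clm_ext (T := T) fun m hm => by rw [T.op_apply (zero_mem _) hm, mul_zero]; rfl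

theorem op_sum {ι : Type*} (s : Finset ι) {a : ι → H →L[ℂ] H} (ha : ∀ i, a i ∈ T.M) :
    T.op (∑ i ∈ s, a i) = ∑ i ∈ s, T.op (a i) := by
  classical
  induction s using Finset.induction_on with
  | empty => simpa using op_zero
  | insert i s hi ih =>
    rw [Finset.sum_insert hi, Finset.sum_insert hi, op_add (ha i) (sum_mem fun i _ => ha i), ih]

theorem op_mul {a b : H →L[ℂ] H} (ha : a ∈ T.M) (hb : b ∈ T.M) :
    T.op (a * b) = T.op b * T.op a :=
  clm_ext (T := T) fun m hm => by
    change _ = T.op b (T.op a (m T.Ω))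
    rw [T.op_apply (mul_mem ha hb) hm, T.op_apply ha hm, T.op_apply hb (mul_mem hm ha), mul_assoc]

/-- Right multiplication respects adjoints only because the vector state is tracial: the trace
property moves a across the inner product. -/
theorem op_star {a : H →L[ℂ] H} (ha : a ∈ T.M) : T.op (star a) = star (T.op a) := by
  refine clm_ext (T := T) fun m hm => ?_
  refine T.cyclic.eq_of_inner_left (𝕜 := ℂ) ?_
  rintro _ ⟨n, hn, rfl⟩
  rw [T.op_apply (star_mem ha) hm, ContinuousLinearMap.inner_star_left, T.op_apply ha hn]
  have h := T.tracial a ha (star m * n) (mul_mem (star_mem hm) hn)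
  calc ⟪(m * star a) T.Ω, n T.Ω⟫_ℂ = ⟪T.Ω, (a * (star m * n)) T.Ω⟫_ℂ := by
        have := ContinuousLinearMap.inner_star_left (a * star m) T.Ω (n T.Ω)
        rw [star_mul, star_star] at this
        rw [this]; rfl
    _ = ⟪T.Ω, (star m * n * a) T.Ω⟫_ℂ := h
    _ = ⟪m T.Ω, (n * a) T.Ω⟫_ℂ := by
        rw [mul_assoc, mul_apply_eq_comp, ContinuousLinearMap.inner_star_right]

theorem op_nonneg {a : H →L[ℂ] H} (ha : a ∈ T.M) (h0 : 0 ≤ a) : 0 ≤ T.op a := by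
  set c := CFC.sqrt a
  have hc : c ∈ T.M := VonNeumannAlgebra.sqrt_mem ha
  have hcs : star c = c := (CFC.sqrt_nonneg a).isSelfAdjoint.star_eq
  have : T.op a = star (T.op c) * T.op c := by
    rw [← op_star hc, hcs, ← op_mul hc hc, CFC.sqrt_mul_sqrt_self a h0]
  rw [this]
  exact star_mul_self_nonneg _

/-! ### The commutant in standard form -/

theorem separating_commutant {y : H →L[ℂ] H} (hy : y ∈ T.M.commutant) (h0 : y T.Ω = 0) :
    y = 0 :=
  clm_ext (T := T) fun m hm => by
    have := VonNeumannAlgebra.mem_commutant_iff.1 hy m hm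
    change (y * m) T.Ω = 0
    rw [← this]
    change m (y T.Ω) = 0
    rw [h0, map_zero]

/-- The closure of M'Ω is invariant under M', so its projection lies in M'' = M. That projection
fixes Ω, and Ω separates M, so it is 1. -/
theorem cyclic_commutant : Dense {v : H | ∃ m ∈ T.M.commutant, m T.Ω = v} := by
  set W : Submodule ℂ H :=
    { carrier := {v : H | ∃ m ∈ T.M.commutant, m T.Ω = v}
      add_mem' := by
        rintro _ _ ⟨m, hm, rfl⟩ ⟨n, hn, rfl⟩
        exact ⟨m + n, add_mem hm hn, rfl⟩
      zero_mem' := ⟨0, zero_mem _, rfl⟩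
      smul_mem' := by
        rintro c _ ⟨m, hm, rfl⟩
        exact ⟨c • m, SMulMemClass.smul_mem c hm, rfl⟩ } with hW
  set V := W.topologicalClosure with hV
  have : CompleteSpace V := (Submodule.isClosed_topologicalClosure _).completeSpace_coe
  have hinv : ∀ y ∈ T.M.commutant, ∀ v ∈ V, y v ∈ V := by
    intro y hy v hv
    rw [hV, ← SetLike.mem_coe, Submodule.topologicalClosure_coe] at hv ⊢
    refine map_mem_closure y.continuous hv ?_
    rintro _ ⟨m, hm, rfl⟩
    exact ⟨y * m, mul_mem hy hm, rfl⟩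
  have hp : V.starProjection ∈ T.M := by
    rw [VonNeumannAlgebra.IsStarProjection.mem_iff (isStarProjection_starProjection)]
    intro y hy
    rw [Module.End.mem_invtSubmodule]
    intro v hv
    rw [Submodule.mem_comap]
    have hv' : v ∈ V := by simpa using hv
    simpa using hinv y hy v hv'
  have hΩ : T.Ω ∈ V := Submodule.le_topologicalClosure _ ⟨1, one_mem _, rfl⟩
  have h1 : 1 - V.starProjection = 0 := by
    apply T.separating _ (sub_mem (one_mem _) hp)
    rw [sub_apply, Submodule.starProjection_eq_self_iff.2 hΩ]
    simp
  intro v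
  have hv : v ∈ V := by
    rw [← Submodule.starProjection_eq_self_iff, ← sub_eq_zero.1 h1]
    rfl
  rw [hV, ← SetLike.mem_coe, Submodule.topologicalClosure_coe] at hv
  exact hv

theorem inner_star_commutant {m z : H →L[ℂ] H} (hm : m ∈ T.M) (hz : z ∈ T.M.commutant) :
    ⟪(star m) T.Ω, (star z) T.Ω⟫_ℂ = ⟪z T.Ω, m T.Ω⟫_ℂ := by
  rw [ContinuousLinearMap.inner_star_left, ← ContinuousLinearMap.inner_star_right z]
  have := VonNeumannAlgebra.mem_commutant_iff.1 (star_mem hz) m hm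
  exact congrArg (fun R : H →L[ℂ] H => ⟪T.Ω, R T.Ω⟫_ℂ) this

/-- Lets an approximation of zΩ by vectors mΩ pass to the adjoints. Applied to a sequence, it first
shows that z and z* have equal norms on Ω, then that m_n*Ω tends to z*Ω. That is what the trace
property on the commutant needs. -/
theorem norm_star_sub_sq {m z : H →L[ℂ] H} (hm : m ∈ T.M) (hz : z ∈ T.M.commutant) :
    ‖(star m) T.Ω - (star z) T.Ω‖ ^ 2
      = ‖m T.Ω - z T.Ω‖ ^ 2 + ‖(star z) T.Ω‖ ^ 2 - ‖z T.Ω‖ ^ 2 := by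
  rw [norm_sub_sq (𝕜 := ℂ), norm_sub_sq (𝕜 := ℂ), inner_star_commutant hm hz,
    T.norm_star_apply hm, ← inner_conj_symm (m T.Ω), RCLike.conj_re]
  ring

theorem exists_seq_tendsto (ξ : H) :
    ∃ m : ℕ → H →L[ℂ] H, (∀ n, m n ∈ T.M) ∧
      Filter.Tendsto (fun n => m n T.Ω) Filter.atTop (nhds ξ) := by
  obtain ⟨x, hx, hlim⟩ := mem_closure_iff_seq_limit.1 (T.cyclic ξ)
  choose m hm hmx using hx
  exact ⟨m, hm, by simpa only [hmx] using hlim⟩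

theorem norm_le_norm_star_commutant {z : H →L[ℂ] H} (hz : z ∈ T.M.commutant) :
    ‖z T.Ω‖ ^ 2 ≤ ‖(star z) T.Ω‖ ^ 2 := by
  obtain ⟨m, hm, hlim⟩ := exists_seq_tendsto (T := T) (z T.Ω)
  have h1 : Filter.Tendsto (fun n => ‖m n T.Ω - z T.Ω‖ ^ 2 + ‖(star z) T.Ω‖ ^ 2 - ‖z T.Ω‖ ^ 2)
      Filter.atTop (nhds (‖z T.Ω - z T.Ω‖ ^ 2 + ‖(star z) T.Ω‖ ^ 2 - ‖z T.Ω‖ ^ 2)) :=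
    ((((hlim.sub_const _).norm).pow 2).add_const _).sub_const _
  have h2 := ge_of_tendsto' h1 (b := 0) fun n => by
    rw [← norm_star_sub_sq (hm n) hz]; positivity
  simp at h2
  linarith

theorem norm_star_commutant {z : H →L[ℂ] H} (hz : z ∈ T.M.commutant) :
    ‖(star z) T.Ω‖ ^ 2 = ‖z T.Ω‖ ^ 2 :=
  le_antisymm (by simpa using norm_le_norm_star_commutant (star_mem hz))
    (norm_le_norm_star_commutant hz)

theorem tracial_commutant {y z : H →L[ℂ] H} (hy : y ∈ T.M.commutant) (hz : z ∈ T.M.commutant) :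
    ⟪T.Ω, (y * z) T.Ω⟫_ℂ = ⟪T.Ω, (z * y) T.Ω⟫_ℂ := by
  obtain ⟨m, hm, hlim⟩ := exists_seq_tendsto (T := T) (z T.Ω)
  have hlim' : Filter.Tendsto (fun n => (star (m n)) T.Ω) Filter.atTop (nhds ((star z) T.Ω)) := by
    rw [tendsto_iff_norm_sub_tendsto_zero] at hlim ⊢
    refine hlim.congr fun n => ?_
    have := norm_star_sub_sq (hm n) hz
    rw [norm_star_commutant hz, add_sub_cancel_right] at this
    exact ((sq_eq_sq₀ (norm_nonneg _) (norm_nonneg _)).1 this).symm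
  have h1 : Filter.Tendsto (fun n => ⟪(star y) T.Ω, m n T.Ω⟫_ℂ) Filter.atTop
      (nhds ⟪(star y) T.Ω, z T.Ω⟫_ℂ) := tendsto_const_nhds.inner hlim
  have h2 : Filter.Tendsto (fun n => ⟪(star (m n)) T.Ω, y T.Ω⟫_ℂ) Filter.atTop
      (nhds ⟪(star z) T.Ω, y T.Ω⟫_ℂ) := hlim'.inner tendsto_const_nhds
  have h3 : ∀ n, ⟪(star y) T.Ω, m n T.Ω⟫_ℂ = ⟪(star (m n)) T.Ω, y T.Ω⟫_ℂ := fun n => by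
    rw [ContinuousLinearMap.inner_star_left, ContinuousLinearMap.inner_star_left]
    have := VonNeumannAlgebra.mem_commutant_iff.1 hy (m n) (hm n)
    exact congrArg (fun R : H →L[ℂ] H => ⟪T.Ω, R T.Ω⟫_ℂ) this.symm
  simp only [h3] at h1
  have := tendsto_nhds_unique h1 h2
  rwa [ContinuousLinearMap.inner_star_left, ContinuousLinearMap.inner_star_left] at this

variable (T) in
/-- The commutant of a tracial von Neumann algebra in standard form is again in standard form. -/
noncomputable def commutantForm : TracialStandardForm H where
  M := T.M.commutant
  Ω := T.Ω
  norm_Ω := T.norm_Ω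
  tracial _ ha _ hb := tracial_commutant ha hb
  separating _ ha h := separating_commutant ha h
  cyclic := cyclic_commutant

/-- Every positive element of the commutant is `b^op` for a positive `b ∈ M`. -/
theorem exists_op_eq {y : H →L[ℂ] H} (hy : y ∈ T.M.commutant) :
    ∃ b ∈ T.M, T.op b = y ∧ (0 ≤ y → 0 ≤ b) := by
  have hb : T.commutantForm.op y ∈ T.M := by
    have := op_mem (T := T.commutantForm) hy
    change _ ∈ T.M.commutant.commutant at this
    rwa [VonNeumannAlgebra.commutant_commutant] at this
  refine ⟨T.commutantForm.op y, hb, clm_ext (T := T) fun m hm => ?_,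
    fun h0 => op_nonneg (T := T.commutantForm) hy h0⟩
  have h1 : T.commutantForm.op y T.Ω = y T.Ω := op_apply_Ω (T := T.commutantForm) hy
  rw [T.op_apply hb hm]
  change m (T.commutantForm.op y T.Ω) = _
  rw [h1]
  have := VonNeumannAlgebra.mem_commutant_iff.1 hy m hm
  exact congrArg (fun R : H →L[ℂ] H => R T.Ω) this

end TracialStandardForm

end VonNeumann

/-! ### The standard form of a corner p M p -/

theorem ContinuousLinearMap.star_commute {K : Type*} [NormedAddCommGroup K]
    [InnerProductSpace ℂ K] [CompleteSpace K] {x y : K →L[ℂ] K} (h : x * y = y * x) :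
    star x * star y = star y * star x := by
  rw [← star_mul, ← star_mul, h]

theorem ContinuousLinearMap.eq_star {K : Type*} [NormedAddCommGroup K]
    [InnerProductSpace ℂ K] [CompleteSpace K] {x y : K →L[ℂ] K}
    (h : ∀ ξ ζ, ⟪ξ, x ζ⟫_ℂ = ⟪y ξ, ζ⟫_ℂ) : x = star y :=
  ContinuousLinearMap.ext fun ζ => ext_inner_left ℂ fun ξ => by
    rw [ContinuousLinearMap.inner_star_right, h]

/-- An element y of the commutant need not map the corner space to itself. The root Z of the
compression of y* y replaces it there: it has the same norms as y and still commutes with x. -/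
theorem ContinuousLinearMap.exists_commute_norm {K : Type*} [NormedAddCommGroup K]
    [InnerProductSpace ℂ K] [CompleteSpace K] {Y x : K →L[ℂ] K} (hY : 0 ≤ Y) (h : Commute Y x) :
    ∃ Z : K →L[ℂ] K, Z * x = x * Z ∧ ∀ ξ, RCLike.re ⟪ξ, Y ξ⟫_ℂ = ‖Z ξ‖ ^ 2 := by
  refine ⟨CFC.sqrt Y, ?_, fun ξ => ?_⟩
  · rw [CFC.sqrt_eq_cfc]
    exact (h.cfc_nnreal _).eq
  · rw [← ContinuousLinearMap.re_inner_star_mul_self,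
      (CFC.sqrt_nonneg Y).isSelfAdjoint.star_eq, CFC.sqrt_mul_sqrt_self Y hY]

theorem ContinuousLinearMap.nonneg_of_inner_eq {K : Type*} [NormedAddCommGroup K]
    [InnerProductSpace ℂ K] [CompleteSpace K] {Y : K →L[ℂ] K} (q : K → ℝ) (hq : ∀ ζ, 0 ≤ q ζ)
    (h : ∀ ζ, ⟪ζ, Y ζ⟫_ℂ = (q ζ : ℂ)) : 0 ≤ Y := by
  rw [ContinuousLinearMap.nonneg_iff_isPositive, ContinuousLinearMap.isPositive_iff_complex]
  intro ζ
  have : ⟪Y ζ, ζ⟫_ℂ = (q ζ : ℂ) := by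
    rw [← inner_conj_symm, h, Complex.conj_ofReal]
  rw [this]
  exact ⟨by simp, by simpa using hq ζ⟩

namespace TracialStandardForm

variable {H : Type*} [NormedAddCommGroup H] [InnerProductSpace ℂ H] [CompleteSpace H]
variable (T : TracialStandardForm H)

theorem op_commute {a m : H →L[ℂ] H} (ha : a ∈ T.M) (hm : m ∈ T.M) (ξ : H) :
    m (T.op a ξ) = T.op a (m ξ) :=
  congrArg (fun R : H →L[ℂ] H => R ξ) (VonNeumannAlgebra.mem_commutant_iff.1 (op_mem ha) m hm)

theorem commutant_comm {y m : H →L[ℂ] H} (hy : y ∈ T.M.commutant) (hm : m ∈ T.M) (ξ : H) :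
    m (y ξ) = y (m ξ) :=
  congrArg (fun R : H →L[ℂ] H => R ξ) (VonNeumannAlgebra.mem_commutant_iff.1 hy m hm)

/-- The Hilbert space `p p^op L²(M, τ)` of the corner `p M p`. -/
noncomputable def cornerSpace (p : H →L[ℂ] H) : Submodule ℂ H where
  carrier := {ζ | p ζ = ζ ∧ T.op p ζ = ζ}
  add_mem' := by
    rintro a b ⟨h1, h2⟩ ⟨h3, h4⟩
    exact ⟨by rw [map_add, h1, h3], by rw [map_add, h2, h4]⟩
  zero_mem' := ⟨map_zero _, map_zero _⟩
  smul_mem' := by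
    rintro c x ⟨h1, h2⟩
    exact ⟨by rw [map_smul, h1], by rw [map_smul, h2]⟩

instance completeSpace_cornerSpace (p : H →L[ℂ] H) : CompleteSpace (T.cornerSpace p) := by
  have : IsClosed (T.cornerSpace p : Set H) :=
    (isClosed_eq p.continuous continuous_id).inter (isClosed_eq (T.op p).continuous continuous_id)
  exact this.completeSpace_coe

/-- The compressions to the corner space of the operators in the commutant. -/
def cornerCommutant (p : H →L[ℂ] H) : Set (T.cornerSpace p →L[ℂ] T.cornerSpace p) :=
  {x | ∃ y ∈ T.M.commutant, ∀ ζ, (x ζ : H) = T.op p (y ζ)}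

/-- The corner `p M p`, acting on the corner space. -/
noncomputable def cornerAlgebra (p : H →L[ℂ] H) : VonNeumannAlgebra (T.cornerSpace p) where
  -- Defined as a centralizer, the algebra satisfies the bicommutant condition automatically. The
  -- identification with p M p is left to `exists_lift` and `restrict_mem_cornerAlgebra`.
  toStarSubalgebra := StarSubalgebra.centralizer ℂ (T.cornerCommutant p)
  centralizer_centralizer' := Set.centralizer_centralizer_centralizer _

variable {T} {p : H →L[ℂ] H}

theorem mem_cornerAlgebra {x : T.cornerSpace p →L[ℂ] T.cornerSpace p} :
    x ∈ T.cornerAlgebra p ↔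
      ∀ y ∈ T.cornerCommutant p, y * x = x * y ∧ star y * x = x * star y :=
  StarSubalgebra.mem_centralizer_iff ℂ

/-- Restriction of an operator to the corner space. -/
noncomputable def cornerRestrict (R : H →L[ℂ] H) (hR : ∀ ζ ∈ T.cornerSpace p, R ζ ∈ T.cornerSpace p) :
    T.cornerSpace p →L[ℂ] T.cornerSpace p :=
  (R.comp (T.cornerSpace p).subtypeL).codRestrict _ fun ζ => hR ζ ζ.2

theorem op_idem (hpM : p ∈ T.M) (hp : IsStarProjection p) (ξ : H) :
    T.op p (T.op p ξ) = T.op p ξ := by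
  have := op_mul (T := T) hpM hpM
  rw [hp.isIdempotentElem.eq] at this
  exact (congrArg (fun R : H →L[ℂ] H => R ξ) this).symm

theorem proj_idem (hp : IsStarProjection p) (ξ : H) : p (p ξ) = p ξ :=
  congrArg (fun R : H →L[ℂ] H => R ξ) hp.isIdempotentElem.eq

theorem op_proj_mem (hpM : p ∈ T.M) (hp : IsStarProjection p) (ξ : H) :
    T.op p (p ξ) ∈ T.cornerSpace p :=
  ⟨by rw [T.op_commute hpM hpM, proj_idem hp], op_idem hpM hp _⟩

theorem proj_Ω_mem (hpM : p ∈ T.M) (hp : IsStarProjection p) : p T.Ω ∈ T.cornerSpace p := by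
  refine ⟨proj_idem hp _, ?_⟩
  rw [T.op_apply hpM hpM, hp.isIdempotentElem.eq]

theorem corner_mem_of_mem {m : H →L[ℂ] H} (hpM : p ∈ T.M) (hm : m ∈ T.M)
    (hpm : p * m = m) : ∀ ζ ∈ T.cornerSpace p, m ζ ∈ T.cornerSpace p := by
  intro ζ hζ
  refine ⟨congrArg (fun R : H →L[ℂ] H => R ζ) hpm, ?_⟩
  rw [← T.op_commute hpM hm, hζ.2]

theorem corner_mem_of_commutant {y : H →L[ℂ] H} (hpM : p ∈ T.M) (hp : IsStarProjection p)
    (hy : y ∈ T.M.commutant) :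
    ∀ ζ ∈ T.cornerSpace p, (T.op p * y) ζ ∈ T.cornerSpace p := by
  intro ζ hζ
  have h := op_proj_mem hpM hp (y ζ)
  rw [T.commutant_comm hy hpM, hζ.1] at h
  exact h

theorem restrict_mem_cornerCommutant {y : H →L[ℂ] H} (hpM : p ∈ T.M) (hp : IsStarProjection p)
    (hy : y ∈ T.M.commutant) :
    cornerRestrict (T.op p * y) (corner_mem_of_commutant hpM hp hy) ∈ T.cornerCommutant p :=
  ⟨y, hy, fun _ => rfl⟩

theorem inner_proj_op (hpM : p ∈ T.M) (hp : IsStarProjection p) {ζ : H}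
    (hζ : ζ ∈ T.cornerSpace p) (ξ : H) : ⟪ζ, T.op p ξ⟫_ℂ = ⟪ζ, ξ⟫_ℂ := by
  have h : star (T.op p) = T.op p := by rw [← op_star hpM, hp.isSelfAdjoint.star_eq]
  rw [← h, ContinuousLinearMap.inner_star_right, hζ.2]

theorem inner_proj (hp : IsStarProjection p) {ζ : H}
    (hζ : ζ ∈ T.cornerSpace p) (ξ : H) : ⟪ζ, p ξ⟫_ℂ = ⟪ζ, ξ⟫_ℂ := by
  have h : star p = p := hp.isSelfAdjoint.star_eq
  rw [← h, ContinuousLinearMap.inner_star_right, hζ.1]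

theorem restrict_mul {y m : H →L[ℂ] H} (hpM : p ∈ T.M)
    (hm : m ∈ T.M) (hpm : p * m = m) {x : T.cornerSpace p →L[ℂ] T.cornerSpace p}
    (hy : y ∈ T.M.commutant) (hx : ∀ ζ, (x ζ : H) = T.op p (y ζ)) :
    x * cornerRestrict m (corner_mem_of_mem hpM hm hpm)
      = cornerRestrict m (corner_mem_of_mem hpM hm hpm) * x := by
  ext ζ
  change ((x (cornerRestrict m _ ζ) : T.cornerSpace p) : H) = m (x ζ)
  rw [hx, hx, T.op_commute hpM hm, T.commutant_comm hy hm]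
  rfl

theorem restrict_mem_cornerAlgebra {m : H →L[ℂ] H} (hpM : p ∈ T.M) (hp : IsStarProjection p)
    (hm : m ∈ T.M) (hpm : p * m = m) (hmp : m * p = m) :
    cornerRestrict m (corner_mem_of_mem hpM hm hpm) ∈ T.cornerAlgebra p := by
  rw [mem_cornerAlgebra]
  rintro x ⟨y, hy, hx⟩
  refine ⟨restrict_mul hpM hm hpm hy hx, ?_⟩
  have hpm' : p * star m = star m := by
    have := congrArg star hmp
    rwa [star_mul, hp.isSelfAdjoint.star_eq] at this
  have h := ContinuousLinearMap.star_commute (restrict_mul hpM (star_mem hm) hpm' hy hx)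
  have hs : cornerRestrict m (corner_mem_of_mem hpM hm hpm)
      = star (cornerRestrict (star m) (corner_mem_of_mem hpM (star_mem hm) hpm')) :=
    ContinuousLinearMap.eq_star fun ξ ζ =>
      (ContinuousLinearMap.inner_star_left m (ξ : H) (ζ : H)).symm
  rw [← hs] at h
  exact h

/-- This bound makes yΩ ↦ y x(pΩ), for y in the commutant, a well-defined bounded map; that map is
the lift of x to M. -/
theorem norm_apply_le_of_mem_cornerAlgebra (hpM : p ∈ T.M) (hp : IsStarProjection p)
    {x : T.cornerSpace p →L[ℂ] T.cornerSpace p} (hx : x ∈ T.cornerAlgebra p)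
    {y : H →L[ℂ] H} (hy : y ∈ T.M.commutant) :
    ‖y (x ⟨p T.Ω, proj_Ω_mem hpM hp⟩ : H)‖ ≤ ‖x‖ * ‖y T.Ω‖ := by
  set Y := cornerRestrict (T.op p * (star y * y))
    (corner_mem_of_commutant hpM hp (mul_mem (star_mem hy) hy)) with hY
  have hYin : ∀ ξ ζ : T.cornerSpace p, ⟪ξ, Y ζ⟫_ℂ = ⟪y (ξ : H), y (ζ : H)⟫_ℂ := fun ξ ζ => by
    change ⟪(ξ : H), T.op p ((star y) (y (ζ : H)))⟫_ℂ = _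
    rw [inner_proj_op hpM hp ξ.2, ContinuousLinearMap.inner_star_right]
  have hY0 : 0 ≤ Y := ContinuousLinearMap.nonneg_of_inner_eq (fun ζ => ‖y (ζ : H)‖ ^ 2)
    (fun ζ => sq_nonneg _) fun ζ => by
      rw [hYin, inner_self_eq_norm_sq_to_K]
      simp
  obtain ⟨Z, hZc, hZY⟩ := ContinuousLinearMap.exists_commute_norm hY0
    (mem_cornerAlgebra.1 hx Y (restrict_mem_cornerCommutant hpM hp (mul_mem (star_mem hy) hy))).1
  have hZn : ∀ ξ : T.cornerSpace p, ‖Z ξ‖ = ‖y (ξ : H)‖ := fun ξ => by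
    have h1 := hZY ξ
    rw [hYin, inner_self_eq_norm_sq] at h1
    exact ((sq_eq_sq₀ (norm_nonneg _) (norm_nonneg _)).1 h1).symm
  set ω : T.cornerSpace p := ⟨p T.Ω, proj_Ω_mem hpM hp⟩ with hω
  calc ‖y (x ω : H)‖ = ‖Z (x ω)‖ := (hZn _).symm
    _ = ‖x (Z ω)‖ := by
        rw [show Z (x ω) = x (Z ω) from congrArg (fun R : T.cornerSpace p →L[ℂ] _ => R ω) hZc]
    _ ≤ ‖x‖ * ‖Z ω‖ := x.le_opNorm _
    _ = ‖x‖ * ‖y (p T.Ω)‖ := by rw [hZn]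
    _ ≤ ‖x‖ * ‖y T.Ω‖ := by
        rw [← T.commutant_comm hy hpM]
        gcongr
        calc ‖p (y T.Ω)‖ ≤ ‖p‖ * ‖y T.Ω‖ := p.le_opNorm _
          _ ≤ 1 * ‖y T.Ω‖ := by gcongr; exact hp.norm_le
          _ = _ := one_mul _

/-- Every element of the corner algebra is the restriction of an element of `p M p`. -/
theorem exists_lift (hpM : p ∈ T.M) (hp : IsStarProjection p)
    {x : T.cornerSpace p →L[ℂ] T.cornerSpace p} (hx : x ∈ T.cornerAlgebra p) :
    ∃ m ∈ T.M, p * m = m ∧ m * p = m ∧ ∀ ζ : T.cornerSpace p, m ζ = x ζ := by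
  set ω : T.cornerSpace p := ⟨p T.Ω, proj_Ω_mem hpM hp⟩ with hω
  set P : Submodule ℂ (H →L[ℂ] H) :=
    Subalgebra.toSubmodule T.M.commutant.toStarSubalgebra.toSubalgebra with hP'
  let e : P →ₗ[ℂ] H :=
    (LinearMap.applyₗ T.Ω).comp ((ContinuousLinearMap.coeLM ℂ).comp P.subtype)
  let f : P →ₗ[ℂ] H :=
    (LinearMap.applyₗ (x ω : H)).comp ((ContinuousLinearMap.coeLM ℂ).comp P.subtype)
  have hP : ∀ m : P, (m : H →L[ℂ] H) ∈ T.M.commutant := fun m => m.2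
  have he : DenseRange e := by
    have : Set.range e = {v : H | ∃ m ∈ T.M.commutant, m T.Ω = v} := by
      ext v
      constructor
      · rintro ⟨m, rfl⟩
        exact ⟨m, hP m, rfl⟩
      · rintro ⟨m, hm, rfl⟩
        exact ⟨⟨m, hm⟩, rfl⟩
    rw [DenseRange, this]
    exact cyclic_commutant
  have hb : ∃ C, ∀ m, ‖f m‖ ≤ C * ‖e m‖ :=
    ⟨‖x‖, fun m => norm_apply_le_of_mem_cornerAlgebra hpM hp hx (hP m)⟩
  set m : H →L[ℂ] H := f.extendOfNorm e with hm
  have hmy : ∀ y ∈ T.M.commutant, m (y T.Ω) = y (x ω : H) := fun y hy =>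
    LinearMap.extendOfNorm_eq he hb ⟨y, hy⟩
  have hmΩ : m T.Ω = x ω := hmy 1 (one_mem _)
  have hext : ∀ {R R' : H →L[ℂ] H}, (∀ y ∈ T.M.commutant, R (y T.Ω) = R' (y T.Ω)) → R = R' :=
    fun h => clm_ext (T := T.commutantForm) h
  have hmM : m ∈ T.M := by
    rw [VonNeumannAlgebra.mem_iff_commute]
    intro z hz
    refine hext fun y hy => ?_
    change z (m (y T.Ω)) = m ((z * y) T.Ω)
    rw [hmy y hy, hmy _ (mul_mem hz hy)]
    rfl
  have hmp : m * p = m := by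
    rw [← sub_eq_zero]
    refine T.separating _ (sub_mem (mul_mem hmM hpM) hmM) ?_
    rw [sub_apply, sub_eq_zero, mul_apply_eq_comp, ← op_apply_Ω hpM,
      T.op_commute hpM hmM, hmΩ]
    exact (x ω).2.2
  refine ⟨m, hmM, hext fun y hy => ?_, hmp, fun ζ => ?_⟩
  · change p (m (y T.Ω)) = _
    rw [hmy y hy, T.commutant_comm hy hpM, (x ω).2.1]
  -- The vectors p p^op y Ω with y in the commutant are dense in the corner space. On them the lift
  -- agrees with x because x commutes with the compression of y.
  · have hc : Continuous fun ξ : H => T.op p (p ξ) := by fun_prop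
    have key : Set.EqOn (fun ξ : H => m (T.op p (p ξ)))
        (fun ξ => (x ⟨T.op p (p ξ), op_proj_mem hpM hp ξ⟩ : H))
        (closure {v : H | ∃ m ∈ T.M.commutant, m T.Ω = v}) := by
      refine Set.EqOn.closure ?_ (m.continuous.comp hc)
        (continuous_subtype_val.comp (x.continuous.comp (hc.subtype_mk _)))
      rintro _ ⟨y, hy, rfl⟩
      set Y := cornerRestrict (T.op p * y) (corner_mem_of_commutant hpM hp hy) with hY
      have hcomm : Y * x = x * Y :=
        (mem_cornerAlgebra.1 hx Y (restrict_mem_cornerCommutant hpM hp hy)).1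
      have h1 : (⟨T.op p (p (y T.Ω)), op_proj_mem hpM hp _⟩ : T.cornerSpace p) = Y ω := by
        refine Subtype.ext ?_
        change T.op p (p (y T.Ω)) = T.op p (y (p T.Ω))
        rw [T.commutant_comm hy hpM]
      have h2 : x (Y ω) = Y (x ω) :=
        congrArg (fun R : T.cornerSpace p →L[ℂ] _ => R ω) hcomm.symm
      simp only
      rw [h1, h2]
      change _ = T.op p (y (x ω))
      rw [T.op_commute hpM hmM, T.commutant_comm hy hpM, T.commutant_comm hy hmM]
      have : m (p T.Ω) = m T.Ω := congrArg (fun R : H →L[ℂ] H => R T.Ω) hmp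
      rw [this, hmΩ]
    have h3 := key (x := (ζ : H)) (cyclic_commutant _)
    simp only [ζ.2.1, ζ.2.2] at h3
    exact h3

theorem eq_of_eqOn_corner (hpM : p ∈ T.M) (hp : IsStarProjection p) {m n : H →L[ℂ] H}
    (hm : m ∈ T.M) (hn : n ∈ T.M) (hmp : m * p = m) (hnp : n * p = n)
    (h : ∀ ζ : T.cornerSpace p, m ζ = n ζ) : m = n := by
  rw [← sub_eq_zero]
  refine T.separating _ (sub_mem hm hn) ?_
  rw [← hmp, ← hnp, sub_apply, sub_eq_zero]
  exact h ⟨p T.Ω, proj_Ω_mem hpM hp⟩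

variable (T) in
/-- The standard form of the corner `p M p`, with normalized trace. -/
noncomputable def corner (hpM : p ∈ T.M) (hp : IsStarProjection p) (h0 : p ≠ 0) :
    TracialStandardForm (T.cornerSpace p) where
  M := T.cornerAlgebra p
  -- The squared norm of pΩ is τ(p), so the corner trace is τ divided by τ(p).
  Ω := ((‖p T.Ω‖⁻¹ : ℝ) : ℂ) • ⟨p T.Ω, proj_Ω_mem hpM hp⟩
  norm_Ω := by
    have hne : ‖p T.Ω‖ ≠ 0 := fun h => h0 (T.separating p hpM (norm_eq_zero.1 h))
    rw [norm_smul]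
    change _ * ‖p T.Ω‖ = 1
    simp [hne]
  tracial a ha b hb := by
    obtain ⟨m, hm, hpm, hmp, hma⟩ := exists_lift hpM hp ha
    obtain ⟨n, hn, hpn, hnp, hnb⟩ := exists_lift hpM hp hb
    set ω : T.cornerSpace p := ⟨p T.Ω, proj_Ω_mem hpM hp⟩ with hω
    have hω' : (ω : H) = p T.Ω := rfl
    have hstar : star p = p := hp.isSelfAdjoint.star_eq
    have h1 : ⟪ω, (a * b) ω⟫_ℂ = ⟪T.Ω, (m * n) T.Ω⟫_ℂ := by
      change ⟪(ω : H), (a (b ω) : H)⟫_ℂ = _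
      rw [← hma, ← hnb, hω', ← hstar, ContinuousLinearMap.inner_star_left, hstar]
      have : p * m * (n * p) = m * n := by rw [hpm, hnp]
      exact congrArg (fun R : H →L[ℂ] H => ⟪T.Ω, R T.Ω⟫_ℂ) this
    have h2 : ⟪ω, (b * a) ω⟫_ℂ = ⟪T.Ω, (n * m) T.Ω⟫_ℂ := by
      change ⟪(ω : H), (b (a ω) : H)⟫_ℂ = _
      rw [← hnb, ← hma, hω', ← hstar, ContinuousLinearMap.inner_star_left, hstar]
      have : p * n * (m * p) = n * m := by rw [hpn, hmp]
      exact congrArg (fun R : H →L[ℂ] H => ⟪T.Ω, R T.Ω⟫_ℂ) this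
    rw [map_smul, map_smul, inner_smul_left, inner_smul_left, inner_smul_right, inner_smul_right,
      h1, h2, T.tracial m hm n hn]
  separating a ha h := by
    obtain ⟨m, hm, hpm, hmp, hma⟩ := exists_lift hpM hp ha
    have hne : ((‖p T.Ω‖⁻¹ : ℝ) : ℂ) ≠ 0 := by
      have : ‖p T.Ω‖ ≠ 0 := fun h => h0 (T.separating p hpM (norm_eq_zero.1 h))
      exact_mod_cast inv_ne_zero this
    rw [map_smul] at h
    have h1 := (smul_eq_zero.1 h).resolve_left hne
    have h2 : m T.Ω = 0 := by
      have h3 : m (p T.Ω) = 0 := by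
        have := hma ⟨p T.Ω, proj_Ω_mem hpM hp⟩
        rw [h1] at this
        exact this
      rw [← hmp]
      exact h3
    have h4 := T.separating m hm h2
    ext ζ
    rw [← hma, h4]
    rfl
  cyclic := by
    intro ζ
    obtain ⟨m, hm, hlim⟩ := exists_seq_tendsto (T := T) (ζ : H)
    have hne : ((‖p T.Ω‖⁻¹ : ℝ) : ℂ) ≠ 0 := by
      have : ‖p T.Ω‖ ≠ 0 := fun h => h0 (T.separating p hpM (norm_eq_zero.1 h))
      exact_mod_cast inv_ne_zero this
    have hc : Continuous fun ξ : H => T.op p (p ξ) := by fun_prop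
    have hlim' := (hc.tendsto (ζ : H)).comp hlim
    rw [ζ.2.1, ζ.2.2] at hlim'
    refine mem_closure_of_tendsto (f := fun n => (⟨T.op p (p (m n T.Ω)), op_proj_mem hpM hp _⟩ :
      T.cornerSpace p)) (b := Filter.atTop) (tendsto_subtype_rng.2 hlim')
      (Filter.Eventually.of_forall fun n => ?_)
    have hR : p * m n * p ∈ T.M := mul_mem (mul_mem hpM (hm n)) hpM
    have hpR : p * (p * m n * p) = p * m n * p := by
      rw [mul_assoc, ← mul_assoc, hp.isIdempotentElem.eq]
    have hRp : p * m n * p * p = p * m n * p := by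
      rw [mul_assoc _ p p, hp.isIdempotentElem.eq]
    refine ⟨((‖p T.Ω‖⁻¹ : ℝ) : ℂ)⁻¹ • cornerRestrict _ (corner_mem_of_mem hpM hR hpR),
      SMulMemClass.smul_mem _ (restrict_mem_cornerAlgebra hpM hp hR hpR hRp), ?_⟩
    rw [smul_apply, map_smul, smul_smul, inv_mul_cancel₀ hne, one_smul]
    refine Subtype.ext ?_
    change p (m n (p (p T.Ω))) = T.op p (p (m n T.Ω))
    rw [proj_idem hp, ← op_apply_Ω hpM, T.op_commute hpM (hm n), T.op_commute hpM hpM]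

/-- The corner `p M p` of a tracial von Neumann algebra is a tracial von Neumann algebra. -/
theorem exists_corner (T : TracialStandardForm H) (p : T.M) (hp : IsStarProjection p)
    (h0 : p ≠ 0) :
    ∃ (K : Submodule ℂ H) (_ : CompleteSpace K) (T' : TracialStandardForm K)
      (j : T'.M →ₙ+* T.M), j 1 = p ∧ (∀ x, j (star x) = star (j x)) ∧
        (∀ x, T.tr (j x) = T.tr p * T'.tr x) ∧ Function.Injective j ∧
        ∀ a, ∃ x, j x = p * a * p ∧ (0 ≤ a → 0 ≤ x) := by
  have hpM := p.2
  have hp' : IsStarProjection (p : H →L[ℂ] H) :=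
    ⟨congrArg Subtype.val hp.isIdempotentElem.eq, congrArg Subtype.val hp.isSelfAdjoint.star_eq⟩
  have h0' : (p : H →L[ℂ] H) ≠ 0 := fun h => h0 (Subtype.ext h)
  have hlift : ∀ x : (T.corner hpM hp' h0').M, ∃ m : T.M, p * m = m ∧ m * p = m ∧
      ∀ ζ : T.cornerSpace p, (m : H →L[ℂ] H) ζ = (x : T.cornerSpace p →L[ℂ] T.cornerSpace p) ζ := fun x => by
    obtain ⟨m, hm, h1, h2, h3⟩ := exists_lift hpM hp' x.2
    exact ⟨⟨m, hm⟩, Subtype.ext h1, Subtype.ext h2, h3⟩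
  choose j hpj hjp hj using hlift
  -- The lifts are only chosen, but an m with m p = m is determined by its action on the corner
  -- space. Every algebraic property of j can thus be checked there.
  have huniq : ∀ (m n : T.M), m * p = m → n * p = n →
      (∀ ζ : T.cornerSpace p, (m : H →L[ℂ] H) ζ = (n : H →L[ℂ] H) ζ) → m = n := fun m n hm hn h =>
    Subtype.ext (eq_of_eqOn_corner hpM hp' m.2 n.2 (congrArg Subtype.val hm)
      (congrArg Subtype.val hn) h)
  have hps : star p = p := hp.isSelfAdjoint.star_eq
  refine ⟨T.cornerSpace p, inferInstance, T.corner hpM hp' h0',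
    { toFun := j, map_mul' := ?_, map_zero' := ?_, map_add' := ?_ }, ?_, ?_, ?_, ?_, ?_⟩
  · intro x y
    refine huniq _ _ (hjp _) (by rw [mul_assoc, hjp]) fun ζ => ?_
    rw [hj]
    change ((x : T.cornerSpace p →L[ℂ] T.cornerSpace p) ((y : T.cornerSpace p →L[ℂ] T.cornerSpace p) ζ) : H)
      = (j x : H →L[ℂ] H) ((j y : H →L[ℂ] H) ζ)
    rw [hj y, hj x]
  · refine huniq _ _ (hjp _) (zero_mul _) fun ζ => ?_
    rw [hj]
    rfl
  · intro x y
    refine huniq _ _ (hjp _) (by rw [add_mul, hjp, hjp]) fun ζ => ?_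
    rw [hj]
    change (((x : T.cornerSpace p →L[ℂ] T.cornerSpace p) ζ + (y : T.cornerSpace p →L[ℂ] T.cornerSpace p) ζ :
      T.cornerSpace p) : H) = (j x : H →L[ℂ] H) ζ + (j y : H →L[ℂ] H) ζ
    rw [hj y, hj x]
    rfl
  · refine huniq _ _ (hjp _) hp.isIdempotentElem.eq fun ζ => ?_
    change (j 1 : H →L[ℂ] H) ζ = _
    rw [hj]
    exact ζ.2.1.symm
  · intro x
    change j (star x) = star (j x)
    refine huniq _ _ (hjp _) ?_ fun ζ => ?_
    · have := congrArg star (hpj x)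
      rwa [star_mul, hps] at this
    · rw [hj]
      have hmem : (star (j x : H →L[ℂ] H)) ζ ∈ T.cornerSpace p := by
        refine corner_mem_of_mem hpM (star_mem (j x).2) ?_ ζ ζ.2
        have := congrArg star (hjp x)
        rw [star_mul, hps] at this
        exact congrArg Subtype.val this
      have : (⟨_, hmem⟩ : T.cornerSpace p) = (star (x : T.cornerSpace p →L[ℂ] T.cornerSpace p)) ζ := by
        refine ext_inner_left ℂ fun ξ => ?_
        rw [ContinuousLinearMap.inner_star_right]
        change ⟪(ξ : H), (star (j x : H →L[ℂ] H)) ζ⟫_ℂ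
          = ⟪((x : T.cornerSpace p →L[ℂ] T.cornerSpace p) ξ : H), (ζ : H)⟫_ℂ
        rw [ContinuousLinearMap.inner_star_right, hj]
      exact (congrArg Subtype.val this).symm
  · intro x
    change T.tr (j x) = _
    have hne : ‖(p : H →L[ℂ] H) T.Ω‖ ≠ 0 :=
      fun h => h0' (T.separating p hpM (norm_eq_zero.1 h))
    have h1 : T.tr p = ‖(p : H →L[ℂ] H) T.Ω‖ ^ 2 := by
      rw [tr_apply, ← ContinuousLinearMap.re_inner_star_mul_self, hp'.isSelfAdjoint.star_eq,
        hp'.isIdempotentElem.eq]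
    set ω : T.cornerSpace p := ⟨(p : H →L[ℂ] H) T.Ω, proj_Ω_mem hpM hp'⟩ with hω
    have h2 : ⟪ω, (x : T.cornerSpace p →L[ℂ] T.cornerSpace p) ω⟫_ℂ = ⟪T.Ω, (j x : H →L[ℂ] H) T.Ω⟫_ℂ := by
      change ⟪(p : H →L[ℂ] H) T.Ω, ((x : T.cornerSpace p →L[ℂ] T.cornerSpace p) ω : H)⟫_ℂ = _
      rw [← hj x]
      have h3 := ContinuousLinearMap.inner_star_left (p : H →L[ℂ] H) T.Ω
        ((j x : H →L[ℂ] H) ω)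
      rw [hp'.isSelfAdjoint.star_eq] at h3
      rw [h3]
      have h4 : p * (j x * p) = j x := by rw [hjp, hpj]
      exact congrArg (fun R : T.M => ⟪T.Ω, (R : H →L[ℂ] H) T.Ω⟫_ℂ) h4
    have h5 : (T.corner hpM hp' h0').tr x = (‖(p : H →L[ℂ] H) T.Ω‖⁻¹) ^ 2 * T.tr (j x) := by
      rw [tr_apply, tr_apply, ← h2]
      change RCLike.re ⟪((‖(p : H →L[ℂ] H) T.Ω‖⁻¹ : ℝ) : ℂ) • ω, (x : T.cornerSpace p →L[ℂ] T.cornerSpace p)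
        (((‖(p : H →L[ℂ] H) T.Ω‖⁻¹ : ℝ) : ℂ) • ω)⟫_ℂ = _
      rw [map_smul, inner_smul_left, inner_smul_right, Complex.conj_ofReal, ← mul_assoc,
        ← Complex.ofReal_mul]
      simp only [RCLike.re_to_complex, Complex.re_ofReal_mul]
      ring
    rw [h5, h1]
    field_simp
  · intro x y hxy
    refine Subtype.ext (ContinuousLinearMap.ext fun ζ => Subtype.ext ?_)
    rw [← hj, ← hj]
    change j x = j y at hxy
    rw [hxy]
  · intro a
    have hR : (p : H →L[ℂ] H) * a * p ∈ T.M := mul_mem (mul_mem hpM a.2) hpM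
    have hpR : (p : H →L[ℂ] H) * (p * a * p) = p * a * p := by
      rw [mul_assoc, ← mul_assoc, hp'.isIdempotentElem.eq]
    have hRp : (p : H →L[ℂ] H) * a * p * p = p * a * p := by
      rw [mul_assoc _ (p : H →L[ℂ] H) p, hp'.isIdempotentElem.eq]
    refine ⟨⟨_, restrict_mem_cornerAlgebra hpM hp' hR hpR hRp⟩,
      huniq _ _ (hjp _) (Subtype.ext hRp) fun ζ => hj _ ζ, fun ha => ?_⟩
    change (0 : T.cornerSpace p →L[ℂ] T.cornerSpace p) ≤
      cornerRestrict ((p : H →L[ℂ] H) * (a : H →L[ℂ] H) * (p : H →L[ℂ] H)) (corner_mem_of_mem hpM hR hpR)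
    have ha' : ContinuousLinearMap.IsPositive (a : H →L[ℂ] H) :=
      (ContinuousLinearMap.nonneg_iff_isPositive _).1 ha
    have hin : ∀ ζ : T.cornerSpace p, ⟪cornerRestrict ((p : H →L[ℂ] H) * (a : H →L[ℂ] H) * (p : H →L[ℂ] H))
        (corner_mem_of_mem hpM hR hpR) ζ, ζ⟫_ℂ = ⟪(a : H →L[ℂ] H) ζ, (ζ : H)⟫_ℂ := fun ζ => by
      change ⟪(p : H →L[ℂ] H) ((a : H →L[ℂ] H) ((p : H →L[ℂ] H) ζ)), (ζ : H)⟫_ℂ = _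
      rw [ζ.2.1, ← inner_conj_symm, inner_proj hp' ζ.2, inner_conj_symm]
    rw [ContinuousLinearMap.nonneg_iff_isPositive, ContinuousLinearMap.isPositive_iff_complex]
    intro ζ
    rw [hin]
    exact (ContinuousLinearMap.isPositive_iff_complex _).1 ha' ζ

end TracialStandardForm

/-! ### Symmetric strategies given by measurements in the algebra -/

theorem VonNeumannAlgebra.exists_star_mul_self {H : Type*} [NormedAddCommGroup H]
    [InnerProductSpace ℂ H] [CompleteSpace H] {S : VonNeumannAlgebra H} {x : S} (hx : 0 ≤ x) :
    ∃ w : S, x = star w * w := by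
  have hx' : (0 : H →L[ℂ] H) ≤ x := hx
  refine ⟨⟨CFC.sqrt (x : H →L[ℂ] H), VonNeumannAlgebra.sqrt_mem x.2⟩, Subtype.ext ?_⟩
  change (x : H →L[ℂ] H) = star (CFC.sqrt (x : H →L[ℂ] H)) * CFC.sqrt (x : H →L[ℂ] H)
  rw [(CFC.sqrt_nonneg (x : H →L[ℂ] H)).isSelfAdjoint.star_eq, CFC.sqrt_mul_sqrt_self _ hx']

namespace TracialStandardForm

section Strategy

variable {H : Type*} [NormedAddCommGroup H] [InnerProductSpace ℂ H] [CompleteSpace H]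
variable {T : TracialStandardForm H}

theorem isPOVM_coe {A : Type*} [Fintype A] {E : A → T.M} (h0 : ∀ a, 0 ≤ E a)
    (h1 : ∑ a, E a = 1) : IsPOVM fun a => (E a : H →L[ℂ] H) where
  pos a := (ContinuousLinearMap.nonneg_iff_isPositive _).1 (h0 a)
  sum_eq := by
    have := congrArg Subtype.val h1
    rwa [AddSubmonoidClass.coe_finsetSum] at this

theorem isPOVM_op {A : Type*} [Fintype A] {E : A → T.M} (h0 : ∀ a, 0 ≤ E a)
    (h1 : ∑ a, E a = 1) : IsPOVM fun a => T.op (E a : H →L[ℂ] H) where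
  pos a := (ContinuousLinearMap.nonneg_iff_isPositive _).1 (op_nonneg (E a).2 (h0 a))
  sum_eq := by
    rw [← op_sum _ fun a => (E a).2, (isPOVM_coe h0 h1).sum_eq, op_one]

variable (T) in
/-- The symmetric strategy with state `|τ⟩` given by measurements in the algebra. -/
noncomputable def symmetricStrategy {X A : Type*} [Fintype A] (E : X → A → T.M)
    (h0 : ∀ x a, 0 ≤ E x a) (h1 : ∀ x, ∑ a, E x a = 1) : CommutingStrategy X A H where
  ψ := T.Ω
  norm_ψ := T.norm_Ω
  alice x a := E x a
  bob x a := T.op (E x a)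
  alice_povm x := isPOVM_coe (h0 x) (h1 x)
  bob_povm x := isPOVM_op (h0 x) (h1 x)
  commute x y a b := VonNeumannAlgebra.mem_commutant_iff.1 (op_mem (E y b).2) _ (E x a).2

theorem re_inner_op (x y : T.M) :
    RCLike.re ⟪T.Ω, ((x : H →L[ℂ] H) * T.op (y : H →L[ℂ] H)) T.Ω⟫_ℂ = T.tr (x * y) := by
  rw [mul_apply_eq_comp, op_apply_Ω y.2]
  rfl

theorem symmetricStrategy_corr {X A : Type*} [Fintype A] {E : X → A → T.M}
    (h0 : ∀ x a, 0 ≤ E x a) (h1 : ∀ x, ∑ a, E x a = 1) (x y : X) (a b : A) :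
    (T.symmetricStrategy E h0 h1).corr x y a b = T.tr (E x a * E y b) :=
  re_inner_op _ _

end Strategy

end TracialStandardForm

/-! ### From the hypothesis to POVMs and corners -/

theorem NonlocalGame.winProb_mem_Icc {X A : Type*} [Fintype X] [Fintype A]
    (𝓖 : NonlocalGame X A) {C : X → X → A → A → ℝ} (h0 : ∀ x y a b, 0 ≤ C x y a b)
    (h1 : ∀ x y, ∑ a, ∑ b, C x y a b ≤ 1) : 𝓖.winProb C ∈ Set.Icc (0 : ℝ) 1 := by
  have hnn : ∀ x y a b, 0 ≤ (if 𝓖.V x y a b = true then C x y a b else 0) := fun x y a b => by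
    split_ifs
    exacts [h0 _ _ _ _, le_rfl]
  constructor
  · exact Finset.sum_nonneg fun x _ => Finset.sum_nonneg fun y _ => mul_nonneg (𝓖.μ_nonneg x y)
      (Finset.sum_nonneg fun a _ => Finset.sum_nonneg fun b _ => hnn x y a b)
  · rw [← 𝓖.μ_sum]
    refine Finset.sum_le_sum fun x _ => Finset.sum_le_sum fun y _ => ?_
    refine mul_le_of_le_one_right (𝓖.μ_nonneg x y) (le_trans ?_ (h1 x y))
    refine Finset.sum_le_sum fun a _ => Finset.sum_le_sum fun b _ => ?_
    split_ifs
    exacts [le_rfl, h0 _ _ _ _]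

section Filter

variable {N : Type*} [CStarAlgebra N] [PartialOrder N] [StarOrderedRing N] {A : Type*} [Fintype A]
  {E : A → N}

theorem sum_filter_nonneg (h0 : ∀ a, 0 ≤ E a) (s : Finset A) : 0 ≤ ∑ a ∈ s, E a :=
  Finset.sum_nonneg fun a _ => h0 a

theorem sum_filter_le (h0 : ∀ a, 0 ≤ E a) (h1 : ∑ a, E a = 1) (s : Finset A) :
    ∑ a ∈ s, E a ≤ 1 := by
  rw [← h1]
  exact Finset.sum_le_sum_of_subset_of_nonneg (Finset.subset_univ _) fun a _ _ => h0 a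

theorem sum_sum_ite_eq_right {B : Type*} [Fintype B] (τ : N →ₗ[ℝ] ℝ) (V : A → B → Bool)
    (E : A → N) (F : B → N) :
    ∑ a, ∑ b, (if V a b = true then τ (E a * F b) else 0)
      = ∑ a, τ (E a * ∑ b with V a b = true, F b) := by
  refine Finset.sum_congr rfl fun a _ => ?_
  rw [Finset.mul_sum, map_sum, Finset.sum_filter]

theorem sum_sum_ite_eq_left {B : Type*} [Fintype B] {τ : N →ₗ[ℝ] ℝ} (hτ : IsTracialState τ)
    (V : A → B → Bool) (E : A → N) (F : B → N) :
    ∑ a, ∑ b, (if V a b = true then τ (E a * F b) else 0)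
      = ∑ b, τ (F b * ∑ a with V a b = true, E a) := by
  rw [Finset.sum_comm]
  refine Finset.sum_congr rfl fun b _ => ?_
  rw [Finset.mul_sum, map_sum, Finset.sum_filter]
  refine Finset.sum_congr rfl fun a _ => ?_
  rw [hτ.mul_comm]

end Filter

/-- The soundness property of all synchronous tracial strategies. -/
def SynchronousSoundness {X A : Type v} {Y B : Type v} [Fintype X] [Fintype A] [Fintype Y]
    [Fintype B] (𝓖 : NonlocalGame X A) (ρ : X → Y → ℝ) (g : X → Y → A → Finset B)
    (κ : ℝ → ℝ) (c₀ : ℝ) : Prop :=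
  ∀ (H : Type u) [NormedAddCommGroup H] [InnerProductSpace ℂ H] [CompleteSpace H]
    (T : TracialStandardForm H) (S : CommutingStrategy X A H), S.IsTracialSynchronous T →
      S.HasSoundness T ρ g (c₀ * κ (𝓖.winProb S.corr))

namespace SynchronousSoundness

variable {X A Y B : Type v} [Fintype X] [Fintype A] [Fintype Y] [Fintype B]
  {𝓖 : NonlocalGame X A} {ρ : X → Y → ℝ} {g : X → Y → A → Finset B} {κ : ℝ → ℝ} {c₀ : ℝ}

/-- Orthogonality of a projective measurement is exactly synchronicity of its symmetric strategy.
The hypothesis then becomes a statement about traces alone. -/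
theorem projective (hS : SynchronousSoundness.{u, v} 𝓖 ρ g κ c₀) {H : Type u}
    [NormedAddCommGroup H] [InnerProductSpace ℂ H] [CompleteSpace H] (T : TracialStandardForm H)
    {Q : X → A → T.M} (hQ : ∀ x a, IsStarProjection (Q x a))
    (horth : ∀ x a b, a ≠ b → Q x a * Q x b = 0) (hsum : ∀ x, ∑ a, Q x a = 1) :
    ∃ G : Y → B → T.M, (∀ y b, 0 ≤ G y b) ∧ (∀ y, ∑ b, G y b = 1) ∧
      𝓖.winProb (fun x y a b => T.tr (Q x a * Q y b)) ∈ Set.Icc (0 : ℝ) 1 ∧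
      c₀ * κ (𝓖.winProb fun x y a b => T.tr (Q x a * Q y b)) ≤
        ∑ x, ∑ y, ρ x y * ∑ a, T.tr (Q x a * ∑ b ∈ g x y a, G y b) := by
  have hQ0 : ∀ x a, 0 ≤ Q x a := fun x a => (hQ x a).zero_le
  have hcorr : (T.symmetricStrategy Q hQ0 hsum).corr = fun x y a b => T.tr (Q x a * Q y b) := by
    ext x y a b
    exact TracialStandardForm.symmetricStrategy_corr hQ0 hsum x y a b
  have hsync : (T.symmetricStrategy Q hQ0 hsum).IsTracialSynchronous T := by
    refine ⟨⟨one_mem _, rfl, fun x a => (Q x a).2,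
      fun x a => TracialStandardForm.op_mem (Q x a).2⟩, fun x a => rfl, fun x a b hab => ?_⟩
    rw [hcorr]
    simp only
    rw [horth x a b hab, map_zero]
  obtain ⟨G, hG, hGM, hle⟩ := hS H T _ hsync
  have hτ := T.isTracialState_tr
  refine ⟨fun y b => ⟨G y b, hGM y b⟩, fun y b => ?_, fun y => Subtype.ext ?_, ?_, ?_⟩
  · exact (ContinuousLinearMap.nonneg_iff_isPositive _).2 ((hG y).pos b)
  · rw [AddSubmonoidClass.coe_finsetSum]
    exact (hG y).sum_eq
  · refine 𝓖.winProb_mem_Icc (fun x y a b => hτ.mul_nonneg (hQ0 x a) (hQ0 y b)) fun x y => ?_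
    have h2 : ∀ a, ∑ b, T.tr (Q x a * Q y b) = T.tr (Q x a) := fun a => by
      rw [← map_sum, ← Finset.mul_sum, hsum, mul_one]
    simp_rw [h2]
    rw [← map_sum, hsum]
    exact hτ.one.le
  · rw [hcorr] at hle
    refine hle.trans_eq ?_
    refine Finset.sum_congr rfl fun x _ => Finset.sum_congr rfl fun y _ => ?_
    refine congrArg _ (Finset.sum_congr rfl fun a _ => ?_)
    have h1 : ((∑ b ∈ g x y a, (⟨G y b, hGM y b⟩ : T.M) : T.M) : H →L[ℂ] H)
        = ∑ b ∈ g x y a, G y b := by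
      rw [AddSubmonoidClass.coe_finsetSum]
    rw [← TracialStandardForm.re_inner_op, h1]
    rfl

/-- Each POVM is rounded to a projective measurement. The rounding is paid once in the soundness
value, where only Alice's operators occur, and twice in the winning probability, where both players'
do. That ω is bounded below only, in averaged form, is enough for the later use of convexity. -/
theorem povm [Nonempty A] (hS : SynchronousSoundness.{u, v} 𝓖 ρ g κ c₀)
    (hρ : ∀ x y, 0 ≤ ρ x y) {H : Type u}
    [NormedAddCommGroup H] [InnerProductSpace ℂ H] [CompleteSpace H] (T : TracialStandardForm H)
    {E : X → A → T.M} (h0 : ∀ x a, 0 ≤ E x a) (h1 : ∀ x, ∑ a, E x a = 1) :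
    ∃ (ω : ℝ) (G : Y → B → T.M), ω ∈ Set.Icc (0 : ℝ) 1 ∧
      (∀ y b, 0 ≤ G y b) ∧ (∀ y, ∑ b, G y b = 1) ∧
      c₀ * κ ω ≤ ∑ x, ∑ y, ρ x y * (∑ a, T.tr (E x a * ∑ b ∈ g x y a, G y b)
        + 840 * √(∑ a, T.tr (E x a - E x a * E x a))) ∧
      ∑ x, ∑ y, 𝓖.μ x y *
        (∑ a, ∑ b, (if 𝓖.V x y a b = true then T.tr (E x a * E y b) else 0)
          - 840 * √(∑ a, T.tr (E x a - E x a * E x a))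
          - 840 * √(∑ a, T.tr (E y a - E y a * E y a))) ≤ ω := by
  have hτ := T.isTracialState_tr
  choose Q hQ horth hsum hQE using fun x =>
    exists_projective_measurement T.M.douglas hτ (E x) (h0 x) (h1 x)
  have hQ0 : ∀ x a, 0 ≤ Q x a := fun x a => (hQ x a).zero_le
  obtain ⟨G, hG0, hG1, hω, hle⟩ := hS.projective T hQ horth hsum
  refine ⟨_, G, hω, hG0, hG1, hle.trans ?_, ?_⟩
  · refine Finset.sum_le_sum fun x _ => Finset.sum_le_sum fun y _ => ?_
    refine mul_le_mul_of_nonneg_left ?_ (hρ x y)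
    have := (abs_le.1 (hτ.abs_sum_sub_sum_le (h0 x) (h1 x) (hQ x)
      (F := fun a => ∑ b ∈ g x y a, G y b)
      (fun a => sum_filter_nonneg (hG0 y) _) (fun a => sum_filter_le (hG0 y) (hG1 y) _)
      (hQE x))).2
    linarith
  · refine Finset.sum_le_sum fun x _ => Finset.sum_le_sum fun y _ => ?_
    refine mul_le_mul_of_nonneg_left ?_ (𝓖.μ_nonneg x y)
    have e1 := (abs_le.1 (hτ.abs_sum_sub_sum_le (h0 x) (h1 x) (hQ x)
      (F := fun a => ∑ b with 𝓖.V x y a b = true, E y b)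
      (fun a => sum_filter_nonneg (h0 y) _) (fun a => sum_filter_le (h0 y) (h1 y) _)
      (hQE x))).1
    have e2 := (abs_le.1 (hτ.abs_sum_sub_sum_le (h0 y) (h1 y) (hQ y)
      (F := fun b => ∑ a with 𝓖.V x y a b = true, Q x a)
      (fun a => sum_filter_nonneg (hQ0 x) _) (fun a => sum_filter_le (hQ0 x) (hsum x) _)
      (hQE y))).1
    have i1 := sum_sum_ite_eq_right T.tr (𝓖.V x y) (E x) (E y)
    have i2 := sum_sum_ite_eq_right T.tr (𝓖.V x y) (Q x) (E y)
    have i3 := sum_sum_ite_eq_left hτ (𝓖.V x y) (Q x) (E y)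
    have i4 := sum_sum_ite_eq_left hτ (𝓖.V x y) (Q x) (Q y)
    linarith

/-- Soundness on the corner cut out by a projection `p`. -/
theorem corner [Nonempty A] (hS : SynchronousSoundness.{u, v} 𝓖 ρ g κ c₀)
    (hρ : ∀ x y, 0 ≤ ρ x y) {H : Type u}
    [NormedAddCommGroup H] [InnerProductSpace ℂ H] [CompleteSpace H] (T : TracialStandardForm H)
    {E : X → A → T.M} (h0 : ∀ x a, 0 ≤ E x a) (h1 : ∀ x, ∑ a, E x a = 1) {p : T.M}
    (hp : IsStarProjection p) :
    ∃ (ω : ℝ) (G : Y → B → T.M), ω ∈ Set.Icc (0 : ℝ) 1 ∧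
      (∀ y b, 0 ≤ G y b) ∧ (∀ y, ∑ b, G y b = p) ∧
      T.tr p * (c₀ * κ ω) ≤ ∑ x, ∑ y, ρ x y * (∑ a, T.tr (E x a * ∑ b ∈ g x y a, G y b)
        + 840 * √(T.tr p * ∑ a, T.tr (p * E x a * p - p * E x a * p * (p * E x a * p)))) ∧
      ∑ x, ∑ y, 𝓖.μ x y *
        (∑ a, ∑ b, (if 𝓖.V x y a b = true then T.tr (p * E x a * p * E y b) else 0)
          - 840 * √(T.tr p * ∑ a, T.tr (p * E x a * p - p * E x a * p * (p * E x a * p)))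
          - 840 * √(T.tr p * ∑ a, T.tr (p * E y a * p - p * E y a * p * (p * E y a * p))))
        ≤ T.tr p * ω := by
  have hτ := T.isTracialState_tr
  have hpp : p * p = p := hp.isIdempotentElem.eq
  -- The zero corner carries no tracial state; both inequalities are trivial there.
  by_cases hp0 : p = 0
  · subst hp0
    refine ⟨0, fun _ _ => 0, by simp, fun _ _ => le_rfl, by simp, by simp, by simp⟩
  obtain ⟨K, _, T', j, hj1, hjs, hjτ, hjinj, hcomp⟩ :=
    TracialStandardForm.exists_corner T p hp hp0
  choose e he he0 using fun x a => hcomp (E x a)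
  have hpt : 0 ≤ T.tr p := hτ.nonneg _ hp.zero_le
  have hj0 : ∀ z, 0 ≤ z → 0 ≤ j z := fun z hz => by
    obtain ⟨w, hw⟩ := VonNeumannAlgebra.exists_star_mul_self hz
    rw [hw, map_mul, hjs]
    exact star_mul_self_nonneg _
  have hpj : ∀ z, p * j z = j z := fun z => by rw [← hj1, ← map_mul, one_mul]
  have hjp : ∀ z, j z * p = j z := fun z => by rw [← hj1, ← map_mul, mul_one]
  have he1 : ∀ x, ∑ a, e x a = 1 := fun x => hjinj <| by
    rw [map_sum, hj1]
    simp_rw [he]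
    rw [← Finset.sum_mul, ← Finset.mul_sum, h1, mul_one, hpp]
  -- Multiplying by τ(p) removes the normalization of the corner trace. Under the root one factor
  -- τ(p) remains, which Cauchy-Schwarz over the levels uses later.
  have hd : ∀ x, T.tr p * √(∑ a, T'.tr (e x a - e x a * e x a))
      = √(T.tr p * ∑ a, T.tr (p * E x a * p - p * E x a * p * (p * E x a * p))) := fun x => by
    have : ∑ a, T.tr (p * E x a * p - p * E x a * p * (p * E x a * p))
        = T.tr p * ∑ a, T'.tr (e x a - e x a * e x a) := by
      rw [Finset.mul_sum]
      refine Finset.sum_congr rfl fun a _ => ?_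
      rw [← hjτ, map_sub j, map_mul j, he]
    rw [this, ← mul_assoc, Real.sqrt_mul (mul_nonneg hpt hpt), Real.sqrt_mul_self hpt]
  have hV : ∀ x y a b, T.tr p * T'.tr (e x a * e y b) = T.tr (p * E x a * p * E y b) :=
    fun x y a b => by
      rw [← hjτ, map_mul, he, he]
      have : p * E x a * p * (p * E y b * p) = p * E x a * p * E y b * p := by
        rw [← mul_assoc, ← mul_assoc, mul_assoc _ p p, hpp]
      rw [this, hτ.mul_comm, ← mul_assoc, ← mul_assoc, ← mul_assoc, hpp]
  obtain ⟨ω, G, hω, hG0, hG1, hle, hwin⟩ := hS.povm hρ T' (fun x a => he0 x a (h0 x a)) he1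
  refine ⟨ω, fun y b => j (G y b), hω, fun y b => hj0 _ (hG0 y b), fun y => ?_, ?_, ?_⟩
  · rw [← map_sum, hG1, hj1]
  · refine (mul_le_mul_of_nonneg_left hle hpt).trans_eq ?_
    rw [Finset.mul_sum]
    refine Finset.sum_congr rfl fun x _ => ?_
    rw [Finset.mul_sum]
    refine Finset.sum_congr rfl fun y _ => ?_
    rw [mul_left_comm, mul_add, mul_left_comm (T.tr p) 840, hd, Finset.mul_sum]
    refine congrArg (fun r => ρ x y * (r + _)) (Finset.sum_congr rfl fun a _ => ?_)
    rw [← hjτ, map_mul, he, map_sum]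
    have : (∑ b ∈ g x y a, j (G y b)) = p * ∑ b ∈ g x y a, j (G y b) := by
      rw [Finset.mul_sum]
      simp_rw [hpj]
    have h2 : (∑ b ∈ g x y a, j (G y b)) * p = ∑ b ∈ g x y a, j (G y b) := by
      rw [Finset.sum_mul]
      simp_rw [hjp]
    rw [mul_assoc, ← this, mul_assoc, hτ.mul_comm, mul_assoc, h2]
  · refine le_trans (Eq.le ?_) (mul_le_mul_of_nonneg_left hwin hpt)
    refine Eq.trans ?_ (Finset.mul_sum _ _ _).symm
    refine Finset.sum_congr rfl fun x _ => ?_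
    refine Eq.trans ?_ (Finset.mul_sum _ _ _).symm
    refine Finset.sum_congr rfl fun y _ => ?_
    have : ∑ a, ∑ b, (if 𝓖.V x y a b = true then T.tr (p * E x a * p * E y b) else 0)
        = T.tr p * ∑ a, ∑ b, (if 𝓖.V x y a b = true then T'.tr (e x a * e y b) else 0) := by
      rw [Finset.mul_sum]
      refine Finset.sum_congr rfl fun a _ => ?_
      rw [Finset.mul_sum]
      refine Finset.sum_congr rfl fun b _ => ?_
      rw [mul_ite, mul_zero, hV]
    rw [this, ← hd, ← hd]
    ring

end SynchronousSoundness

/-! ### Averaging over the levels and transport to the original state -/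

theorem sum_sum_ite_conj {N : Type*} [CStarAlgebra N] {A B : Type*} [Fintype A] [Fintype B]
    (τ : N →ₗ[ℝ] ℝ) (V : A → B → Bool) (s : N) (E : A → N) (F : B → N) :
    ∑ a, ∑ b, (if V a b = true then τ (s * E a * s * F b) else 0)
      = ∑ b, τ (s * (∑ a with V a b = true, E a) * s * F b) := by
  rw [Finset.sum_comm]
  refine Finset.sum_congr rfl fun b _ => ?_
  rw [Finset.mul_sum, Finset.sum_mul, Finset.sum_mul, map_sum, Finset.sum_filter]

namespace IsStaircase

variable {N : Type*} [CStarAlgebra N] [PartialOrder N] [StarOrderedRing N]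
  {n : ℕ} {E : ℕ → N} {r : ℕ → ℝ}

/-- The error terms of the levels, averaged with the level weights. -/
theorem sum_level_sqrt_le (h : IsStaircase n E r) {τ : N →ₗ[ℝ] ℝ} (hτ : IsTracialState τ)
    {ι : Type*} [Fintype ι] {A B : ι → N} {d : ℝ}
    (hc : IsCorrelatedPair τ (diagOp n E r) A B d)
    (ht : τ (diagOp n E r * diagOp n E r) ≤ 1) :
    ∑ k ∈ Finset.range n, levelWeight r k * √(τ (levelProj n E k) *
      ∑ a, τ (levelProj n E k * A a * levelProj n E k -
        levelProj n E k * A a * levelProj n E k * (levelProj n E k * A a * levelProj n E k)))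
      ≤ 3 * √√d := by
  have hdef := h.sum_level_defect_le hτ hc ht
  have hsq : ∑ k ∈ Finset.range n, levelWeight r k * τ (levelProj n E k) ≤ 1 := by
    rw [h.sq_eq_sum, map_sum] at ht
    simpa using ht
  set P := fun k => levelProj n E k with hP
  set D := fun k => ∑ a, τ (levelProj n E k * A a * levelProj n E k -
        levelProj n E k * A a * levelProj n E k * (levelProj n E k * A a * levelProj n E k))
    with hD
  have hp : ∀ k, IsStarProjection (P k) := fun k => h.levelProj_proj k
  have hP0 : ∀ k, 0 ≤ τ (P k) := fun k => hτ.nonneg _ (hp k).zero_le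
  have hD0 : ∀ k, 0 ≤ D k := fun k => Finset.sum_nonneg fun a _ => hτ.nonneg _ <| by
    have h1 : star (P k) = P k := (hp k).star_eq
    refine sub_nonneg.2 (mul_self_le_self ?_ ?_)
    · exact (hp k).isSelfAdjoint.conjugate_nonneg (hc.nonneg_left a)
    · refine le_trans ((hp k).isSelfAdjoint.conjugate_le_conjugate (hc.left_le a)) ?_
      rw [mul_one, (hp k).mul_self]
      exact (hp k).le_one'
  have hw := h.levelWeight_nonneg
  calc ∑ k ∈ Finset.range n, levelWeight r k * √(τ (P k) * D k)
      = ∑ k ∈ Finset.range n, √(levelWeight r k * τ (P k)) * √(levelWeight r k * D k) := by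
        refine Finset.sum_congr rfl fun k _ => ?_
        rw [← Real.sqrt_mul (mul_nonneg (hw k) (hP0 k)), mul_mul_mul_comm,
          Real.sqrt_mul (mul_nonneg (hw k) (hw k)), Real.sqrt_mul_self (hw k)]
    -- Cauchy-Schwarz over the levels: the first factor is at most 1, being the root of τ(s²), and
    -- the second is at most √(6 √d).
    _ ≤ √(∑ k ∈ Finset.range n, levelWeight r k * τ (P k)) *
          √(∑ k ∈ Finset.range n, levelWeight r k * D k) :=
        Real.sum_sqrt_mul_sqrt_le _ (fun k => mul_nonneg (hw k) (hP0 k))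
          fun k => mul_nonneg (hw k) (hD0 k)
    _ ≤ 1 * √(6 * √d) := by
        refine mul_le_mul (Real.sqrt_le_one.2 hsq) (Real.sqrt_le_sqrt hdef) (Real.sqrt_nonneg _)
          zero_le_one
    _ ≤ 3 * √√d := by
        rw [one_mul, Real.sqrt_mul (by norm_num)]
        refine mul_le_mul_of_nonneg_right ?_ (Real.sqrt_nonneg _)
        rw [Real.sqrt_le_left (by norm_num)]
        norm_num

end IsStaircase

namespace SynchronousSoundness

variable {X A Y B : Type v} [Fintype X] [Fintype A] [Fintype Y] [Fintype B]
  {𝓖 : NonlocalGame X A} {ρ : X → Y → ℝ} {g : X → Y → A → Finset B} {κ : ℝ → ℝ} {c₀ : ℝ}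

/-- Soundness for a state with finite spectrum, from the soundness on its levels. -/
theorem staircase [Nonempty A] (hS : SynchronousSoundness.{u, v} 𝓖 ρ g κ c₀)
    (hρ : ∀ x y, 0 ≤ ρ x y) (hκ : ConvexOn ℝ (Set.Icc 0 1) κ) (hc₀ : 0 ≤ c₀) {H : Type u}
    [NormedAddCommGroup H] [InnerProductSpace ℂ H] [CompleteSpace H] (T : TracialStandardForm H)
    {E F : X → A → T.M} {n : ℕ} {P : ℕ → T.M} {r : ℕ → ℝ} (h : IsStaircase n P r)
    {d : X → ℝ} (hc : ∀ x, IsCorrelatedPair T.tr (diagOp n P r) (E x) (F x) (d x))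
    (ht : T.tr (diagOp n P r * diagOp n P r) ≤ 1)
    (ht0 : 0 < T.tr (diagOp n P r * diagOp n P r)) :
    ∃ (ω : ℝ) (G : Y → B → T.M), ω ∈ Set.Icc (0 : ℝ) 1 ∧
      (∀ y b, 0 ≤ G y b) ∧ (∀ y, ∑ b, G y b = diagOp n P r * diagOp n P r) ∧
      T.tr (diagOp n P r * diagOp n P r) * (c₀ * κ ω) ≤
        ∑ x, ∑ y, ρ x y * (∑ a, T.tr (E x a * ∑ b ∈ g x y a, G y b) + 2520 * √√(d x)) ∧
      ∑ x, ∑ y, 𝓖.μ x y *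
        (∑ a, ∑ b, (if 𝓖.V x y a b = true then
            T.tr (diagOp n P r * E x a * diagOp n P r * F y b) else 0)
          - 2520 * √√(d x) - 2533 * √√(d y))
        ≤ T.tr (diagOp n P r * diagOp n P r) * ω := by
  have hτ := T.isTracialState_tr
  have hE0 : ∀ x a, 0 ≤ E x a := fun x => (hc x).nonneg_left
  have hE1 : ∀ x, ∑ a, E x a = 1 := fun x => (hc x).sum_left
  have hw := h.levelWeight_nonneg
  have hsum := h.sq_eq_sum
  choose ω G hω hG0 hG1 hle hwin using fun k =>
    hS.corner hρ T hE0 hE1 (h.levelProj_proj k)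
  set t := T.tr (diagOp n P r * diagOp n P r) with htdef
  set δ := fun k x => √(T.tr (levelProj n P k) * ∑ a, T.tr
    (levelProj n P k * E x a * levelProj n P k -
      levelProj n P k * E x a * levelProj n P k * (levelProj n P k * E x a * levelProj n P k)))
    with hδ
  have hδle : ∀ x, ∑ k ∈ Finset.range n, levelWeight r k * δ k x ≤ 3 * √√(d x) := fun x =>
    h.sum_level_sqrt_le hτ (hc x) ht
  -- The α_k sum to τ(s²), so the α_k / t form a probability distribution on the levels; Jensen's
  -- inequality for κ is applied to it.
  set α := fun k => levelWeight r k * T.tr (levelProj n P k) with hα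
  have hα0 : ∀ k, 0 ≤ α k := fun k =>
    mul_nonneg (hw k) (hτ.nonneg _ (h.levelProj_proj k).zero_le)
  have hαt : ∑ k ∈ Finset.range n, α k = t := by
    rw [htdef, hsum, map_sum]
    simp [hα]
  have hq0 : ∀ k ∈ Finset.range n, 0 ≤ α k / t := fun k _ => div_nonneg (hα0 k) ht0.le
  have hq1 : ∑ k ∈ Finset.range n, α k / t = 1 := by
    rw [← Finset.sum_div, hαt, div_self ht0.ne']
  have hmul : ∀ f : ℕ → ℝ, t * ∑ k ∈ Finset.range n, (α k / t) • f k
      = ∑ k ∈ Finset.range n, α k * f k := fun f => by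
    rw [Finset.mul_sum]
    refine Finset.sum_congr rfl fun k _ => ?_
    rw [smul_eq_mul]
    field_simp
  refine ⟨∑ k ∈ Finset.range n, (α k / t) • ω k,
    fun y b => ∑ k ∈ Finset.range n, levelWeight r k • G k y b,
    (convex_Icc (0 : ℝ) 1).sum_mem hq0 hq1 fun k _ => hω k,
    fun y b => Finset.sum_nonneg fun k _ => smul_nonneg (hw k) (hG0 k y b), fun y => ?_, ?_, ?_⟩
  · rw [Finset.sum_comm, hsum]
    refine Finset.sum_congr rfl fun k _ => ?_
    rw [← Finset.smul_sum, hG1]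
  · have hJ := hκ.map_sum_le hq0 hq1 fun k _ => hω k
    calc t * (c₀ * κ (∑ k ∈ Finset.range n, (α k / t) • ω k))
        ≤ t * (c₀ * ∑ k ∈ Finset.range n, (α k / t) • κ (ω k)) := by gcongr
      _ = ∑ k ∈ Finset.range n, levelWeight r k * (T.tr (levelProj n P k) * (c₀ * κ (ω k))) := by
          rw [mul_left_comm, hmul, Finset.mul_sum]
          refine Finset.sum_congr rfl fun k _ => ?_
          simp only [hα]
          ring
      _ ≤ ∑ k ∈ Finset.range n, levelWeight r k * ∑ x, ∑ y, ρ x y *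
            (∑ a, T.tr (E x a * ∑ b ∈ g x y a, G k y b) + 840 * δ k x) :=
          Finset.sum_le_sum fun k _ => mul_le_mul_of_nonneg_left (hle k) (hw k)
      _ = ∑ x, ∑ y, ρ x y * (∑ a, T.tr (E x a * ∑ b ∈ g x y a,
            ∑ k ∈ Finset.range n, levelWeight r k • G k y b)
              + 840 * ∑ k ∈ Finset.range n, levelWeight r k * δ k x) := by
          simp_rw [Finset.mul_sum]
          rw [Finset.sum_comm]
          refine Finset.sum_congr rfl fun x _ => ?_
          rw [Finset.sum_comm]
          refine Finset.sum_congr rfl fun y _ => ?_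
          have : ∀ a, T.tr (∑ b ∈ g x y a, ∑ k ∈ Finset.range n,
              E x a * levelWeight r k • G k y b)
              = ∑ k ∈ Finset.range n, levelWeight r k * T.tr (∑ b ∈ g x y a, E x a * G k y b) :=
            fun a => by
              rw [Finset.sum_comm, map_sum]
              refine Finset.sum_congr rfl fun k _ => ?_
              rw [← smul_eq_mul, ← map_smul, Finset.smul_sum]
              simp_rw [mul_smul_comm]
          simp_rw [this]
          rw [Finset.sum_comm, ← Finset.sum_add_distrib, Finset.mul_sum]
          refine Finset.sum_congr rfl fun k _ => ?_
          rw [← Finset.mul_sum]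
          ring
      _ ≤ _ := by
          refine Finset.sum_le_sum fun x _ => Finset.sum_le_sum fun y _ => ?_
          refine mul_le_mul_of_nonneg_left ?_ (hρ x y)
          have := hδle x
          linarith
  · calc _ ≤ ∑ x, ∑ y, 𝓖.μ x y * (∑ k ∈ Finset.range n, levelWeight r k *
            (∑ a, ∑ b, if 𝓖.V x y a b = true then
              T.tr (levelProj n P k * E x a * levelProj n P k * E y b) else 0)
            - 840 * ∑ k ∈ Finset.range n, levelWeight r k * δ k x
            - 840 * ∑ k ∈ Finset.range n, levelWeight r k * δ k y) := by
          refine Finset.sum_le_sum fun x _ => Finset.sum_le_sum fun y _ => ?_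
          refine mul_le_mul_of_nonneg_left ?_ (𝓖.μ_nonneg x y)
          -- Replacing Bob's measurement by Alice's costs 13 √√(d y), and rounding costs 840·3 =
          -- 2520 for each player; hence 2533 on the second question.
          have h1 := h.sum_level_effect_ge hτ (hc y) ht
            (F := fun b => ∑ a with 𝓖.V x y a b = true, E x a)
            (fun b => sum_filter_nonneg (hE0 x) _) (fun b => sum_filter_le (hE0 x) (hE1 x) _)
          rw [sum_sum_ite_conj]
          simp_rw [sum_sum_ite_conj]
          have h2 := hδle x
          have h3 := hδle y
          linarith
      _ = ∑ k ∈ Finset.range n, levelWeight r k * ∑ x, ∑ y, 𝓖.μ x y *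
            ((∑ a, ∑ b, if 𝓖.V x y a b = true then
              T.tr (levelProj n P k * E x a * levelProj n P k * E y b) else 0)
              - 840 * δ k x - 840 * δ k y) := by
          have e1 : ∀ k, levelWeight r k * ∑ x, ∑ y, 𝓖.μ x y *
            ((∑ a, ∑ b, if 𝓖.V x y a b = true then
              T.tr (levelProj n P k * E x a * levelProj n P k * E y b) else 0)
              - 840 * δ k x - 840 * δ k y) = ∑ x, ∑ y, levelWeight r k * (𝓖.μ x y *
            ((∑ a, ∑ b, if 𝓖.V x y a b = true then
              T.tr (levelProj n P k * E x a * levelProj n P k * E y b) else 0)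
              - 840 * δ k x - 840 * δ k y)) := fun k => by
            rw [Finset.mul_sum]
            refine Finset.sum_congr rfl fun x _ => Finset.mul_sum _ _ _
          simp_rw [e1]
          refine Eq.trans ?_ Finset.sum_comm
          refine Finset.sum_congr rfl fun x _ => ?_
          refine Eq.trans ?_ Finset.sum_comm
          refine Finset.sum_congr rfl fun y _ => ?_
          rw [Finset.mul_sum _ _ (840 : ℝ), Finset.mul_sum _ _ (840 : ℝ),
            ← Finset.sum_sub_distrib, ← Finset.sum_sub_distrib, Finset.mul_sum]
          refine Finset.sum_congr rfl fun k _ => ?_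
          ring
      _ ≤ ∑ k ∈ Finset.range n, levelWeight r k * (T.tr (levelProj n P k) * ω k) :=
          Finset.sum_le_sum fun k _ => mul_le_mul_of_nonneg_left (hwin k) (hw k)
      _ = t * ∑ k ∈ Finset.range n, (α k / t) • ω k := by
          rw [hmul]
          refine Finset.sum_congr rfl fun k _ => ?_
          simp only [hα]
          ring

end SynchronousSoundness

/-- G' is s⁻¹ G s⁻¹, a measurement of the support of s. Since s ≤ h this support lies under w* w, so
conjugating by w and then by w* loses nothing, and R is the conjugate of G' completed to a POVM. -/
theorem IsStaircase.exists_povm {N : Type*} [CStarAlgebra N] [PartialOrder N] [StarOrderedRing N]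
    {n : ℕ} {E : ℕ → N} {r : ℕ → ℝ} (hst : IsStaircase n E r) {h w : N}
    (hle : diagOp n E r ≤ h) (hq : IsStarProjection (star w * w)) (hqh : star w * w * h = h)
    (hh : 0 ≤ h) (hwq : w * (star w * w) = w) {B : Type*} [Fintype B] [Nonempty B] {G : B → N}
    (hG0 : ∀ b, 0 ≤ G b) (hG1 : ∑ b, G b = diagOp n E r * diagOp n E r) :
    ∃ G' R : B → N, (∀ b, 0 ≤ G' b) ∧ ∑ b, G' b ≤ 1 ∧
      (∀ b, diagOp n E r * G' b * diagOp n E r = G b) ∧ (∀ b, 0 ≤ R b) ∧ ∑ b, R b = 1 ∧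
      ∀ b, G' b ≤ star w * R b * w := by
  classical
  set s := diagOp n E r with hs
  -- The pseudo-inverse of s: the convention 0⁻¹ = 0 makes it vanish on the kernel, so s f is the
  -- support projection e.
  set f := diagOp n E fun i => (r i)⁻¹ with hf
  set e := diagOp n E fun i => r i * (r i)⁻¹ with he
  set q := star w * w with hqdef
  have hs0 : 0 ≤ s := hst.diagOp_nonneg hst.r_nonneg
  have hsf : s * f = e := hst.diagOp_mul _ _
  have hfs : f * s = e := by
    rw [hf, hs, hst.diagOp_mul, he]
    simp_rw [mul_comm]
  have hes : e * s = s := by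
    rw [he, hs, hst.diagOp_mul]
    simp_rw [mul_inv_mul_cancel]
  have hfe : f * e = f := by
    rw [he, hf, hst.diagOp_mul]
    congr 1
    ext i
    by_cases hi : r i = 0 <;> simp [hi]
  have hsstar : star s = s := hst.star_diagOp _
  have hfstar : star f = f := hst.star_diagOp _
  have hestar : star e = e := hst.star_diagOp _
  have hee : e * e = e := by
    nth_rw 2 [← hsf]
    rw [← mul_assoc, hes, hsf]
  have heproj : IsStarProjection e := ⟨hee, hestar⟩
  have hse : s * e = s := by
    have := congrArg star hes
    rwa [star_mul, hsstar, hestar] at this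
  have hef : e * f = f := by
    have := congrArg star hfe
    rwa [star_mul, hfstar, hestar] at this
  have hGle : ∀ b, G b ≤ s * s := fun b => by
    rw [← hG1]
    exact Finset.single_le_sum (fun b _ => hG0 b) (Finset.mem_univ b)
  have hGe : ∀ b, G b * e = G b := fun b => by
    have := mul_eq_zero_of_le (x := 1 - e) (hG0 b) (hGle b)
      (by rw [mul_assoc, mul_sub, hse, mul_one, sub_self, mul_zero])
    rw [mul_sub, mul_one, sub_eq_zero] at this
    exact this.symm
  have heG : ∀ b, e * G b = G b := fun b => by
    have := congrArg star (hGe b)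
    rwa [star_mul, (hG0 b).isSelfAdjoint.star_eq, hestar] at this
  have hhq : h * (1 - q) = 0 := by
    have := congrArg star hqh
    rw [star_mul, hh.isSelfAdjoint.star_eq, hq.isSelfAdjoint.star_eq] at this
    rw [mul_sub, this, mul_one, sub_self]
  have hsq : s * (1 - q) = 0 := mul_eq_zero_of_le hs0 hle hhq
  have hfq : f * q = f := by
    have : f * (1 - q) = 0 := by
      rw [← hfe, ← hfs, mul_assoc, mul_assoc, hsq, mul_zero, mul_zero]
    rw [mul_sub, mul_one, sub_eq_zero] at this
    exact this.symm
  have hqf : q * f = f := by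
    have := congrArg star hfq
    rwa [star_mul, hfstar, hq.isSelfAdjoint.star_eq] at this
  have hfsa : IsSelfAdjoint f := hfstar
  have hG' : ∀ b, 0 ≤ f * G b * f := fun b => hfsa.conjugate_nonneg (hG0 b)
  have hsumG' : ∑ b, f * G b * f = e := by
    rw [← Finset.sum_mul, ← Finset.mul_sum, hG1, ← mul_assoc, hfs, mul_assoc, hsf, hee]
  have hww : w * star w ≤ 1 := by
    have : IsStarProjection (w * star w) := by
      refine ⟨?_, ?_⟩
      · change w * star w * (w * star w) = w * star w
        rw [mul_assoc, ← mul_assoc (star w), ← mul_assoc, hwq]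
      · change star (w * star w) = _
        rw [star_mul, star_star]
    exact this.le_one'
  have hwe : w * e * star w ≤ 1 := by
    refine le_trans (star_right_conjugate_le_conjugate heproj.le_one' w) ?_
    rwa [mul_one]
  -- The missing mass 1 - w e w* is positive and goes to one outcome; this can only increase w* R w.
  let b₀ : B := Classical.arbitrary B
  refine ⟨fun b => f * G b * f,
    fun b => w * (f * G b * f) * star w + if b = b₀ then 1 - w * e * star w else 0,
    hG', hsumG'.trans_le heproj.le_one', fun b => ?_, fun b => ?_, ?_, fun b => ?_⟩
  · calc s * (f * G b * f) * s = (s * f) * G b * (f * s) := by simp only [mul_assoc]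
      _ = G b := by rw [hsf, hfs, heG, hGe]
  · refine add_nonneg (star_right_conjugate_nonneg (hG' b) w) ?_
    split_ifs
    exacts [sub_nonneg.2 hwe, le_rfl]
  · rw [Finset.sum_add_distrib, ← Finset.sum_mul, ← Finset.mul_sum, hsumG']
    simp
  · have h1 : star w * (w * (f * G b * f) * star w) * w = f * G b * f := by
      calc star w * (w * (f * G b * f) * star w) * w = (q * f) * G b * (f * q) := by
            simp only [hqdef, mul_assoc]
        _ = _ := by rw [hqf, hfq]
    rw [mul_add, add_mul, h1]
    refine le_add_of_nonneg_right (star_left_conjugate_nonneg ?_ w)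
    split_ifs
    exacts [sub_nonneg.2 hwe, le_rfl]

namespace SynchronousSoundness

variable {X A Y B : Type v} [Fintype X] [Fintype A] [Fintype Y] [Fintype B]
  {𝓖 : NonlocalGame X A} {ρ : X → Y → ℝ} {g : X → Y → A → Finset B} {κ : ℝ → ℝ} {c₀ : ℝ}

/-- The measurements obtained from the levels of a state `s` with finite spectrum, transported to
a state `h w*` with `s ≤ h`. -/
theorem transport [Nonempty A] (hS : SynchronousSoundness.{u, v} 𝓖 ρ g κ c₀)
    (hρ : ∀ x y, 0 ≤ ρ x y) (hκ : ConvexOn ℝ (Set.Icc 0 1) κ) (hc₀ : 0 ≤ c₀) {H : Type u}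
    [NormedAddCommGroup H] [InnerProductSpace ℂ H] [CompleteSpace H] (T : TracialStandardForm H)
    {E F : X → A → T.M} {n : ℕ} {P : ℕ → T.M} {r : ℕ → ℝ} (hst : IsStaircase n P r)
    {d : X → ℝ} (hc : ∀ x, IsCorrelatedPair T.tr (diagOp n P r) (E x) (F x) (d x))
    (ht : T.tr (diagOp n P r * diagOp n P r) ≤ 1)
    (ht0 : 0 < T.tr (diagOp n P r * diagOp n P r)) {h w : T.M}
    (hle : diagOp n P r ≤ h) (hq : IsStarProjection (star w * w)) (hqh : star w * w * h = h)
    (hh : 0 ≤ h) (hwq : w * (star w * w) = w) :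
    ∃ (ω : ℝ) (G R : Y → B → T.M), ω ∈ Set.Icc (0 : ℝ) 1 ∧
      (∀ y b, 0 ≤ G y b) ∧ (∀ y, ∑ b, G y b ≤ 1) ∧
      (∀ y b, 0 ≤ R y b) ∧ (∀ y, ∑ b, R y b = 1) ∧
      (∀ x y a, T.tr (h * E x a * h * ∑ b ∈ g x y a, G y b)
        ≤ T.tr (h * E x a * h * (star w * (∑ b ∈ g x y a, R y b) * w))) ∧
      T.tr (diagOp n P r * diagOp n P r) * (c₀ * κ ω) ≤
        ∑ x, ∑ y, ρ x y * (∑ a, T.tr (diagOp n P r * E x a * diagOp n P r *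
          ∑ b ∈ g x y a, G y b) + 2520 * √√(d x)) ∧
      ∑ x, ∑ y, 𝓖.μ x y *
        (∑ a, ∑ b, (if 𝓖.V x y a b = true then
            T.tr (diagOp n P r * E x a * diagOp n P r * F y b) else 0)
          - 2520 * √√(d x) - 2533 * √√(d y))
        ≤ T.tr (diagOp n P r * diagOp n P r) * ω := by
  have hτ := T.isTracialState_tr
  obtain ⟨ω, G, hω, hG0, hG1, hle', hwin⟩ := hS.staircase hρ hκ hc₀ T hst hc ht ht0
  -- The operators G_b sum to s², which has positive trace, so the outcome set cannot be empty once
  -- there is a question y.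
  have hB : ∀ _ : Y, Nonempty B := fun y => by
    by_contra hB
    rw [not_nonempty_iff] at hB
    have := hG1 y
    rw [Finset.univ_eq_empty, Finset.sum_empty] at this
    rw [← this, map_zero] at ht0
    exact lt_irrefl _ ht0
  choose G' R h1 h2 h3 h4 h5 h6 using fun y =>
    have := hB y
    hst.exists_povm hle hq hqh hh hwq (hG0 y) (hG1 y)
  refine ⟨ω, G', R, hω, h1, h2, h4, h5, fun x y a => ?_, hle'.trans_eq ?_, hwin⟩
  · rw [hτ.mul_comm, hτ.mul_comm _ (star w * _ * w)]
    refine hτ.mul_le_mul_right ?_ (hh.isSelfAdjoint.conjugate_nonneg ((hc x).nonneg_left a))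
    rw [Finset.mul_sum, Finset.sum_mul]
    exact Finset.sum_le_sum fun b _ => h6 y b
  · refine Finset.sum_congr rfl fun x _ => Finset.sum_congr rfl fun y _ => ?_
    refine congrArg (fun z => ρ x y * (z + _)) (Finset.sum_congr rfl fun a _ => ?_)
    have : ∑ b ∈ g x y a, G y b
        = diagOp n P r * (∑ b ∈ g x y a, G' y b) * diagOp n P r := by
      rw [Finset.mul_sum, Finset.sum_mul]
      exact Finset.sum_congr rfl fun b _ => (h3 y b).symm
    rw [this, mul_assoc (_ * E x a), hτ.mul_comm, hτ.mul_comm (_ * E x a)]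
    rw [mul_assoc, mul_assoc]

end SynchronousSoundness

/-! ### Perfect agreement -/

section Exact

variable {N : Type*} [CStarAlgebra N] [PartialOrder N] [StarOrderedRing N]
  {τ : N →ₗ[ℝ] ℝ}

/-- The trace is that of |a h b|² with a and b the square roots of A and B, so faithfulness gives a
h b = 0. -/
theorem IsTracialState.mul_mul_eq_zero (hτ : IsTracialState τ)
    (hf : ∀ x, τ (Star.star x * x) = 0 → x = 0) {h A B : N} (hh : 0 ≤ h) (hA : 0 ≤ A) (hB : 0 ≤ B)
    (h0 : τ (h * A * h * B) = 0) : A * h * B = 0 := by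
  set a := CFC.sqrt A with ha
  set b := CFC.sqrt B with hb
  have ha2 : a * a = A := CFC.sqrt_mul_sqrt_self A hA
  have hb2 : b * b = B := CFC.sqrt_mul_sqrt_self B hB
  have has : Star.star a = a := (CFC.sqrt_nonneg A).isSelfAdjoint.star_eq
  have hbs : Star.star b = b := (CFC.sqrt_nonneg B).isSelfAdjoint.star_eq
  have hz : a * h * b = 0 := hf _ <| by
    rw [star_mul, star_mul, has, hbs, hh.isSelfAdjoint.star_eq, ← h0, ← ha2, ← hb2,
      ← mul_assoc (h * (a * a) * h), hτ.mul_comm _ b]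
    simp only [mul_assoc]
  calc A * h * B = a * (a * h * b) * b := by
        rw [← ha2, ← hb2]
        simp only [mul_assoc]
    _ = 0 := by rw [hz, mul_zero, zero_mul]

theorem commute_of_commute_mul_self {h A : N} (hh : 0 ≤ h) (hc : Commute (h * h) A) :
    Commute h A := by
  have : Commute (CFC.sqrt (h * h)) A := by
    rw [CFC.sqrt_eq_cfc]
    exact hc.cfc_nnreal _
  rwa [CFC.sqrt_mul_self h hh] at this

namespace IsCorrelatedPair

variable {ι : Type*} [Fintype ι] {h : N} {A B : ι → N}

theorem mul_eq_mul (hτ : IsTracialState τ) (hf : ∀ x, τ (star x * x) = 0 → x = 0) (hh : 0 ≤ h)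
    (hc : IsCorrelatedPair τ h A B 0) (i : ι) : A i * h = h * B i := by
  have h1 := hc.diff_le hτ hh
  rw [mul_zero] at h1
  have h2 := (Finset.sum_eq_zero_iff_of_nonneg fun i _ => hτ.star_mul_self_nonneg _).1
    (le_antisymm h1 (Finset.sum_nonneg fun i _ => hτ.star_mul_self_nonneg _)) i (Finset.mem_univ i)
  exact sub_eq_zero.1 (hf _ h2)

/-- A h = h B and its adjoint h A = B h give h² A = h B h = A h², and h is the square root of h². -/
theorem commute (hτ : IsTracialState τ) (hf : ∀ x, τ (star x * x) = 0 → x = 0) (hh : 0 ≤ h)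
    (hc : IsCorrelatedPair τ h A B 0) (i : ι) : Commute h (A i) := by
  have h1 := hc.mul_eq_mul hτ hf hh i
  have h2 := congrArg star h1
  rw [star_mul, star_mul, hc.star_left, hc.star_right, hh.isSelfAdjoint.star_eq] at h2
  refine commute_of_commute_mul_self hh ?_
  change h * h * A i = A i * (h * h)
  rw [mul_assoc, h2, ← mul_assoc, ← h1, mul_assoc]

theorem mul_defect (hτ : IsTracialState τ) (hf : ∀ x, τ (star x * x) = 0 → x = 0) (hh : 0 ≤ h)
    (hc : IsCorrelatedPair τ h A B 0) (i : ι) : h * (A i - A i * A i) = 0 := by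
  have h1 := hc.sum_left_defect_le hτ hh
  rw [mul_zero] at h1
  have hnn : ∀ i, 0 ≤ τ (h * h * (A i - A i * A i)) := fun i =>
    hτ.mul_nonneg (IsCorrelatedPair.mul_self_nonneg' hh) (hc.left_defect i)
  have h2 := (Finset.sum_eq_zero_iff_of_nonneg fun i _ => hnn i).1
    (le_antisymm h1 (Finset.sum_nonneg fun i _ => hnn i)) i (Finset.mem_univ i)
  set D := A i - A i * A i with hD
  have h3 := hτ.mul_mul_eq_zero hf (A := D) (B := 1) hh (hc.left_defect i) zero_le_one
    (by rw [mul_one, hτ.mul_comm, ← mul_assoc, h2])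
  rw [mul_one] at h3
  have h4 := congrArg star h3
  rwa [star_mul, hh.isSelfAdjoint.star_eq, (hc.left_defect i).isSelfAdjoint.star_eq,
    star_zero] at h4

/-- Perfect agreement passes to smaller states that commute with Alice's measurement. -/
theorem sum_eq_of_le (hτ : IsTracialState τ) (hf : ∀ x, τ (star x * x) = 0 → x = 0) (hh : 0 ≤ h)
    (hc : IsCorrelatedPair τ h A B 0) {s : N} (hs : 0 ≤ s) (hsh : s ≤ h)
    (hcomm : ∀ i, Commute s (A i)) : ∑ i, τ (s * A i * s * B i) = τ (s * s) := by
  have h1 : ∀ i, τ (s * A i * s * B i) = τ (s * s * A i) := fun i => by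
    have e1 : s * (A i - B i) = 0 := mul_eq_zero_of_le hs hsh <| by
      rw [mul_sub, (hc.commute hτ hf hh i).eq, hc.mul_eq_mul hτ hf hh, sub_self]
    have e2 : s * (A i - A i * A i) = 0 :=
      mul_eq_zero_of_le hs hsh (hc.mul_defect hτ hf hh i)
    rw [mul_sub, sub_eq_zero] at e1 e2
    rw [(hcomm i).eq, mul_assoc, ← e1, mul_assoc (A i), hτ.mul_comm, mul_assoc, mul_assoc s (A i),
      ← e2, ← mul_assoc]
  simp_rw [h1]
  rw [← map_sum, ← Finset.mul_sum, hc.sum_left, mul_one]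

/-- A losing pair of answers stays impossible for a smaller commuting state: h kills A b, hence so
does any positive s ≤ h. -/
theorem eq_zero_of_le (hτ : IsTracialState τ) (hf : ∀ x, τ (star x * x) = 0 → x = 0) (hh : 0 ≤ h)
    (hc : IsCorrelatedPair τ h A B 0) {s : N} (hs : 0 ≤ s) (hsh : s ≤ h) {i : ι}
    (hcomm : Commute s (A i)) {b : N} (hb : 0 ≤ b) (h0 : τ (h * A i * h * b) = 0) :
    τ (s * A i * s * b) = 0 := by
  have h1 := hτ.mul_mul_eq_zero hf hh (hc.nonneg_left i) hb h0
  rw [← (hc.commute hτ hf hh i).eq, mul_assoc] at h1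
  have h2 : s * (A i * b) = 0 := mul_eq_zero_of_le hs hsh h1
  rw [mul_assoc s, ← hcomm.eq, mul_assoc, mul_assoc, h2, mul_zero, map_zero]

end IsCorrelatedPair

end Exact

/-! ### From staircases to a general positive state -/

theorem TracialStandardForm.faithful {H : Type*} [NormedAddCommGroup H] [InnerProductSpace ℂ H]
    [CompleteSpace H] (T : TracialStandardForm H) (x : T.M) (hx : T.tr (star x * x) = 0) :
    x = 0 := by
  have h1 := ContinuousLinearMap.re_inner_star_mul_self (x : H →L[ℂ] H) T.Ω
  have h2 : T.tr (star x * x) = ‖(x : H →L[ℂ] H) T.Ω‖ ^ 2 := h1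
  rw [hx] at h2
  have h3 : (x : H →L[ℂ] H) T.Ω = 0 := by
    rw [← norm_eq_zero]
    exact pow_eq_zero_iff two_ne_zero |>.1 h2.symm
  exact Subtype.ext (T.separating x x.2 h3)

theorem TracialStandardForm.abs_tr_le {H : Type*} [NormedAddCommGroup H] [InnerProductSpace ℂ H]
    [CompleteSpace H] (T : TracialStandardForm H) (x : T.M) : |T.tr x| ≤ ‖x‖ := by
  refine (RCLike.abs_re_le_norm ⟪T.Ω, (x : H →L[ℂ] H) T.Ω⟫_ℂ).trans ((norm_inner_le_norm _ _).trans ?_)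
  rw [T.norm_Ω, one_mul]
  refine ((x : H →L[ℂ] H).le_opNorm _).trans ?_
  rw [T.norm_Ω, mul_one]
  exact le_of_eq rfl

theorem TracialStandardForm.continuous_tr {H : Type*} [NormedAddCommGroup H]
    [InnerProductSpace ℂ H] [CompleteSpace H] (T : TracialStandardForm H) : Continuous T.tr :=
  AddMonoidHomClass.continuous_of_bound T.tr 1 fun x => by
    rw [one_mul]
    exact T.abs_tr_le x

theorem norm_sub_le_of_le_of_le {N : Type*} [CStarAlgebra N] [PartialOrder N] [StarOrderedRing N]
    {s h : N} {η : ℝ} (hη : 0 ≤ η) (h1 : s ≤ h) (h2 : h ≤ s + η • (1 : N)) : ‖h - s‖ ≤ η := by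
  rw [CStarAlgebra.norm_le_iff_le_algebraMap _ hη (sub_nonneg.2 h1), Algebra.algebraMap_eq_smul_one]
  exact sub_le_iff_le_add'.2 h2

theorem commute_diagOp {N : Type*} [CStarAlgebra N] {n : ℕ} {P : ℕ → N} {z : N}
    (hz : ∀ i, Commute (P i) z) (f : ℕ → ℝ) : Commute (diagOp n P f) z :=
  Commute.sum_left _ _ _ fun i _ => (hz i).smul_left (f i)

theorem sum_sum_joint {N : Type*} [CStarAlgebra N] {τ : N →ₗ[ℝ] ℝ} {A : Type*} [Fintype A]
    {E F : A → N} {s q : N} (hE : ∑ a, E a = 1) (hF : ∑ a, F a = q) (hs : s * q = s) :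
    ∑ a, ∑ b, τ (s * E a * s * F b) = τ (s * s) := by
  simp_rw [← map_sum, ← Finset.mul_sum, hF, mul_assoc, hs]
  rw [← Finset.mul_sum, ← Finset.sum_mul, hE, one_mul]

/-- A monotone convex function on `[0, 1]` is left-continuous in the interior. -/
theorem ConvexOn.exists_lt_of_mem_Ioo {κ : ℝ → ℝ} (hκ : ConvexOn ℝ (Set.Icc 0 1) κ) {m : ℝ}
    (hm0 : 0 < m) (hm1 : m < 1) {ε : ℝ} (hε : 0 < ε) : ∃ m' ∈ Set.Ico 0 m, κ m - ε ≤ κ m' := by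
  have hcont : ContinuousOn κ (Set.Ioo 0 1) := by
    have := hκ.continuousOn_interior
    rwa [interior_Icc] at this
  have hc : ContinuousAt κ m := hcont.continuousAt (Ioo_mem_nhds hm0 hm1)
  obtain ⟨η, hη, h⟩ := Metric.continuousAt_iff.1 hc ε hε
  have hmax : max 0 (m - η / 2) < m := max_lt hm0 (by linarith)
  refine ⟨max 0 (m - η / 2), ⟨le_max_left _ _, hmax⟩, ?_⟩
  have h1 := h (x := max 0 (m - η / 2)) (by
    rw [Real.dist_eq, abs_sub_comm, abs_of_pos (by linarith)]
    have := le_max_right 0 (m - η / 2)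
    linarith)
  rw [Real.dist_eq, abs_lt] at h1
  linarith [h1.1]

namespace SynchronousSoundness

variable {X A Y B : Type v} [Fintype X] [Fintype A] [Fintype Y] [Fintype B]
  {𝓖 : NonlocalGame X A} {ρ : X → Y → ℝ} {g : X → Y → A → Finset B} {κ : ℝ → ℝ} {c₀ : ℝ}

/-- Soundness up to `ε` for a strategy with state `h w*`. -/
theorem exists_approx [Nonempty A] (hS : SynchronousSoundness.{u, v} 𝓖 ρ g κ c₀)
    (hρ : ∀ x y, 0 ≤ ρ x y) (hρ1 : ∑ x, ∑ y, ρ x y = 1) (hκ : ConvexOn ℝ (Set.Icc 0 1) κ)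
    (hmono : MonotoneOn κ (Set.Icc 0 1)) (hc₀ : 0 < c₀) {H : Type u}
    [NormedAddCommGroup H] [InnerProductSpace ℂ H] [CompleteSpace H] (T : TracialStandardForm H)
    {E F : X → A → T.M} (hE0 : ∀ x a, 0 ≤ E x a) (hE1 : ∀ x, ∑ a, E x a = 1)
    {h w : T.M} (hF0 : ∀ x a, 0 ≤ F x a) (hF1 : ∀ x, ∑ a, F x a = star w * w)
    (hq : IsStarProjection (star w * w)) (hqh : star w * w * h = h)
    (hh : 0 ≤ h) (hwq : w * (star w * w) = w) (hh1 : T.tr (h * h) = 1)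
    {d : X → ℝ} (hd : ∀ x, d x = 1 - ∑ a, T.tr (h * E x a * h * F x a)) {m : ℝ}
    (hm : m ∈ Set.Icc (0 : ℝ) 1)
    (hcase : m = 0 ∨ (m < 1 ∧ m ≤ ∑ x, ∑ y, 𝓖.μ x y *
        (∑ a, ∑ b, (if 𝓖.V x y a b = true then T.tr (h * E x a * h * F y b) else 0)
          - 2520 * √√(d x) - 2533 * √√(d y))) ∨
      ∀ x y, 𝓖.μ x y ≠ 0 → d x = 0 ∧ d y = 0 ∧
        ∀ a b, 𝓖.V x y a b ≠ true → T.tr (h * E x a * h * F y b) = 0)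
    {ε : ℝ} (hε : 0 < ε) :
    ∃ R : Y → B → T.M, (∀ y b, 0 ≤ R y b) ∧ (∀ y, ∑ b, R y b = 1) ∧
      c₀ * κ m - 2520 * ∑ x, ∑ y, ρ x y * √√(d x) - ε ≤ ∑ x, ∑ y, ρ x y *
        ∑ a, T.tr (h * E x a * h * (star w * (∑ b ∈ g x y a, R y b) * w)) := by
  have hτ := T.isTracialState_tr
  have hηpos : ∀ k : ℕ, (0 : ℝ) < 1 / ((k : ℝ) + 1) := fun k => Nat.one_div_pos_of_nat
  choose n P hst hle hge hcomm using fun k : ℕ =>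
    exists_staircase T.M.douglas hh (hηpos k)
  set s : ℕ → T.M := fun k => diagOp (n k) (P k) fun j => j * (1 / ((k : ℝ) + 1)) with hs
  have hs0 : ∀ k, 0 ≤ s k := fun k => (hst k).diagOp_nonneg (hst k).r_nonneg
  have hnorm : ∀ k, ‖h - s k‖ ≤ 1 / ((k : ℝ) + 1) := fun k =>
    norm_sub_le_of_le_of_le (hηpos k).le (hle k) (hge k)
  have hη0 : Filter.Tendsto (fun k : ℕ => 1 / ((k : ℝ) + 1)) Filter.atTop (nhds 0) :=
    tendsto_one_div_add_atTop_nhds_zero_nat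
  have hslim : Filter.Tendsto s Filter.atTop (nhds h) := by
    rw [tendsto_iff_norm_sub_tendsto_zero]
    refine squeeze_zero (fun _ => norm_nonneg _) (fun k => ?_) hη0
    rw [norm_sub_rev]
    exact hnorm k
  have hct := T.continuous_tr
  set t : ℕ → ℝ := fun k => T.tr (s k * s k) with ht
  have htlim : Filter.Tendsto t Filter.atTop (nhds 1) := by
    rw [← hh1]
    exact (hct.tendsto _).comp (hslim.mul hslim)
  have htle : ∀ k, t k ≤ 1 := fun k => by
    rw [← hh1]
    refine hτ.sq_le_sq (hle k) ?_
    exact (neg_nonpos.2 hh).trans (hs0 k)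
  have hjoint : ∀ x y a b, Filter.Tendsto (fun k => T.tr (s k * E x a * s k * F y b))
      Filter.atTop (nhds (T.tr (h * E x a * h * F y b))) := fun x y a b =>
    (hct.tendsto _).comp (((hslim.mul_const _).mul hslim).mul_const _)
  set D : ℕ → X → ℝ := fun k x => t k - ∑ a, T.tr (s k * E x a * s k * F x a) with hD
  have hDlim : ∀ x, Filter.Tendsto (fun k => D k x) Filter.atTop (nhds (d x)) := fun x => by
    rw [hd]
    exact htlim.sub (tendsto_finsetSum _ fun a _ => hjoint x x a a)
  have hsqrt : ∀ x, Filter.Tendsto (fun k => √√(D k x)) Filter.atTop (nhds √√(d x)) := fun x =>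
    (Real.continuous_sqrt.tendsto _).comp ((Real.continuous_sqrt.tendsto _).comp (hDlim x))
  have hpair : ∀ k x, IsCorrelatedPair T.tr (s k) (E x) (F x) (D k x) := fun k x =>
    ⟨hE0 x, hE1 x, hF0 x, (hF1 x).trans_le hq.le_one', by simp only [hD, ht]; ring⟩
  set W : ℕ → ℝ := fun k => ∑ x, ∑ y, 𝓖.μ x y *
        (∑ a, ∑ b, (if 𝓖.V x y a b = true then T.tr (s k * E x a * s k * F y b) else 0)
          - 2520 * √√(D k x) - 2533 * √√(D k y)) with hW
  -- Half of ε pays for the loss in κ; the other half gives the strict inequality that absorbs the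
  -- errors tending to 0.
  set ε' := ε / (2 * c₀) with hε'
  have hε'0 : 0 < ε' := by positivity
  have hwin : ∀ᶠ k in Filter.atTop, ∀ ω ∈ Set.Icc (0 : ℝ) 1, W k ≤ t k * ω →
      κ m - ε' ≤ κ ω := by
    -- At level 0 monotonicity suffices. Inside (0,1) κ is left-continuous, and the winning values
    -- of the staircases converge. The last case covers level 1, where κ may jump and an approximate
    -- winning probability would not do.
    rcases hcase with h0 | ⟨hm1, hmW⟩ | hex
    · refine Filter.Eventually.of_forall fun k ω hω _ => ?_
      have := hmono hm hω (by rw [h0]; exact hω.1)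
      linarith
    · rcases hm.1.eq_or_lt with h0 | h0
      · refine Filter.Eventually.of_forall fun k ω hω _ => ?_
        have := hmono hm hω (by rw [← h0]; exact hω.1)
        linarith
      obtain ⟨m', hm', hκm'⟩ := hκ.exists_lt_of_mem_Ioo h0 hm1 hε'0
      have hWlim : Filter.Tendsto W Filter.atTop (nhds (∑ x, ∑ y, 𝓖.μ x y *
          (∑ a, ∑ b, (if 𝓖.V x y a b = true then T.tr (h * E x a * h * F y b) else 0)
            - 2520 * √√(d x) - 2533 * √√(d y)))) := by
        refine tendsto_finsetSum _ fun x _ => tendsto_finsetSum _ fun y _ => ?_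
        refine Filter.Tendsto.const_mul _ ?_
        refine Filter.Tendsto.sub (Filter.Tendsto.sub ?_ ((hsqrt x).const_mul _))
          ((hsqrt y).const_mul _)
        refine tendsto_finsetSum _ fun a _ => tendsto_finsetSum _ fun b _ => ?_
        split_ifs
        exacts [hjoint x y a b, tendsto_const_nhds]
      filter_upwards [hWlim.eventually (lt_mem_nhds (hm'.2.trans_le hmW))] with k hk ω hω hWω
      refine hκm'.trans (hmono ⟨hm'.1, by linarith [hm'.2]⟩ hω ?_)
      have := mul_le_of_le_one_left hω.1 (htle k)
      linarith
    -- The spectral steps of h commute with whatever commutes with h, so for positive-weight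
    -- questions each staircase inherits exact agreement and every impossible losing pair. Its value
    -- is then all of t_k, which forces ω ≥ 1 once t_k > 0.
    · have htot : ∀ k x y, ∑ a, ∑ b, T.tr (s k * E x a * s k * F y b) = t k := fun k x y => by
        refine sum_sum_joint (hE1 x) (hF1 y) ?_
        have h1 : h * (1 - star w * w) = 0 := by
          have := congrArg star hqh
          rw [star_mul, hh.isSelfAdjoint.star_eq, hq.isSelfAdjoint.star_eq] at this
          rw [mul_sub, this, mul_one, sub_self]
        have h2 := mul_eq_zero_of_le (hs0 k) (hle k) h1
        rw [mul_sub, mul_one, sub_eq_zero] at h2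
        exact h2.symm
      have hpair0 : ∀ x, d x = 0 → IsCorrelatedPair T.tr h (E x) (F x) 0 := fun x hx =>
        ⟨hE0 x, hE1 x, hF0 x, (hF1 x).trans_le hq.le_one', by
          have := hd x
          rw [hx] at this
          rw [hh1]
          linarith⟩
      have hsE : ∀ k x, d x = 0 → ∀ a, Commute (s k) (E x a) := fun k x hx a =>
        commute_diagOp (hcomm k _ (hE0 x a).isSelfAdjoint
          ((hpair0 x hx).commute hτ T.faithful hh a)) _
      have hD0 : ∀ k x, d x = 0 → D k x = 0 := fun k x hx => by
        have := (hpair0 x hx).sum_eq_of_le hτ T.faithful hh (hs0 k) (hle k) (hsE k x hx)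
        simp only [hD, ht]
        rw [this, sub_self]
      have hWt : ∀ k, W k = t k := fun k => by
        have : ∀ x y, 𝓖.μ x y *
            (∑ a, ∑ b, (if 𝓖.V x y a b = true then T.tr (s k * E x a * s k * F y b) else 0)
              - 2520 * √√(D k x) - 2533 * √√(D k y)) = 𝓖.μ x y * t k := fun x y => by
          by_cases hμ : 𝓖.μ x y = 0
          · rw [hμ, zero_mul, zero_mul]
          obtain ⟨hx, hy, hV⟩ := hex x y hμ
          rw [hD0 k x hx, hD0 k y hy, Real.sqrt_zero, Real.sqrt_zero, mul_zero, mul_zero,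
            sub_zero, sub_zero, ← htot k x y]
          congr 1
          refine Finset.sum_congr rfl fun a _ => Finset.sum_congr rfl fun b _ => ?_
          split_ifs with hVab
          · rfl
          · exact ((hpair0 x hx).eq_zero_of_le hτ T.faithful hh (hs0 k) (hle k)
              (hsE k x hx a) (hF0 y b) (hV a b hVab)).symm
        simp only [hW, this]
        simp_rw [← Finset.sum_mul]
        rw [𝓖.μ_sum, one_mul]
      filter_upwards [htlim.eventually (lt_mem_nhds zero_lt_one)] with k hk ω hω hWω
      rw [hWt] at hWω
      have h1 : 1 ≤ ω := by
        by_contra hlt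
        push Not at hlt
        nlinarith
      have := hmono hm hω (hm.2.trans h1)
      linarith
  have hlim : Filter.Tendsto (fun k : ℕ => t k * (c₀ * (κ m - ε'))
      - 2520 * ∑ x, ∑ y, ρ x y * √√(D k x)
      - Fintype.card A * (2 * (1 / ((k : ℝ) + 1)) * ‖h‖)) Filter.atTop
      (nhds (1 * (c₀ * (κ m - ε')) - 2520 * ∑ x, ∑ y, ρ x y * √√(d x)
        - Fintype.card A * (2 * 0 * ‖h‖))) := by
    refine ((htlim.mul_const _).sub (Filter.Tendsto.const_mul _ ?_)).sub
      (((hη0.const_mul _).mul_const _).const_mul _)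
    exact tendsto_finsetSum _ fun x _ => tendsto_finsetSum _ fun y _ => (hsqrt x).const_mul _
  have hlt : c₀ * κ m - 2520 * ∑ x, ∑ y, ρ x y * √√(d x) - ε <
      1 * (c₀ * (κ m - ε')) - 2520 * ∑ x, ∑ y, ρ x y * √√(d x)
        - Fintype.card A * (2 * 0 * ‖h‖) := by
    have : c₀ * ε' = ε / 2 := by
      rw [hε']
      field_simp
    rw [mul_zero, zero_mul, mul_zero, sub_zero, one_mul, mul_sub, this]
    linarith
  obtain ⟨k, hk1, hk2, hk3⟩ := ((hlim.eventually (lt_mem_nhds hlt)).and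
    (hwin.and (htlim.eventually (lt_mem_nhds zero_lt_one)))).exists
  obtain ⟨ω, G, R, hω, hG0, hG1, hR0, hR1, hGR, hsound, hWω⟩ :=
    hS.transport hρ hκ hc₀.le T (hst k) (hpair k) (htle k) hk3 (hle k) hq hqh hh hwq
  refine ⟨R, hR0, hR1, hk1.le.trans ?_⟩
  have hκω := hk2 ω hω hWω
  -- Replacing s by h costs 2 ‖h - s‖ ‖h‖ for each answer. The number of answers enters only this
  -- error, which vanishes in the limit and does not affect the constants.
  have hclose : ∀ x y a, T.tr (s k * E x a * s k * ∑ b ∈ g x y a, G y b)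
      ≤ T.tr (h * E x a * h * ∑ b ∈ g x y a, G y b) + 2 * (1 / ((k : ℝ) + 1)) * ‖h‖ :=
    fun x y a => by
      set Z := ∑ b ∈ g x y a, G y b with hZ
      have hZ1 : ‖Z‖ ≤ 1 := by
        refine (CStarAlgebra.norm_le_one_iff_of_nonneg Z (sum_filter_nonneg (hG0 y) _)).2 ?_
        exact (Finset.sum_le_sum_of_subset_of_nonneg (Finset.subset_univ _)
          fun b _ _ => hG0 y b).trans (hG1 y)
      have hE : ‖E x a‖ ≤ 1 :=
        (CStarAlgebra.norm_le_one_iff_of_nonneg _ (hE0 x a)).2 ((hpair k x).left_le a)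
      have hsn : ‖s k‖ ≤ ‖h‖ := CStarAlgebra.norm_le_norm_of_nonneg_of_le (hs0 k) (hle k)
      have hid : s k * E x a * s k * Z - h * E x a * h * Z
          = -((h - s k) * E x a * h * Z + s k * E x a * (h - s k) * Z) := by noncomm_ring
      have h1 : ‖(h - s k) * E x a * h * Z‖ ≤ 1 / ((k : ℝ) + 1) * 1 * ‖h‖ * 1 :=
        (norm_mul_le _ _).trans (mul_le_mul ((norm_mul_le _ _).trans (mul_le_mul
          ((norm_mul_le _ _).trans (mul_le_mul (hnorm k) hE (norm_nonneg _) (hηpos k).le)) le_rfl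
          (norm_nonneg _) (by have := (hηpos k).le; positivity))) hZ1 (norm_nonneg _)
          (by have := (hηpos k).le; positivity))
      have h2 : ‖s k * E x a * (h - s k) * Z‖ ≤ ‖h‖ * 1 * (1 / ((k : ℝ) + 1)) * 1 :=
        (norm_mul_le _ _).trans (mul_le_mul ((norm_mul_le _ _).trans (mul_le_mul
          ((norm_mul_le _ _).trans (mul_le_mul hsn hE (norm_nonneg _) (norm_nonneg _))) (hnorm k)
          (norm_nonneg _) (by positivity))) hZ1 (norm_nonneg _)
          (by have := (hηpos k).le; positivity))
      have h3 := (abs_le.1 ((T.abs_tr_le ((h - s k) * E x a * h * Z +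
        s k * E x a * (h - s k) * Z)).trans (norm_add_le _ _))).1
      have h4 := congrArg T.tr hid
      rw [map_sub, map_neg] at h4
      linarith
  calc t k * (c₀ * (κ m - ε')) - 2520 * ∑ x, ∑ y, ρ x y * √√(D k x)
      - Fintype.card A * (2 * (1 / ((k : ℝ) + 1)) * ‖h‖)
      ≤ t k * (c₀ * κ ω) - 2520 * ∑ x, ∑ y, ρ x y * √√(D k x)
      - Fintype.card A * (2 * (1 / ((k : ℝ) + 1)) * ‖h‖) := by gcongr
    _ ≤ ∑ x, ∑ y, ρ x y * (∑ a, T.tr (s k * E x a * s k * ∑ b ∈ g x y a, G y b)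
          + 2520 * √√(D k x)) - 2520 * ∑ x, ∑ y, ρ x y * √√(D k x)
          - Fintype.card A * (2 * (1 / ((k : ℝ) + 1)) * ‖h‖) := by gcongr
    _ = ∑ x, ∑ y, ρ x y * (∑ a, T.tr (s k * E x a * s k * ∑ b ∈ g x y a, G y b)
          - Fintype.card A * (2 * (1 / ((k : ℝ) + 1)) * ‖h‖)) := by
        have : ∀ c : ℝ, c = ∑ x, ∑ y, ρ x y * c := fun c => by
          simp_rw [← Finset.sum_mul]
          rw [hρ1, one_mul]
        conv_lhs => rw [this (Fintype.card A * (2 * (1 / ((k : ℝ) + 1)) * ‖h‖))]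
        rw [Finset.mul_sum, ← Finset.sum_sub_distrib, ← Finset.sum_sub_distrib]
        refine Finset.sum_congr rfl fun x _ => ?_
        rw [Finset.mul_sum, ← Finset.sum_sub_distrib, ← Finset.sum_sub_distrib]
        refine Finset.sum_congr rfl fun y _ => ?_
        ring
    _ ≤ _ := by
        refine Finset.sum_le_sum fun x _ => Finset.sum_le_sum fun y _ => ?_
        refine mul_le_mul_of_nonneg_left ?_ (hρ x y)
        rw [sub_le_iff_le_add]
        have : (Fintype.card A : ℝ) * (2 * (1 / ((k : ℝ) + 1)) * ‖h‖)
            = ∑ _a : A, 2 * (1 / ((k : ℝ) + 1)) * ‖h‖ := by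
          rw [Finset.sum_const, Finset.card_univ, nsmul_eq_mul]
        rw [this, ← Finset.sum_add_distrib]
        refine Finset.sum_le_sum fun a _ => (hclose x y a).trans ?_
        gcongr
        exact hGR x y a

end SynchronousSoundness

/-! ### Weak compactness of measurements -/

section WeakLimit

variable {H : Type*} [NormedAddCommGroup H] [InnerProductSpace ℂ H] [CompleteSpace H]

/-- A bounded sequence of operators converges weakly along an ultrafilter. -/
theorem exists_weak_limit (l : Ultrafilter ℕ) {G : ℕ → H →L[ℂ] H} {c : ℝ}
    (hG : ∀ n, ‖G n‖ ≤ c) :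
    ∃ R : H →L[ℂ] H, ∀ ξ ζ, Filter.Tendsto (fun n => ⟪ξ, G n ζ⟫_ℂ) l (nhds ⟪ξ, R ζ⟫_ℂ) := by
  have hbd : ∀ ξ ζ n, ‖⟪ξ, G n ζ⟫_ℂ‖ ≤ c * ‖ξ‖ * ‖ζ‖ := fun ξ ζ n => by
    refine (norm_inner_le_norm _ _).trans ?_
    calc ‖ξ‖ * ‖G n ζ‖ ≤ ‖ξ‖ * (c * ‖ζ‖) := by
          gcongr
          exact (G n).le_of_opNorm_le (hG n) ζ
      _ = c * ‖ξ‖ * ‖ζ‖ := by ring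
  have hex : ∀ ξ ζ, ∃ z : ℂ, ‖z‖ ≤ c * ‖ξ‖ * ‖ζ‖ ∧
      Filter.Tendsto (fun n => ⟪ξ, G n ζ⟫_ℂ) l (nhds z) := fun ξ ζ => by
    obtain ⟨z, hz, hlim⟩ := (isCompact_closedBall (0 : ℂ) (c * ‖ξ‖ * ‖ζ‖)).ultrafilter_le_nhds
      (l.map fun n => ⟪ξ, G n ζ⟫_ℂ) (by
        rw [Filter.le_principal_iff]
        refine Filter.mem_map.2 (Filter.univ_mem' fun n => ?_)
        simpa using hbd ξ ζ n)
    exact ⟨z, by simpa using hz, hlim⟩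
  choose L hL hlim using hex
  let Λ : H →ₗ⋆[ℂ] H →ₗ[ℂ] ℂ := LinearMap.mk₂'ₛₗ (starRingEnd ℂ) (RingHom.id ℂ) L
    (fun ξ₁ ξ₂ ζ => tendsto_nhds_unique (hlim _ _) <|
      ((hlim ξ₁ ζ).add (hlim ξ₂ ζ)).congr fun n => (inner_add_left _ _ _).symm)
    (fun z ξ ζ => tendsto_nhds_unique (hlim _ _) <|
      ((hlim ξ ζ).const_mul _).congr fun n => (inner_smul_left _ _ _).symm)
    (fun ξ ζ₁ ζ₂ => tendsto_nhds_unique (hlim _ _) <|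
      ((hlim ξ ζ₁).add (hlim ξ ζ₂)).congr fun n => by rw [map_add, inner_add_right])
    (fun z ξ ζ => tendsto_nhds_unique (hlim _ _) <|
      ((hlim ξ ζ).const_mul _).congr fun n => by rw [map_smul, inner_smul_right]; rfl)
  let Λ' : H →L⋆[ℂ] H →L[ℂ] ℂ := Λ.mkContinuous₂ c hL
  refine ⟨star (InnerProductSpace.continuousLinearMapOfBilin Λ'), fun ξ ζ => ?_⟩
  rw [ContinuousLinearMap.inner_star_right, InnerProductSpace.continuousLinearMapOfBilin_apply]
  exact hlim ξ ζ

theorem IsPOVM.norm_le {A : Type*} [Fintype A] {E : A → H →L[ℂ] H} (hE : IsPOVM E) (a : A) :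
    ‖E a‖ ≤ 1 := by
  have h0 : ∀ a, 0 ≤ E a := fun a => (ContinuousLinearMap.nonneg_iff_isPositive _).2 (hE.pos a)
  rw [CStarAlgebra.norm_le_one_iff_of_nonneg _ (h0 a), ← hE.sum_eq]
  exact Finset.single_le_sum (fun a _ => h0 a) (Finset.mem_univ a)

end WeakLimit

/-- As b^op sends σΩ to σ b Ω, the payoff becomes a matrix coefficient of b between fixed vectors,
hence weakly continuous in b. -/
theorem CommutingStrategy.IsTracialEmbedded.re_inner_op {X A H : Type*} [Fintype A]
    [NormedAddCommGroup H] [InnerProductSpace ℂ H] [CompleteSpace H]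
    {S : CommutingStrategy X A H} {T : TracialStandardForm H} {σ : H →L[ℂ] H}
    (hS : S.IsTracialEmbedded T σ) {x : X} {a : A} {b : H →L[ℂ] H} (hb : b ∈ T.M) :
    RCLike.re ⟪S.ψ, (S.alice x a * T.op b) S.ψ⟫_ℂ
      = RCLike.re ⟪(star σ * S.alice x a * σ) T.Ω, b T.Ω⟫_ℂ := by
  have hsa : star (S.alice x a) = S.alice x a :=
    ((S.alice_povm x).pos a).isSelfAdjoint.star_eq
  have h1 : star (star σ * S.alice x a * σ) = star σ * S.alice x a * σ := by
    rw [star_mul, star_mul, star_star, hsa, mul_assoc]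
  rw [← h1, ContinuousLinearMap.inner_star_left, hS.state_eq, mul_apply_eq_comp,
    T.op_apply hb hS.σ_mem]
  change _ = RCLike.re ⟪T.Ω, (star σ) (S.alice x a (σ (b T.Ω)))⟫_ℂ
  rw [ContinuousLinearMap.inner_star_right]
  rfl

/-- The optimal soundness level is attained. -/
theorem CommutingStrategy.hasSoundness_of_forall_lt {X A Y B H : Type*} [Fintype X] [Fintype A]
    [Fintype Y] [Fintype B] [NormedAddCommGroup H] [InnerProductSpace ℂ H] [CompleteSpace H]
    {S : CommutingStrategy X A H} {T : TracialStandardForm H} {σ : H →L[ℂ] H}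
    (hS : S.IsTracialEmbedded T σ) {ρ : X → Y → ℝ} {g : X → Y → A → Finset B} {v : ℝ}
    (h : ∀ ε > 0, S.HasSoundness T ρ g (v - ε)) : S.HasSoundness T ρ g v := by
  choose G hG hGM hGv using fun n : ℕ => h (1 / ((n : ℝ) + 1)) Nat.one_div_pos_of_nat
  -- A nonprincipal ultrafilter makes all matrix coefficients converge at once, without separability
  -- of the Hilbert space. Positivity, the sum condition and commutation with M' all pass to the
  -- limit.
  set l : Ultrafilter ℕ := Filter.hyperfilter ℕ with hl
  have hlt : (l : Filter ℕ) ≤ Filter.atTop := by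
    rw [hl, ← Nat.cofinite_eq_atTop]
    exact Filter.hyperfilter_le_cofinite
  choose R hR using fun y b =>
    exists_weak_limit l (G := fun n => G n y b) fun n => (hG n y).norm_le b
  have hRM : ∀ y b, R y b ∈ T.M := fun y b => by
    rw [VonNeumannAlgebra.mem_iff_commute]
    intro z hz
    refine ContinuousLinearMap.ext fun ζ => ext_inner_left ℂ fun ξ => ?_
    have h1 := hR y b ((star z) ξ) ζ
    have h2 := hR y b ξ (z ζ)
    change ⟪ξ, z (R y b ζ)⟫_ℂ = ⟪ξ, R y b (z ζ)⟫_ℂ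
    rw [← ContinuousLinearMap.inner_star_left]
    refine tendsto_nhds_unique h1 (h2.congr fun n => ?_)
    rw [ContinuousLinearMap.inner_star_left, T.commutant_comm hz (hGM n y b)]
  have hRpos : ∀ y b, (R y b).IsPositive := fun y b => by
    rw [ContinuousLinearMap.isPositive_iff_complex]
    intro ζ
    set K : Set ℂ := {z | ((RCLike.re z : ℝ) : ℂ) = z ∧ 0 ≤ RCLike.re z} with hK
    have hcl : IsClosed K :=
      (isClosed_eq (Complex.continuous_ofReal.comp RCLike.continuous_re) continuous_id).inter
        (isClosed_le continuous_const RCLike.continuous_re)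
    have hconj : ∀ z ∈ K, (starRingEnd ℂ) z ∈ K := fun z hz => by
      rw [← hz.1, Complex.conj_ofReal, hz.1]
      exact hz
    have hmem : ⟪ζ, R y b ζ⟫_ℂ ∈ K := hcl.mem_of_tendsto (hR y b ζ ζ) <|
      Filter.Eventually.of_forall fun n => by
        have := hconj _ ((ContinuousLinearMap.isPositive_iff_complex _).1 ((hG n y).pos b) ζ)
        rwa [inner_conj_symm] at this
    have := hconj _ hmem
    rwa [inner_conj_symm] at this
  have hRsum : ∀ y, ∑ b, R y b = 1 := fun y => by
    refine ContinuousLinearMap.ext fun ζ => ext_inner_left ℂ fun ξ => ?_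
    have h1 : Filter.Tendsto (fun n => ∑ b, ⟪ξ, G n y b ζ⟫_ℂ) l (nhds (∑ b, ⟪ξ, R y b ζ⟫_ℂ)) :=
      tendsto_finsetSum _ fun b _ => hR y b ξ ζ
    have h2 : ∀ n, ∑ b, ⟪ξ, G n y b ζ⟫_ℂ = ⟪ξ, ζ⟫_ℂ := fun n => by
      rw [← inner_sum, ← sum_apply, (hG n y).sum_eq]
      rfl
    simp_rw [h2] at h1
    rw [sum_apply, inner_sum]
    exact tendsto_nhds_unique h1 tendsto_const_nhds
  refine ⟨R, fun y => ⟨hRpos y, hRsum y⟩, hRM, ?_⟩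
  have hval : ∀ (Q : Y → B → H →L[ℂ] H), (∀ y b, Q y b ∈ T.M) → ∑ x, ∑ y, ρ x y *
      ∑ a, RCLike.re ⟪S.ψ, (S.alice x a * T.op (∑ b ∈ g x y a, Q y b)) S.ψ⟫_ℂ
      = ∑ x, ∑ y, ρ x y * ∑ a, ∑ b ∈ g x y a,
        RCLike.re ⟪(star σ * S.alice x a * σ) T.Ω, Q y b T.Ω⟫_ℂ := fun Q hQ => by
    refine Finset.sum_congr rfl fun x _ => Finset.sum_congr rfl fun y _ => congrArg _
      (Finset.sum_congr rfl fun a _ => ?_)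
    rw [hS.re_inner_op (sum_mem fun b _ => hQ y b), sum_apply, inner_sum,
      map_sum]
  rw [hval R hRM]
  have hlim : Filter.Tendsto (fun n => ∑ x, ∑ y, ρ x y * ∑ a, ∑ b ∈ g x y a,
        RCLike.re ⟪(star σ * S.alice x a * σ) T.Ω, G n y b T.Ω⟫_ℂ) l
      (nhds (∑ x, ∑ y, ρ x y * ∑ a, ∑ b ∈ g x y a,
        RCLike.re ⟪(star σ * S.alice x a * σ) T.Ω, R y b T.Ω⟫_ℂ)) := by
    refine tendsto_finsetSum _ fun x _ => tendsto_finsetSum _ fun y _ =>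
      Filter.Tendsto.const_mul _ <| tendsto_finsetSum _ fun a _ => tendsto_finsetSum _ fun b _ => ?_
    exact (RCLike.continuous_re.tendsto _).comp (hR y b _ _)
  have hv : Filter.Tendsto (fun n : ℕ => v - 1 / ((n : ℝ) + 1)) l (nhds (v - 0)) :=
    (tendsto_one_div_add_atTop_nhds_zero_nat.mono_left hlt).const_sub _
  rw [sub_zero] at hv
  refine le_of_tendsto_of_tendsto' hv hlim fun n => ?_
  rw [← hval (G n) (hGM n)]
  exact hGv n

/-- Concavity of the fourth root, obtained from two uses of Cauchy-Schwarz. -/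
theorem sum_mul_sqrt_sqrt_le {ι : Type*} (s : Finset ι) {w d : ι → ℝ} (hw : ∀ i, 0 ≤ w i)
    (hd : ∀ i, 0 ≤ d i) (hs : ∑ i ∈ s, w i ≤ 1) :
    ∑ i ∈ s, w i * √√(d i) ≤ √√(∑ i ∈ s, w i * d i) := by
  have key : ∀ f : ι → ℝ, (∀ i, 0 ≤ f i) → ∑ i ∈ s, w i * √(f i) ≤ √(∑ i ∈ s, w i * f i) := by
    intro f hf
    calc ∑ i ∈ s, w i * √(f i) = ∑ i ∈ s, √(w i) * √(w i * f i) := by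
          refine Finset.sum_congr rfl fun i _ => ?_
          rw [Real.sqrt_mul (hw i), ← mul_assoc, Real.mul_self_sqrt (hw i)]
      _ ≤ √(∑ i ∈ s, w i) * √(∑ i ∈ s, w i * f i) :=
          Real.sum_sqrt_mul_sqrt_le _ hw fun i => mul_nonneg (hw i) (hf i)
      _ ≤ 1 * √(∑ i ∈ s, w i * f i) :=
          mul_le_mul_of_nonneg_right (Real.sqrt_le_one.2 hs) (Real.sqrt_nonneg _)
      _ = _ := one_mul _
  exact (key _ fun i => Real.sqrt_nonneg _).trans (Real.sqrt_le_sqrt (key d hd))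

theorem sqrt_sqrt_eq_rpow {x : ℝ} (hx : 0 ≤ x) : √√x = x ^ (1 / 4 : ℝ) := by
  rw [Real.sqrt_eq_rpow, Real.sqrt_eq_rpow, ← Real.rpow_mul hx]
  norm_num

theorem sqrt_sqrt_le_mul {K x y : ℝ} (hy : 0 ≤ y) (h : x ≤ K * y) :
    √√x ≤ √√(max K 0) * √√y := by
  rw [← Real.sqrt_mul (Real.sqrt_nonneg _), ← Real.sqrt_mul (le_max_right _ _)]
  refine Real.sqrt_le_sqrt (Real.sqrt_le_sqrt (h.trans ?_))
  gcongr
  exact le_max_left _ _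

theorem sum_if_ne {A : Type*} [Fintype A] [DecidableEq A] (f : A → A → ℝ) :
    (∑ a, ∑ b, if a ≠ b then f a b else 0) = ∑ a, ∑ b, f a b - ∑ a, f a a := by
  rw [← Finset.sum_sub_distrib]
  refine Finset.sum_congr rfl fun a _ => ?_
  have h : ∀ b, (if a ≠ b then f a b else 0) = f a b - if a = b then f a b else 0 := fun b => by
    split_ifs with h1 h2 <;> simp_all
  simp_rw [h, Finset.sum_sub_distrib]
  simp

/-! ### Polar form of an embedded strategy, and the theorem -/

section Embedded

variable {X A H : Type*} [Fintype A] [NormedAddCommGroup H] [InnerProductSpace ℂ H]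
  [CompleteSpace H]

/-- The polar form of a tracial embedded strategy: with `σ = h w*`, the statistics are those of
the state `h`, with measurements in `M` on both sides. -/
theorem CommutingStrategy.IsTracialEmbedded.exists_polar_form {S : CommutingStrategy X A H}
    {T : TracialStandardForm H} {σ : H →L[ℂ] H} (hS : S.IsTracialEmbedded T σ) :
    ∃ (E F : X → A → T.M) (h w : T.M), (∀ x a, 0 ≤ E x a) ∧ (∀ x, ∑ a, E x a = 1) ∧
      (∀ x a, 0 ≤ F x a) ∧ (∀ x, ∑ a, F x a = star w * w) ∧ IsStarProjection (star w * w) ∧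
      star w * w * h = h ∧ 0 ≤ h ∧ w * (star w * w) = w ∧ T.tr (h * h) = 1 ∧
      (∀ x y a b, S.corr x y a b = T.tr (h * E x a * h * F y b)) ∧
      ∀ x a (z : T.M), RCLike.re ⟪S.ψ, (S.alice x a * T.op (z : H →L[ℂ] H)) S.ψ⟫_ℂ
        = T.tr (h * E x a * h * (star w * z * w)) := by
  have hτ := T.isTracialState_tr
  let E : X → A → T.M := fun x a => ⟨S.alice x a, hS.alice_mem x a⟩
  have hE0 : ∀ x a, 0 ≤ E x a := fun x a =>
    (ContinuousLinearMap.nonneg_iff_isPositive _).2 ((S.alice_povm x).pos a)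
  have hE1 : ∀ x, ∑ a, E x a = 1 := fun x => Subtype.ext <| by
    rw [AddSubmonoidClass.coe_finsetSum]
    exact (S.alice_povm x).sum_eq
  choose β hβM hβop hβ0 using fun y b =>
    TracialStandardForm.exists_op_eq (T := T) (hS.bob_mem y b)
  let β' : X → A → T.M := fun y b => ⟨β y b, hβM y b⟩
  have hβ'0 : ∀ y b, 0 ≤ β' y b := fun y b =>
    hβ0 y b ((ContinuousLinearMap.nonneg_iff_isPositive _).2 ((S.bob_povm y).pos b))
  have hβ'1 : ∀ y, ∑ b, β' y b = 1 := fun y => Subtype.ext <| by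
    rw [AddSubmonoidClass.coe_finsetSum]
    change ∑ b, β y b = 1
    have h1 : T.op (∑ b, β y b) = 1 := by
      rw [TracialStandardForm.op_sum _ (hβM y)]
      simp_rw [hβop]
      exact (S.bob_povm y).sum_eq
    have h2 := TracialStandardForm.op_apply_Ω (T := T) (sum_mem fun b _ => hβM y b :
      ∑ b, β y b ∈ T.M)
    rw [h1] at h2
    rw [← sub_eq_zero]
    refine T.separating _ (sub_mem (sum_mem fun b _ => hβM y b) (one_mem _)) ?_
    rw [sub_apply, ← h2, sub_self]
  let σ' : T.M := ⟨σ, hS.σ_mem⟩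
  -- The adjoint is decomposed, σ* = w h, so that σ = h w* has its positive factor next to Alice's
  -- operators, while w can be moved around the trace to Bob's side.
  obtain ⟨h, u, hh, hhh, huh, -, hq, hqh, huq⟩ :=
    exists_polar T.M.douglas {()} fun _ : Unit => star σ'
  simp only [Finset.sum_singleton, Finset.mem_singleton, star_star] at hhh huh hq hqh huq
  set w := u () with hw
  replace huh := huh () trivial
  replace huq := huq () trivial
  have hσ : σ' = h * star w := by
    have := congrArg star huh
    rw [star_mul, hh.isSelfAdjoint.star_eq, star_star] at this
    exact this.symm
  have hval : ∀ x a (z : T.M), RCLike.re ⟪S.ψ, (S.alice x a * T.op (z : H →L[ℂ] H)) S.ψ⟫_ℂ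
        = T.tr (h * E x a * h * (star w * z * w)) := fun x a z => by
    rw [hS.re_inner_op z.2]
    have h1 : star (star σ' * E x a * σ') = star σ' * E x a * σ' := by
      rw [star_mul, star_mul, star_star, (hE0 x a).isSelfAdjoint.star_eq, mul_assoc]
    have h2 : RCLike.re ⟪(star σ * S.alice x a * σ) T.Ω, (z : H →L[ℂ] H) T.Ω⟫_ℂ
        = T.tr (star σ' * E x a * σ' * z) := by
      rw [← h1]
      exact congrArg (fun c : ℂ => RCLike.re c)
        (ContinuousLinearMap.inner_star_right (star σ * S.alice x a * σ) _ _).symm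
    rw [h2, ← huh, hσ]
    have e1 : w * h * E x a * (h * star w) * z = w * (h * E x a * h * (star w * z)) := by
      simp only [mul_assoc]
    rw [e1, hτ.mul_comm]
    simp only [mul_assoc]
  refine ⟨E, fun y b => star w * β' y b * w, h, w, hE0, hE1,
    fun y b => star_left_conjugate_nonneg (hβ'0 y b) w, fun y => ?_, hq, hqh, hh, huq, ?_,
    fun x y a b => ?_, hval⟩
  · rw [← Finset.sum_mul, ← Finset.mul_sum, hβ'1, mul_one]
  · rw [hhh, hτ.mul_comm, TracialStandardForm.tr_apply]
    have h1 := ContinuousLinearMap.re_inner_star_mul_self σ T.Ω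
    rw [← hS.state_eq, S.norm_ψ, one_pow] at h1
    exact h1
  · rw [← hval x a (β' y b)]
    change _ = RCLike.re ⟪S.ψ, (S.alice x a * T.op (β y b)) S.ψ⟫_ℂ
    rw [hβop]
    rfl

end Embedded

/-- Answers weighted by a bipartite distribution: averages of the fourth root of the
disagreement. -/
theorem sum_sum_mul_sqrt_sqrt_le {X Y : Type*} [Fintype X] [Fintype Y] {p : X → Y → ℝ}
    (hp : ∀ x y, 0 ≤ p x y) (hp1 : ∑ x, ∑ y, p x y = 1) {d : X → ℝ} (hd : ∀ x, 0 ≤ d x)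
    {K δ : ℝ} (hδ : 0 ≤ δ) (h : ∑ x, (∑ y, p x y) * d x ≤ K * δ) :
    ∑ x, ∑ y, p x y * √√(d x) ≤ √√(max K 0) * √√δ := by
  simp_rw [← Finset.sum_mul]
  exact (sum_mul_sqrt_sqrt_le _ (fun x => Finset.sum_nonneg fun y _ => hp x y) hd hp1.le).trans
    (sqrt_sqrt_le_mul hδ h)

theorem corollary5p1 :
    ∃ q : ℝ, 0 < q ∧ ∀ K L : ℝ, ∃ c : ℝ, 0 < c ∧
      ∀ (X A Y B : Type v) [Fintype X] [Fintype A] [Fintype Y] [Fintype B] [DecidableEq A]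
        -- a synchronous game; the second marginal of `μ` is at most `L` times the first
        (𝓖 : NonlocalGame X A) (_ : 𝓖.IsSynchronous)
        (_ : ∀ x, ∑ y, 𝓖.μ y x ≤ L * ∑ y, 𝓖.μ x y)
        -- a distribution on `X × Y` under which disagreement is controlled by synchronicity
        (ρ : X → Y → ℝ) (_ : ∀ x y, 0 ≤ ρ x y) (_ : ∑ x, ∑ y, ρ x y = 1)
        (_ : ∀ δ : ℝ, ∀ C ∈ commutingCorr.{u, v} X A, 𝓖.synchronicity C ≤ δ →
          ∑ x, (∑ y, ρ x y) * disagreement C x ≤ K * δ)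
        (g : X → Y → A → Finset B)
        (_ : ∀ x y a a', a ≠ a' → Disjoint (g x y a) (g x y a'))
        (κ : ℝ → ℝ) (_ : ConvexOn ℝ (Set.Icc 0 1) κ) (_ : MonotoneOn κ (Set.Icc 0 1))
        (_ : ∀ t ∈ Set.Icc (0 : ℝ) 1, 0 ≤ κ t)
        (c₀ : ℝ) (_ : 0 < c₀)
        -- the soundness property holds for all synchronous strategies
        (_ : ∀ (H : Type u) [NormedAddCommGroup H] [InnerProductSpace ℂ H] [CompleteSpace H]
          (T : TracialStandardForm H) (S : CommutingStrategy X A H), S.IsTracialSynchronous T →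
            S.HasSoundness T ρ g (c₀ * κ (𝓖.winProb S.corr))),
        -- it extends to all tracial embedded strategies that are `δ`-synchronous
        ∀ (δ : ℝ) (H : Type u) [NormedAddCommGroup H] [InnerProductSpace ℂ H] [CompleteSpace H]
          (T : TracialStandardForm H) (σ : H →L[ℂ] H) (S : CommutingStrategy X A H),
          S.IsTracialEmbedded T σ → 𝓖.synchronicity S.corr ≤ δ →
            S.HasSoundness T ρ g
              (c₀ * κ (max 0 (𝓖.winProb S.corr - c * δ ^ q)) - c * δ ^ (1 / 8 : ℝ)) := by
  -- The exponent 1/4 is the double square root. In the constant, K pays for the ρ-average of the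
  -- soundness loss; 2520 and the term with L pay for the two marginals of μ in the winning
  -- probability. Negative K or L are replaced by 0.
  refine ⟨1 / 4, by norm_num, fun K L =>
    ⟨2520 * √√(max K 0) + 2520 + 2533 * √√(max L 0) + 1, by positivity, ?_⟩⟩
  intro X A Y B _ _ _ _ _ 𝓖 _ hL ρ hρ hρ1 hK g _ κ hκ hmono hκ0 c₀ hc₀ hsound δ H _ _ _ T σ S hS
    hδ
  set c := 2520 * √√(max K 0) + 2520 + 2533 * √√(max L 0) + 1 with hc
  have hsnd : SynchronousSoundness.{u, v} 𝓖 ρ g κ c₀ := hsound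
  have hτ := T.isTracialState_tr
  obtain ⟨E, F, h, w, hE0, hE1, hF0, hF1, hq, hqh, hh, hwq, hh1, hcorr, hval⟩ :=
    hS.exists_polar_form
  have hhq : h * (star w * w) = h := by
    have := congrArg star hqh
    rwa [star_mul, hh.isSelfAdjoint.star_eq, hq.isSelfAdjoint.star_eq] at this
  have hC0 : ∀ x y a b, 0 ≤ S.corr x y a b := fun x y a b => by
    rw [hcorr]
    exact hτ.mul_nonneg (hh.isSelfAdjoint.conjugate_nonneg (hE0 x a)) (hF0 y b)
  have hC1 : ∀ x y, ∑ a, ∑ b, S.corr x y a b = 1 := fun x y => by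
    simp_rw [hcorr]
    rw [sum_sum_joint (hE1 x) (hF1 y) hhq, hh1]
  set d : X → ℝ := fun x => disagreement S.corr x with hddef
  have hd : ∀ x, d x = 1 - ∑ a, T.tr (h * E x a * h * F x a) := fun x => by
    simp only [hddef, disagreement]
    rw [sum_if_ne, hC1]
    simp_rw [hcorr]
  have hd0 : ∀ x, 0 ≤ d x := fun x => Finset.sum_nonneg fun a _ => Finset.sum_nonneg fun b _ => by
    split_ifs
    exacts [hC0 _ _ _ _, le_rfl]
  have hd1 : ∀ x, d x ≤ 1 := fun x => by
    rw [hd, sub_le_self_iff]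
    exact Finset.sum_nonneg fun a _ => by
      rw [← hcorr]
      exact hC0 _ _ _ _
  set δ₀ := 𝓖.synchronicity S.corr with hδ₀
  have hδ₀d : δ₀ = ∑ x, (∑ y, 𝓖.μ x y) * d x := rfl
  have hμ1 : ∀ x, 0 ≤ ∑ y, 𝓖.μ x y := fun x => Finset.sum_nonneg fun y _ => 𝓖.μ_nonneg x y
  have hδ₀0 : 0 ≤ δ₀ := Finset.sum_nonneg fun x _ => mul_nonneg (hμ1 x) (hd0 x)
  have hδ₀1 : δ₀ ≤ 1 := by
    rw [hδ₀d, ← 𝓖.μ_sum]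
    exact Finset.sum_le_sum fun x _ => mul_le_of_le_one_right (hμ1 x) (hd1 x)
  have hδ0 : 0 ≤ δ := hδ₀0.trans hδ
  have hr : √√δ₀ ≤ δ ^ (1 / 4 : ℝ) := by
    rw [sqrt_sqrt_eq_rpow hδ₀0]
    exact Real.rpow_le_rpow hδ₀0 hδ (by norm_num)
  -- The given δ may exceed 1, so the exponent is lowered for the actual synchronicity δ₀ ≤ 1 before
  -- passing to δ.
  have hr' : √√δ₀ ≤ δ ^ (1 / 8 : ℝ) := by
    rw [sqrt_sqrt_eq_rpow hδ₀0]
    rcases hδ₀0.eq_or_lt with h0 | h0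
    · rw [← h0, Real.zero_rpow (by norm_num)]
      exact Real.rpow_nonneg hδ0 _
    · exact (Real.rpow_le_rpow_of_exponent_ge h0 hδ₀1 (by norm_num)).trans
        (Real.rpow_le_rpow hδ₀0 hδ (by norm_num))
  have hr0 : 0 ≤ √√δ₀ := Real.sqrt_nonneg _
  have hKn : 0 ≤ √√(max K 0) := Real.sqrt_nonneg _
  have hLn : 0 ≤ √√(max L 0) := Real.sqrt_nonneg _
  have hρd : ∑ x, ∑ y, ρ x y * √√(d x) ≤ √√(max K 0) * √√δ₀ :=
    sum_sum_mul_sqrt_sqrt_le hρ hρ1 hd0 hδ₀0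
      (hK δ₀ S.corr ⟨H, inferInstance, inferInstance, inferInstance, S, rfl⟩ le_rfl)
  have hμd : ∑ x, ∑ y, 𝓖.μ x y * √√(d x) ≤ √√δ₀ := by
    have := sum_sum_mul_sqrt_sqrt_le 𝓖.μ_nonneg 𝓖.μ_sum hd0 hδ₀0 (K := 1)
      (by rw [one_mul, hδ₀d])
    simpa using this
  have hμ2 : ∑ y, (∑ x, 𝓖.μ x y) * d y ≤ L * δ₀ := by
    rw [hδ₀d, Finset.mul_sum]
    refine Finset.sum_le_sum fun x _ => ?_
    rw [← mul_assoc]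
    exact mul_le_mul_of_nonneg_right (hL x) (hd0 x)
  have hμd2 : ∑ x, ∑ y, 𝓖.μ x y * √√(d y) ≤ √√(max L 0) * √√δ₀ := by
    rw [Finset.sum_comm]
    exact sum_sum_mul_sqrt_sqrt_le (p := fun y x => 𝓖.μ x y) (fun y x => 𝓖.μ_nonneg x y)
      (by rw [Finset.sum_comm]; exact 𝓖.μ_sum) hd0 hδ₀0 hμ2
  have hω : 𝓖.winProb S.corr ∈ Set.Icc (0 : ℝ) 1 := 𝓖.winProb_mem_Icc hC0 fun x y => (hC1 x y).le
  set ω := 𝓖.winProb S.corr with hωdef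
  have hωeq : ω = ∑ x, ∑ y, 𝓖.μ x y *
      ∑ a, ∑ b, (if 𝓖.V x y a b = true then T.tr (h * E x a * h * F y b) else 0) := by
    rw [hωdef, NonlocalGame.winProb]
    simp_rw [hcorr]
  have hcpos : 0 < c := by positivity
  have hδq : 0 ≤ c * δ ^ (1 / 4 : ℝ) := mul_nonneg hcpos.le (Real.rpow_nonneg hδ0 _)
  have hm : max 0 (ω - c * δ ^ (1 / 4 : ℝ)) ∈ Set.Icc (0 : ℝ) 1 :=
    ⟨le_max_left _ _, max_le zero_le_one (by linarith [hω.2])⟩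
  have hA : Nonempty A := by
    by_contra hA
    rw [not_nonempty_iff] at hA
    have hX : Nonempty X := by
      by_contra hX
      rw [not_nonempty_iff] at hX
      have := 𝓖.μ_sum
      simp at this
    have := hC1 hX.some hX.some
    simp at this
  have hcase : max 0 (ω - c * δ ^ (1 / 4 : ℝ)) = 0 ∨ (max 0 (ω - c * δ ^ (1 / 4 : ℝ)) < 1 ∧
      max 0 (ω - c * δ ^ (1 / 4 : ℝ)) ≤ ∑ x, ∑ y, 𝓖.μ x y *
        (∑ a, ∑ b, (if 𝓖.V x y a b = true then T.tr (h * E x a * h * F y b) else 0)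
          - 2520 * √√(d x) - 2533 * √√(d y))) ∨
      ∀ x y, 𝓖.μ x y ≠ 0 → d x = 0 ∧ d y = 0 ∧
        ∀ a b, 𝓖.V x y a b ≠ true → T.tr (h * E x a * h * F y b) = 0 := by
    rcases le_or_gt (ω - c * δ ^ (1 / 4 : ℝ)) 0 with h0 | h0
    · exact Or.inl (max_eq_left h0)
    rw [max_eq_right h0.le]
    refine Or.inr ?_
    rcases lt_or_ge (ω - c * δ ^ (1 / 4 : ℝ)) 1 with h1 | h1
    · refine Or.inl ⟨h1, ?_⟩
      have e1 : ∑ x, ∑ y, 𝓖.μ x y *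
          (∑ a, ∑ b, (if 𝓖.V x y a b = true then T.tr (h * E x a * h * F y b) else 0)
            - 2520 * √√(d x) - 2533 * √√(d y))
          = ω - 2520 * ∑ x, ∑ y, 𝓖.μ x y * √√(d x) - 2533 * ∑ x, ∑ y, 𝓖.μ x y * √√(d y) := by
        rw [hωeq]
        simp_rw [mul_sub, Finset.sum_sub_distrib, Finset.mul_sum]
        congr 1
        · congr 1
          refine Finset.sum_congr rfl fun x _ => Finset.sum_congr rfl fun y _ => ?_
          ring
        · refine Finset.sum_congr rfl fun x _ => Finset.sum_congr rfl fun y _ => ?_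
          ring
      rw [e1]
      have e2 : c * √√δ₀ ≤ c * δ ^ (1 / 4 : ℝ) := mul_le_mul_of_nonneg_left hr hcpos.le
      have e3 : c * √√δ₀ = 2520 * (√√(max K 0) * √√δ₀) + 2520 * √√δ₀
          + 2533 * (√√(max L 0) * √√δ₀) + √√δ₀ := by rw [hc]; ring
      have e4 : 0 ≤ √√(max K 0) * √√δ₀ := mul_nonneg hKn hr0
      linarith
    -- Level 1 forces winning probability 1 and δ = 0. Both marginal averages of d and the losing
    -- mass then vanish, and each is a sum of nonnegative terms.
    · refine Or.inr fun x y hxy => ?_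
      have hω1 : ω = 1 := le_antisymm hω.2 (by linarith)
      have hr1 : √√δ₀ ≤ 0 := by
        have : c * δ ^ (1 / 4 : ℝ) ≤ c * 0 := by linarith
        exact hr.trans (le_of_mul_le_mul_left this hcpos)
      have hδz : δ₀ = 0 := by
        have := (Real.sqrt_eq_zero (Real.sqrt_nonneg δ₀)).1 (le_antisymm hr1 hr0)
        exact (Real.sqrt_eq_zero hδ₀0).1 this
      have hxpos : 0 < 𝓖.μ x y := lt_of_le_of_ne (𝓖.μ_nonneg x y) (Ne.symm hxy)
      have hμx : 0 < ∑ y, 𝓖.μ x y :=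
        hxpos.trans_le (Finset.single_le_sum (fun y _ => 𝓖.μ_nonneg x y) (Finset.mem_univ y))
      have hμy : 0 < ∑ x, 𝓖.μ x y :=
        hxpos.trans_le (Finset.single_le_sum (f := fun x => 𝓖.μ x y)
          (fun x _ => 𝓖.μ_nonneg x y) (Finset.mem_univ x))
      have hμy0 : ∀ y, 0 ≤ ∑ x, 𝓖.μ x y := fun y => Finset.sum_nonneg fun x _ => 𝓖.μ_nonneg x y
      have hz1 := (Finset.sum_eq_zero_iff_of_nonneg fun x _ => mul_nonneg (hμ1 x) (hd0 x)).1
        (hδ₀d.symm.trans hδz) x (Finset.mem_univ x)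
      rw [hδz, mul_zero] at hμ2
      have hz2 := (Finset.sum_eq_zero_iff_of_nonneg fun y _ => mul_nonneg (hμy0 y) (hd0 y)).1
        (le_antisymm hμ2 (Finset.sum_nonneg fun y _ => mul_nonneg (hμy0 y) (hd0 y))) y
        (Finset.mem_univ y)
      refine ⟨(mul_eq_zero.1 hz1).resolve_left hμx.ne', (mul_eq_zero.1 hz2).resolve_left hμy.ne',
        fun a b hV => ?_⟩
      have hnn : ∀ x y a b, 0 ≤ (if 𝓖.V x y a b = true then 0 else S.corr x y a b) :=
        fun x y a b => by
          split_ifs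
          exacts [le_rfl, hC0 _ _ _ _]
      have hlose : ∑ x, ∑ y, 𝓖.μ x y *
          ∑ a, ∑ b, (if 𝓖.V x y a b = true then 0 else S.corr x y a b) = 0 := by
        have : ∀ x y, ∑ a, ∑ b, (if 𝓖.V x y a b = true then 0 else S.corr x y a b)
            = 1 - ∑ a, ∑ b, (if 𝓖.V x y a b = true then S.corr x y a b else 0) := fun x y => by
          rw [← hC1 x y, ← Finset.sum_sub_distrib]
          refine Finset.sum_congr rfl fun a _ => ?_
          rw [← Finset.sum_sub_distrib]
          refine Finset.sum_congr rfl fun b _ => ?_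
          split_ifs <;> simp
        simp_rw [this, mul_sub, Finset.sum_sub_distrib, mul_one]
        rw [𝓖.μ_sum, sub_eq_zero, ← hω1]
        rfl
      have hn1 : ∀ x y, 0 ≤ 𝓖.μ x y *
          ∑ a, ∑ b, (if 𝓖.V x y a b = true then 0 else S.corr x y a b) := fun x y =>
        mul_nonneg (𝓖.μ_nonneg x y) (Finset.sum_nonneg fun a _ => Finset.sum_nonneg fun b _ =>
          hnn x y a b)
      have l1 := (Finset.sum_eq_zero_iff_of_nonneg fun x _ =>
        Finset.sum_nonneg fun y _ => hn1 x y).1 hlose x (Finset.mem_univ x)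
      have l2 := (Finset.sum_eq_zero_iff_of_nonneg fun y _ => hn1 x y).1 l1 y (Finset.mem_univ y)
      have l3 := (mul_eq_zero.1 l2).resolve_left hxy
      have l4 := (Finset.sum_eq_zero_iff_of_nonneg fun a _ =>
        Finset.sum_nonneg fun b _ => hnn x y a b).1 l3 a (Finset.mem_univ a)
      have l5 := (Finset.sum_eq_zero_iff_of_nonneg fun b _ => hnn x y a b).1 l4 b
        (Finset.mem_univ b)
      rw [if_neg hV] at l5
      rw [← hcorr]
      exact l5
  refine CommutingStrategy.hasSoundness_of_forall_lt hS fun ε hε => ?_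
  obtain ⟨R, hR0, hR1, hle⟩ := hsnd.exists_approx hρ hρ1 hκ hmono hc₀ T hE0 hE1 hF0 hF1 hq hqh hh
    hwq hh1 hd hm hcase hε
  refine ⟨fun y b => R y b, fun y => TracialStandardForm.isPOVM_coe (hR0 y) (hR1 y),
    fun y b => (R y b).2, ?_⟩
  have hR : ∀ x y a, RCLike.re ⟪S.ψ, (S.alice x a *
      T.op (∑ b ∈ g x y a, (R y b : H →L[ℂ] H))) S.ψ⟫_ℂ
      = T.tr (h * E x a * h * (star w * (∑ b ∈ g x y a, R y b) * w)) := fun x y a => by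
    rw [← hval x a, AddSubmonoidClass.coe_finsetSum]
  simp_rw [hR]
  refine le_trans ?_ hle
  have e1 : c * √√δ₀ ≤ c * δ ^ (1 / 8 : ℝ) := mul_le_mul_of_nonneg_left hr' hcpos.le
  have e3 : c * √√δ₀ = 2520 * (√√(max K 0) * √√δ₀) + 2520 * √√δ₀
      + 2533 * (√√(max L 0) * √√δ₀) + √√δ₀ := by rw [hc]; ring
  have e4 : 0 ≤ √√(max L 0) * √√δ₀ := mul_nonneg hLn hr0
  linarith
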